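/- **Setting.** Let $k,h,n_{cl}>0$ and let $n_{co}:[-h,h]\to\mathbb R$ be bounded, measurable and even. Put $n(x)=n_{co}(x)$ for $|x|\le h$ and $n(x)=n_{cl}$ for $|x|>h$, and $$n_*=\sup_{\mathbb R} n,\quad q(x)=k^2\,(n_*^2-n(x)^2),\quad d^2=k^2\,(n_*^2-n_{cl}^2),\quad \beta_0=k\,n_{cl}.$$ For $j\in\{s,a\}$ and $\lambda>d^2$ let $\phi_j(\cdot,\lambda)$ be the solution on $[-h,h]$ of $\phi''+[\lambda-q(x)]\phi=0$ (with $\phi'$ absolutely continuous) such that $$\phi_s(0,\lambda)=1,\quad \phi_s'(0,\lambda)=0,\qquad \phi_a(0,\lambda)=0,\quad \phi_a'(0,\lambda)=\sqrt\lambda .$$ With $Q=\sqrt{\lambda-d^2}$ set $$v_j(x,\lambda)=\begin{cases}\phi_j(h,\lambda)\cos Q(x-h)+\frac{\phi_j'(h,\lambda)}{Q}\sin Q(x-h), & x>h,\\ \phi_j(x,\lambda), & |x|\le h,\\ \phi_j(-h,\lambda)\cos Q(x+h)+\frac{\phi_j'(-h,\lambda)}{Q}\sin Q(x+h), & x<-h,\end{cases}$$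 $$\sigma_j(\lambda)=\frac{\lambda-d^2}{(\lambda-d^2)\,\phi_j(h,\lambda)^2+\phi_j'(h,\lambda)^2}.$$ For $z\ne\zeta$ the non-guided part of the Green's function of $\Delta u+k^2n(x)^2u=f$ in $\mathbb R^2$ is $$G^{rad}(x,z;\xi,\zeta)=\frac1{2\pi}\sum_{j\in\{s,a\}}\int_{d^2}^{+\infty}\frac{e^{i|z-\zeta|\sqrt{k^2n_*^2-\lambda}}}{2i\sqrt{k^2n_*^2-\lambda}}\,v_j(x,\lambda)\,v_j(\xi,\lambda)\,\frac{\sigma_j(\lambda)}{\sqrt{\lambda-d^2}}\,d\lambda,$$ where $\sqrt{k^2n_*^2-\lambda}=i\sqrt{\lambda-k^2n_*^2}$ for $\lambda>k^2n_*^2$. Let $[x]_h=x+h$ for $x<-h$, $[x]_h=0$ for $|x|\le h$, $[x]_h=x-h$ for $x>h$. Let $$\Omega_R=\{(x,z)\in\mathbb R^2:\ [x]_h^2+z^2\le R^2\},$$ and let $\nu=([x]_h,z)/R$ be the outward unit normal at $(x,z)\in\partial\Omega_R$. **Theorem.** As $R\to\infty$, $$\frac{\partial G^{rad}}{\partial\nu}-i\beta_0\,G^{rad}=\mathcal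 O\left(R^{-3/2}\right)\quad\text{on }\partial\Omega_R,$$ uniformly with respect to the points of $\partial\Omega_R$ off the line $z=\zeta$ and to $(\xi,\zeta)$ in bounded sets. That is, for every $B$ there are constants $C$ and $R_0>0$, depending only on $B$ and on the waveguide $(k,h,n_{cl},n_{co})$, such that for all $R\ge R_0$, all $\xi,\zeta$ with $|\xi|,|\zeta|\le B$ and all $(x,z)\in\partial\Omega_R$ with $z\ne\zeta$: the two integrals defining $G^{rad}(x,z;\xi,\zeta)$ converge absolutely, the derivative of $G^{rad}(\cdot,\cdot;\xi,\zeta)$ in the direction $\nu$ exists at $(x,z)$, and $$\left|\frac{\partial G^{rad}}{\partial\nu}(x,z;\xi,\zeta)-i\beta_0\,G^{rad}(x,z;\xi,\zeta)\right|\le C\,R^{-3/2}.$$ -/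

import Mathlib

open MeasureTheory Set

/-- `(u, u')` is the solution on `[-h, h]` of the initial value problem
`y'' = w y`, `y 0 = a`, `y' 0 = b`, in the usual (Carathéodory) sense for a bounded measurable
coefficient `w`: `u` is differentiable with derivative `u'`, and `u'` is an absolutely continuous
function, namely a primitive of `w u`. -/
structure IsCaratheodorySolution {𝕜 : Type*} [RCLike 𝕜] (h : ℝ) (w : ℝ → 𝕜) (a b : 𝕜)
    (u u' : ℝ → 𝕜) : Prop where
  value_zero : u 0 = a
  deriv_zero : u' 0 = b
  hasDeriv : ∀ x ∈ Icc (-h) h, HasDerivWithinAt u (u' x) (Icc (-h) h) x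
  deriv_eq : ∀ x ∈ Icc (-h) h, u' x = b + ∫ y in (0:ℝ)..x, w y * u y

theorem norm_primitive_le {𝕜 : Type*} [RCLike 𝕜] {f g : ℝ → 𝕜} {L M : ℝ} {n : ℕ} {x : ℝ}
    (hg : ∀ y, |y| ≤ |x| → ‖g y‖ ≤ L * (M * (L * |y|) ^ n / n.factorial))
    (hf : f x = ∫ y in (0:ℝ)..x, g y) :
    ‖f x‖ ≤ M * (L * |x|) ^ (n + 1) / (n + 1).factorial := by
  have key : ∀ c : ℝ, 0 ≤ c → ∫ y in (0:ℝ)..c, L * (M * (L * y) ^ n / n.factorial)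
      = M * (L * c) ^ (n + 1) / (n + 1).factorial := by
    intro c _
    have : (fun y : ℝ => L * (M * (L * y) ^ n / n.factorial))
        = fun y => (L * M * L ^ n / n.factorial) * y ^ n := by
      funext y; rw [mul_pow]; ring
    rw [this, intervalIntegral.integral_const_mul, integral_pow, Nat.factorial_succ]
    push_cast
    have h1 : (n.factorial : ℝ) ≠ 0 := by positivity
    have h2 : (n : ℝ) + 1 ≠ 0 := by positivity
    field_simp
    ring
  rw [hf]
  rcases le_total 0 x with hx | hx
  · rw [abs_of_nonneg hx, ← key x hx]
    refine intervalIntegral.norm_integral_le_of_norm_le hx ?_ ?_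
    · refine Filter.Eventually.of_forall fun y hy => ?_
      have := hg y (by rw [abs_of_pos hy.1, abs_of_nonneg hx]; exact hy.2)
      rwa [abs_of_pos hy.1] at this
    · exact Continuous.intervalIntegrable (by fun_prop) _ _
  · rw [abs_of_nonpos hx, ← key (-x) (by linarith)]
    have e : ∫ y in (0:ℝ)..x, g y = - ∫ y in (0:ℝ)..(-x), g (-y) := by
      rw [intervalIntegral.integral_comp_neg]; simp [intervalIntegral.integral_symm x 0]
    rw [e, norm_neg]
    refine intervalIntegral.norm_integral_le_of_norm_le (by linarith) ?_ ?_
    · refine Filter.Eventually.of_forall fun y hy => ?_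
      have := hg (-y) (by rw [abs_neg, abs_of_pos hy.1, abs_of_nonpos hx]; exact hy.2)
      rwa [abs_neg, abs_of_pos hy.1] at this
    · exact Continuous.intervalIntegrable (by fun_prop) _ _

/-- The terms of the Picard series. -/
noncomputable def picardTerm {𝕜 : Type*} [RCLike 𝕜] (w : ℝ → 𝕜) (a b : 𝕜) :
    ℕ → (ℝ → 𝕜) × (ℝ → 𝕜)
  | 0 => (fun _ => a, fun _ => b)
  | n + 1 => (fun x => ∫ y in (0:ℝ)..x, (picardTerm w a b n).2 y,
      fun x => ∫ y in (0:ℝ)..x, w y * (picardTerm w a b n).1 y)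

theorem intervalIntegrable_mul_of_bounded {𝕜 : Type*} [RCLike 𝕜] {w u : ℝ → 𝕜} {K : ℝ}
    (hw : AEStronglyMeasurable w volume) (hK : ∀ x, ‖w x‖ ≤ K) (hu : Continuous u) (s t : ℝ) :
    IntervalIntegrable (fun y => w y * u y) volume s t := by
  rw [intervalIntegrable_iff]
  refine Integrable.bdd_mul (c := K) ((hu.intervalIntegrable s t).def') hw.restrict ?_
  exact Filter.Eventually.of_forall hK

theorem picardTerm_continuous {𝕜 : Type*} [RCLike 𝕜] {w : ℝ → 𝕜} {K : ℝ}
    (hw : AEStronglyMeasurable w volume) (hK : ∀ x, ‖w x‖ ≤ K) (a b : 𝕜) (n : ℕ) :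
    Continuous (picardTerm w a b n).1 ∧ Continuous (picardTerm w a b n).2 := by
  induction n with
  | zero => exact ⟨continuous_const, continuous_const⟩
  | succ n ih =>
    exact ⟨intervalIntegral.continuous_primitive (fun s t => ih.2.intervalIntegrable s t) 0,
      intervalIntegral.continuous_primitive
        (fun s t => intervalIntegrable_mul_of_bounded hw hK ih.1 s t) 0⟩

theorem picardTerm_bound {𝕜 : Type*} [RCLike 𝕜] {w : ℝ → 𝕜} {L : ℝ}
    (hL : 1 ≤ L) (hK : ∀ x, ‖w x‖ ≤ L) (a b : 𝕜) (n : ℕ) (x : ℝ) :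
    ‖(picardTerm w a b n).1 x‖ ≤ (‖a‖ + ‖b‖) * (L * |x|) ^ n / n.factorial ∧
    ‖(picardTerm w a b n).2 x‖ ≤ (‖a‖ + ‖b‖) * (L * |x|) ^ n / n.factorial := by
  induction n generalizing x with
  | zero => simp [picardTerm]
  | succ n ih =>
    refine ⟨norm_primitive_le (fun y _ => ?_) rfl,
      norm_primitive_le (fun y _ => ?_) rfl⟩
    · exact (ih y).2.trans (le_mul_of_one_le_left (by positivity) hL)
    · rw [norm_mul]
      exact mul_le_mul (hK y) (ih y).1 (norm_nonneg _) (by linarith)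

theorem exists_linear_solution {𝕜 : Type*} [RCLike 𝕜] {w : ℝ → 𝕜} {K : ℝ}
    (hw : AEStronglyMeasurable w volume) (hK : ∀ x, ‖w x‖ ≤ K) (a b : 𝕜) :
    ∃ u u' : ℝ → 𝕜, Continuous u ∧ Continuous u' ∧
      (∀ x, u x = a + ∫ y in (0:ℝ)..x, u' y) ∧
      (∀ x, u' x = b + ∫ y in (0:ℝ)..x, w y * u y) := by
  set L := max 1 K
  have hL : 1 ≤ L := le_max_left _ _
  have hKL : ∀ x, ‖w x‖ ≤ L := fun x => (hK x).trans (le_max_right _ _)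
  have hb := picardTerm_bound hL hKL a b
  have hc := picardTerm_continuous hw hK a b
  have hs : ∀ r : ℝ, Summable fun n : ℕ => (‖a‖ + ‖b‖) * (L * r) ^ n / n.factorial := by
    intro r
    simp_rw [mul_div_assoc]
    exact (Real.summable_pow_div_factorial (L * r)).mul_left _
  have mono : ∀ (n : ℕ) (x r : ℝ), |x| ≤ r →
      (‖a‖ + ‖b‖) * (L * |x|) ^ n / n.factorial ≤ (‖a‖ + ‖b‖) * (L * r) ^ n / n.factorial := by
    intro n x r hx; gcongr
  have hs1 : ∀ x, Summable fun n => (picardTerm w a b n).1 x := fun x =>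
    Summable.of_norm_bounded (hs |x|) fun n => (hb n x).1
  have hs2 : ∀ x, Summable fun n => (picardTerm w a b n).2 x := fun x =>
    Summable.of_norm_bounded (hs |x|) fun n => (hb n x).2
  have cont : ∀ f : ℕ → ℝ → 𝕜, (∀ n, Continuous (f n)) →
      (∀ n x, ‖f n x‖ ≤ (‖a‖ + ‖b‖) * (L * |x|) ^ n / n.factorial) →
      Continuous fun x => ∑' n, f n x := by
    intro f hf hfb
    rw [continuous_iff_continuousAt]
    intro x
    have : ContinuousOn (fun x => ∑' n, f n x) (Ioo (-(|x| + 1)) (|x| + 1)) := by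
      refine continuousOn_tsum (fun n => (hf n).continuousOn) (hs (|x| + 1)) fun n y hy => ?_
      exact (hfb n y).trans (mono n y _ (abs_le.2 ⟨hy.1.le, hy.2.le⟩))
    exact this.continuousAt (Ioo_mem_nhds (by linarith [neg_abs_le x]) (by linarith [le_abs_self x]))
  have swap : ∀ (f : ℕ → ℝ → 𝕜) (x : ℝ), (∀ n, Continuous (f n)) →
      (∀ n x, ‖f n x‖ ≤ (‖a‖ + ‖b‖) * (L * |x|) ^ n / n.factorial) →
      ∀ c : ℝ → 𝕜, AEStronglyMeasurable c volume → (∀ y, ‖c y‖ ≤ L) →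
      (∫ y in (0:ℝ)..x, c y * ∑' n, f n y) = ∑' n, ∫ y in (0:ℝ)..x, c y * f n y := by
    intro f x hf hfb c hcm hcb
    refine (intervalIntegral.hasSum_integral_of_dominated_convergence
      (bound := fun n _ => L * ((‖a‖ + ‖b‖) * (L * |x|) ^ n / n.factorial))
      (fun n => ?_) (fun n => ?_) ?_ ?_ ?_).tsum_eq.symm
    · exact (hcm.mul (hf n).aestronglyMeasurable).restrict
    · refine Filter.Eventually.of_forall fun y hy => ?_
      rw [norm_mul]
      refine mul_le_mul (hcb y) ((hfb n y).trans (mono n y _ ?_)) (norm_nonneg _) (by linarith)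
      rcases mem_uIoc.1 hy with h | h
      · rw [abs_of_pos h.1]; exact h.2.trans (le_abs_self x)
      · rw [abs_of_nonpos h.2]; linarith [neg_abs_le x, h.1]
    · exact Filter.Eventually.of_forall fun y _ => (hs |x|).mul_left L
    · exact intervalIntegrable_const
    · refine Filter.Eventually.of_forall fun y _ => ?_
      exact (Summable.of_norm_bounded (hs |y|) fun n => hfb n y).hasSum.mul_left _
  refine ⟨fun x => ∑' n, (picardTerm w a b n).1 x, fun x => ∑' n, (picardTerm w a b n).2 x,
    cont _ (fun n => (hc n).1) fun n x => (hb n x).1,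
    cont _ (fun n => (hc n).2) fun n x => (hb n x).2, fun x => ?_, fun x => ?_⟩
  · have e := swap (fun n => (picardTerm w a b n).2) x
      (fun n => (hc n).2) (fun n x => (hb n x).2) (fun _ => 1) aestronglyMeasurable_const
      (by simpa using hL)
    simp only [one_mul] at e
    rw [e]
    exact (hs1 x).tsum_eq_zero_add
  · rw [swap (fun n => (picardTerm w a b n).1) x
      (fun n => (hc n).1) (fun n x => (hb n x).1) w hw hKL]
    exact (hs2 x).tsum_eq_zero_add

/-- Existence for the initial value problem. -/
theorem exists_isCaratheodorySolution {𝕜 : Type*} [RCLike 𝕜] {h : ℝ} (hh : 0 < h) {w : ℝ → 𝕜}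
    {K : ℝ} (hw : AEStronglyMeasurable w (volume.restrict (Icc (-h) h)))
    (hK : ∀ x ∈ Icc (-h) h, ‖w x‖ ≤ K) (a b : 𝕜) :
    ∃ p : (ℝ → 𝕜) × (ℝ → 𝕜), IsCaratheodorySolution h w a b p.1 p.2 := by
  have hK0 : 0 ≤ K := (norm_nonneg _).trans (hK 0 ⟨by linarith, hh.le⟩)
  obtain ⟨u, u', hu, hu', h1, h2⟩ := exists_linear_solution (w := (Icc (-h) h).indicator w) (K := K)
    ((aestronglyMeasurable_indicator_iff measurableSet_Icc).2 hw)
    (fun x => by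
      by_cases hx : x ∈ Icc (-h) h
      · rw [indicator_of_mem hx]; exact hK x hx
      · rw [indicator_of_notMem hx]; simpa using hK0) a b
  refine ⟨(u, u'), ⟨by simpa using h1 0, by simpa using h2 0, fun x _ => ?_, fun x hx => ?_⟩⟩
  · have : HasDerivAt u (u' x) x := by
      rw [show u = fun x => a + ∫ y in (0:ℝ)..x, u' y from funext h1]
      exact (hu'.integral_hasStrictDerivAt 0 x).hasDerivAt.const_add a
    exact this.hasDerivWithinAt
  · have e := h2 x
    simp only at e ⊢
    rw [e]
    congr 1
    refine intervalIntegral.integral_congr fun y hy => ?_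
    have hy' : y ∈ Icc (-h) h :=
      (uIcc_subset_Icc ⟨by linarith, hh.le⟩ hx) hy
    simp only [indicator_of_mem hy']

/-- Uniqueness for the initial value problem. -/
theorem isCaratheodorySolution_unique {𝕜 : Type*} [RCLike 𝕜] {h : ℝ} (hh : 0 < h) {w : ℝ → 𝕜}
    {K : ℝ} (hw : AEStronglyMeasurable w (volume.restrict (Icc (-h) h)))
    (hK : ∀ x ∈ Icc (-h) h, ‖w x‖ ≤ K) {a b : 𝕜} {u u' v v' : ℝ → 𝕜}
    (hu : IsCaratheodorySolution h w a b u u') (hv : IsCaratheodorySolution h w a b v v') :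
    ∀ x ∈ Icc (-h) h, u x = v x ∧ u' x = v' x := by
  have h0 : (0:ℝ) ∈ Icc (-h) h := ⟨by linarith, hh.le⟩
  have cu : ContinuousOn u (Icc (-h) h) := fun x hx => (hu.hasDeriv x hx).continuousWithinAt
  have cv : ContinuousOn v (Icc (-h) h) := fun x hx => (hv.hasDeriv x hx).continuousWithinAt
  have sub : ∀ x ∈ Icc (-h) h, uIcc 0 x ⊆ Icc (-h) h := fun x hx => uIcc_subset_Icc h0 hx
  have ii : ∀ f : ℝ → 𝕜, ContinuousOn f (Icc (-h) h) →
      IntegrableOn (fun y => w y * f y) (Icc (-h) h) := fun f hf =>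
    Integrable.bdd_mul (c := K) hf.integrableOn_Icc hw
      ((ae_restrict_iff' measurableSet_Icc).2 (Filter.Eventually.of_forall hK))
  have ii' : ∀ f : ℝ → 𝕜, ContinuousOn f (Icc (-h) h) → ∀ x ∈ Icc (-h) h,
      IntervalIntegrable (fun y => w y * f y) volume 0 x := fun f hf x hx =>
    ((ii f hf).mono_set (sub x hx)).intervalIntegrable
  have cd : ∀ f f' : ℝ → 𝕜, IsCaratheodorySolution h w a b f f' →
      ContinuousOn f' (Icc (-h) h) := by
    intro f f' hf
    have cf : ContinuousOn f (Icc (-h) h) := fun x hx => (hf.hasDeriv x hx).continuousWithinAt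
    have := (ii f cf)
    have c1 : ContinuousOn (fun x => ∫ y in (0:ℝ)..x, w y * f y) (Icc (-h) h) := by
      have := intervalIntegral.continuousOn_primitive_interval' (μ := volume) (a := 0)
        (f := fun y => w y * f y) (b₁ := -h) (b₂ := h)
        ((by rw [← uIcc_of_le (by linarith : -h ≤ h)] at this; exact this.intervalIntegrable))
        (by rw [uIcc_of_le (by linarith)]; exact h0)
      rwa [uIcc_of_le (by linarith)] at this
    exact (continuousOn_const.add c1).congr fun x hx => hf.deriv_eq x hx
  have cu' := cd u u' hu
  have cv' := cd v v' hv
  have prim : ∀ f f' : ℝ → 𝕜, IsCaratheodorySolution h w a b f f' → ∀ x ∈ Icc (-h) h,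
      ∫ y in (0:ℝ)..x, f' y = f x - a := by
    intro f f' hf x hx
    have cf : ContinuousOn f (Icc (-h) h) := fun x hx => (hf.hasDeriv x hx).continuousWithinAt
    have hi : IntervalIntegrable f' volume 0 x := ((cd f f' hf).mono (sub x hx)).intervalIntegrable
    have hd : ∀ y ∈ Ioo (min 0 x) (max 0 x), HasDerivAt f (f' y) y := by
      intro y hy
      have hy' : y ∈ Ioo (-h) h := by
        refine ⟨lt_of_le_of_lt ?_ hy.1, lt_of_lt_of_le hy.2 ?_⟩
        · exact le_min (by linarith) hx.1
        · exact max_le hh.le hx.2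
      exact (hf.hasDeriv y (Ioo_subset_Icc_self hy')).hasDerivAt (Icc_mem_nhds hy'.1 hy'.2)
    have := intervalIntegral.integral_eq_sub_of_hasDeriv_right (cf.mono (sub x hx))
      (fun y hy => (hd y hy).hasDerivWithinAt) hi
    rw [this, hf.value_zero]
  obtain ⟨M1, hM1⟩ := (isCompact_Icc (a := -h) (b := h)).exists_bound_of_continuousOn (cu.sub cv)
  obtain ⟨M2, hM2⟩ := (isCompact_Icc (a := -h) (b := h)).exists_bound_of_continuousOn (cu'.sub cv')
  set M := max M1 M2
  set L := max 1 K
  have hM : 0 ≤ M := (norm_nonneg _).trans ((hM1 0 h0).trans (le_max_left _ _))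
  have hL : 1 ≤ L := le_max_left _ _
  have hsym : ∀ x ∈ Icc (-h) h, ∀ y : ℝ, |y| ≤ |x| → y ∈ Icc (-h) h := fun x hx y hy =>
    abs_le.1 (hy.trans (abs_le.2 hx))
  have bd : ∀ n : ℕ, ∀ x ∈ Icc (-h) h,
      ‖u x - v x‖ ≤ M * (L * |x|) ^ n / n.factorial ∧
      ‖u' x - v' x‖ ≤ M * (L * |x|) ^ n / n.factorial := by
    intro n
    induction n with
    | zero =>
      intro x hx
      simpa using ⟨(hM1 x hx).trans (le_max_left M1 M2), (hM2 x hx).trans (le_max_right M1 M2)⟩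
    | succ n ih =>
      intro x hx
      constructor
      · refine norm_primitive_le (f := fun x => u x - v x) (g := fun y => u' y - v' y) (fun y hy => ?_) ?_
        · exact (ih y (hsym x hx y hy)).2.trans (le_mul_of_one_le_left (by positivity) hL)
        · rw [intervalIntegral.integral_sub ((cu'.mono (sub x hx)).intervalIntegrable)
            ((cv'.mono (sub x hx)).intervalIntegrable), prim u u' hu x hx, prim v v' hv x hx]
          ring
      · refine norm_primitive_le (f := fun x => u' x - v' x) (g := fun y => w y * (u y - v y)) (fun y hy => ?_) ?_
        · rw [norm_mul]
          exact mul_le_mul ((hK y (hsym x hx y hy)).trans (le_max_right _ _))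
            (ih y (hsym x hx y hy)).1 (norm_nonneg _) (by linarith)
        · simp_rw [mul_sub]
          rw [intervalIntegral.integral_sub (ii' u cu x hx) (ii' v cv x hx),
            hu.deriv_eq x hx, hv.deriv_eq x hx]
          ring
  have lim : ∀ x : ℝ, Filter.Tendsto (fun n : ℕ => M * (L * |x|) ^ n / n.factorial)
      Filter.atTop (nhds 0) := by
    intro x
    simp_rw [mul_div_assoc]
    simpa using (FloorSemiring.tendsto_pow_div_factorial_atTop (L * |x|)).const_mul M
  intro x hx
  constructor
  · have := ge_of_tendsto' (lim x) fun n => (bd n x hx).1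
    exact sub_eq_zero.1 (norm_le_zero_iff.1 this)
  · have := ge_of_tendsto' (lim x) fun n => (bd n x hx).2
    exact sub_eq_zero.1 (norm_le_zero_iff.1 this)

/-- The data of a symmetric planar open waveguide: the wave number `k`, the half-width `h` of the
core, the constant refraction index `nCl` of the cladding and the bounded measurable even
refraction index `nCo` of the core (only its values on `[-h, h]` matter). -/
structure Waveguide where
  k : ℝ
  h : ℝ
  nCl : ℝ
  nCo : ℝ → ℝ
  k_pos : 0 < k
  h_pos : 0 < h
  nCl_pos : 0 < nCl
  nCo_measurable : AEMeasurable nCo (volume.restrict (Icc (-h) h))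
  nCo_bounded : ∃ B : ℝ, ∀ x ∈ Icc (-h) h, |nCo x| ≤ B
  nCo_even : ∀ x ∈ Icc (-h) h, nCo (-x) = nCo x

/-- The two families of modes: symmetric and antisymmetric. -/
inductive Parity where
  | s : Parity
  | a : Parity

/-- `[x]_h`: the signed distance from `x` to `[-h, h]`. -/
noncomputable def outerCoord (h x : ℝ) : ℝ :=
  if x < -h then x + h else if x ≤ h then 0 else x - h

/-- The square root of a real number with non-negative imaginary part
(`√s` if `s ≥ 0` and `i √(-s)` if `s < 0`). -/
noncomputable def outgoingSqrt (s : ℝ) : ℂ :=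
  (Real.sqrt s : ℂ) + Complex.I * (Real.sqrt (-s) : ℂ)

namespace Waveguide

/-- The index of refraction `n`. -/
noncomputable def index (W : Waveguide) (x : ℝ) : ℝ :=
  if |x| ≤ W.h then W.nCo x else W.nCl

/-- `n_* = max n`, as a supremum. -/
noncomputable def nStar (W : Waveguide) : ℝ := ⨆ x : ℝ, W.index x

/-- `d² = k² (n_*² - n_cl²)`. -/
noncomputable def dSq (W : Waveguide) : ℝ := W.k ^ 2 * (W.nStar ^ 2 - W.nCl ^ 2)

/-- `q(x) = k² (n_*² - n(x)²)`. -/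
noncomputable def q (W : Waveguide) (x : ℝ) : ℝ :=
  W.k ^ 2 * (W.nStar ^ 2 - W.index x ^ 2)

/-- `β₀ = k n_cl`. -/
noncomputable def beta0 (W : Waveguide) : ℝ := W.k * W.nCl

/-- The prescribed value `φ_j(0, λ)`. -/
noncomputable def initValue (j : Parity) : ℝ :=
  match j with
  | .s => 1
  | .a => 0

/-- The prescribed derivative `φ_j'(0, λ)`. -/
noncomputable def initDeriv (j : Parity) (lam : ℝ) : ℝ :=
  match j with
  | .s => 0
  | .a => Real.sqrt lam

theorem coeff_measurable (W : Waveguide) (lam : ℝ) :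
    AEStronglyMeasurable (fun x => W.q x - lam) (volume.restrict (Icc (-W.h) W.h)) := by
  have h1 : AEMeasurable (fun x => W.k ^ 2 * (W.nStar ^ 2 - W.nCo x ^ 2) - lam)
      (volume.restrict (Icc (-W.h) W.h)) :=
    (((W.nCo_measurable.pow_const 2).const_sub _).const_mul _).sub_const _
  refine h1.aestronglyMeasurable.congr ?_
  refine (ae_restrict_iff' measurableSet_Icc).2 (Filter.Eventually.of_forall fun x hx => ?_)
  simp only [q, index, if_pos (abs_le.2 hx)]

theorem coeff_bounded (W : Waveguide) (lam : ℝ) :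
    ∃ K : ℝ, ∀ x ∈ Icc (-W.h) W.h, ‖W.q x - lam‖ ≤ K := by
  obtain ⟨B, hB⟩ := W.nCo_bounded
  refine ⟨W.k ^ 2 * (W.nStar ^ 2 + B ^ 2) + |lam|, fun x hx => ?_⟩
  have h1 : W.nCo x ^ 2 ≤ B ^ 2 := sq_le_sq' (abs_le.1 (hB x hx)).1 (abs_le.1 (hB x hx)).2
  refine (norm_sub_le _ _).trans ?_
  simp only [q, index, if_pos (abs_le.2 hx), Real.norm_eq_abs]
  rw [abs_mul, abs_of_nonneg (sq_nonneg W.k)]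
  have h2 : |W.nStar ^ 2 - W.nCo x ^ 2| ≤ W.nStar ^ 2 + B ^ 2 :=
    abs_le.2 ⟨by nlinarith [sq_nonneg W.nStar], by nlinarith [sq_nonneg (W.nCo x), sq_nonneg B]⟩
  have h3 := mul_le_mul_of_nonneg_left h2 (sq_nonneg W.k)
  linarith

theorem exists_phi (W : Waveguide) (j : Parity) (lam : ℝ) :
    ∃ p : (ℝ → ℝ) × (ℝ → ℝ), IsCaratheodorySolution W.h (fun x => W.q x - lam)
      (initValue j) (initDeriv j lam) p.1 p.2 := by
  obtain ⟨K, hK⟩ := W.coeff_bounded lam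
  exact exists_isCaratheodorySolution W.h_pos (W.coeff_measurable lam) hK _ _

/-- The solution `φ_j(·, λ)` on `[-h, h]` of `v'' + (λ - q) v = 0` with the initial conditions
`φ_s(0) = 1, φ_s'(0) = 0` and `φ_a(0) = 0, φ_a'(0) = √λ`.  It is unique on `[-h, h]` by
`isCaratheodorySolution_unique`. -/
noncomputable def phi (W : Waveguide) (j : Parity) (lam : ℝ) : ℝ → ℝ :=
  (Classical.choose (W.exists_phi j lam)).1

/-- The derivative `φ_j'(·, λ)`. -/
noncomputable def dphi (W : Waveguide) (j : Parity) (lam : ℝ) : ℝ → ℝ :=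
  (Classical.choose (W.exists_phi j lam)).2

theorem phi_spec (W : Waveguide) (j : Parity) (lam : ℝ) :
    IsCaratheodorySolution W.h (fun x => W.q x - lam) (initValue j) (initDeriv j lam)
      (W.phi j lam) (W.dphi j lam) :=
  Classical.choose_spec (W.exists_phi j lam)

/-- The generalized eigenfunction `v_j(x, λ)`, `λ > d²`, with `Q = √(λ - d²)`. -/
noncomputable def v (W : Waveguide) (j : Parity) (x lam : ℝ) : ℝ :=
  let Q := Real.sqrt (lam - W.dSq)
  if W.h < x then
    W.phi j lam W.h * Real.cos (Q * (x - W.h)) +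
      W.dphi j lam W.h / Q * Real.sin (Q * (x - W.h))
  else if x < -W.h then
    W.phi j lam (-W.h) * Real.cos (Q * (x + W.h)) +
      W.dphi j lam (-W.h) / Q * Real.sin (Q * (x + W.h))
  else W.phi j lam x

/-- The spectral density `σ_j(λ)`. -/
noncomputable def sigma (W : Waveguide) (j : Parity) (lam : ℝ) : ℝ :=
  (lam - W.dSq) / ((lam - W.dSq) * W.phi j lam W.h ^ 2 + W.dphi j lam W.h ^ 2)

/-- The integrand of the `j`-th part of `G^rad (x, z; ξ, ζ)`, as a function of `λ`. -/
noncomputable def radIntegrand (W : Waveguide) (j : Parity) (x z ξ ζ lam : ℝ) : ℂ :=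
  let β : ℂ := outgoingSqrt (W.k ^ 2 * W.nStar ^ 2 - lam)
  Complex.exp (Complex.I * (|z - ζ| : ℝ) * β) / (2 * Complex.I * β) *
    ((W.v j x lam * W.v j ξ lam * (W.sigma j lam / Real.sqrt (lam - W.dSq)) : ℝ) : ℂ)

/-- The non-guided part `G^rad (x, z; ξ, ζ)` of the Green's function, for `z ≠ ζ` (where the
integrals over `(d², ∞)` converge absolutely). -/
noncomputable def Grad (W : Waveguide) (x z ξ ζ : ℝ) : ℂ :=
  1 / (2 * (Real.pi : ℂ)) *
    ((∫ lam in Ioi W.dSq, W.radIntegrand .s x z ξ ζ lam) +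
      ∫ lam in Ioi W.dSq, W.radIntegrand .a x z ξ ζ lam)

/-- `Ω_R = {(x, z) : [x]_h² + z² ≤ R²}`. -/
def Omega (W : Waveguide) (R : ℝ) : Set (ℝ × ℝ) :=
  {p | outerCoord W.h p.1 ^ 2 + p.2 ^ 2 ≤ R ^ 2}

/-- The outward unit normal to `∂Ω_R` at `p = (x, z)`: the unit vector `([x]_h, z) / R`, in the
direction of the gradient `2 ([x]_h, z)` of the continuously differentiable function
`[x]_h² + z²` which equals `R²` on `∂Ω_R`. -/
noncomputable def normal (W : Waveguide) (R : ℝ) (p : ℝ × ℝ) : ℝ × ℝ :=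
  (outerCoord W.h p.1 / R, p.2 / R)

end Waveguide

/-!
Write `λ = d² + Q²` and `u_j(·, Q)` for the solution of `u'' = (q - d² - Q²) u` whose data at `0` do
not depend on `Q`; it is entire and even in `Q`. With the Jost function
`J_j(Q) = Q u_j(h, Q) + i u_j'(h, Q)`, the spectral density is `-Q²/(J_j(Q) J_j(-Q))` up to
normalization, and outside the core `u_j` is a superposition of `e^{±iQ|[x]_h|}` with coefficients
proportional to `J_j(∓Q)`. Hence the spectral kernel is `(e^{iQX} F(Q) + e^{-iQX} F(-Q)) / 2`, where
`X = |[x]_h|` and, for `|x| > h`, `F(Q) = ± u_j(ξ, Q) Q / J_j(Q)` (`Waveguide.kernel_eq`). The quotient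
`Q / J_j(Q)` has no singularity on the real axis, not even at `Q = 0` (`Waveguide.jostReg_ne_zero`),
and it is controlled in the upper half plane for large `|Q|` (`IsGlobalSolution.high_energy`).
So `F` is holomorphic with bounds in a region made of a neighbourhood of a real segment and of the
remote part of the upper half plane (`Waveguide.exists_amplitude_bound`).

With `Q = β₀ cos w` the spectral integral becomes an integral of plane waves
`e^{iβ₀ (X cos w + Z sin w)}`, `Z = |z - ζ|`, along the broken line from `i∞` to `0` and on to `π/2`
(`Waveguide.integral_radIntegrand`). In polar coordinates `(X, Z) = ρ (cos θ, sin θ)` the phase is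
`β₀ ρ cos (w - θ)`, and by symmetry the two families `±Q` may be cut at `w = θ` and `w = π - θ`
instead of `π/2` (`contourIntegral_add_reflect`). Inside the region of holomorphy the contour is
moved to a half line over a point `a₀` followed by a segment to `θ`, along which the integrand
decays like a Gaussian. Since the contour ends at the stationary point, the integral is
`O(ρ^{-1/2})`, and `O(ρ^{-3/2})` if it contains the factor `cos (w - θ) - 1`
(`norm_contourIntegral_le`). All of this is uniform up to `θ = 0`, because the half line is moved
to the side on which the exponential still decays there.

Finally, differentiation along the normal minus `iβ₀` multiplies each plane wave by
`iβ₀ (cos (w - θ) - 1)` up to terms of size `1/R`, which come from the difference between the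
origin and the source; so every contribution is `O(R^{-3/2})` (`Waveguide.exists_radiation_bound`).
-/

/-! ### Global solutions of the linear equation -/

/-- `(u, u')` solves `y'' = w y`, `y 0 = a`, `y' 0 = b` on the whole line, in integrated form. -/
structure IsGlobalSolution (w : ℝ → ℂ) (a b : ℂ) (u u' : ℝ → ℂ) : Prop where
  cont : Continuous u
  cont' : Continuous u'
  eq : ∀ x, u x = a + ∫ y in (0:ℝ)..x, u' y
  eq' : ∀ x, u' x = b + ∫ y in (0:ℝ)..x, w y * u y

theorem absolutelyContinuousOnInterval_primitive {f : ℝ → ℂ} {s t : ℝ} (c : ℝ)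
    (hi : ∀ x y, IntervalIntegrable f volume x y) (hb : ∃ B, ∀ x ∈ uIcc s t, ‖f x‖ ≤ B) :
    AbsolutelyContinuousOnInterval (fun x => ∫ y in c..x, f y) s t := by
  obtain ⟨B, hB⟩ := hb
  refine LipschitzOnWith.absolutelyContinuousOnInterval (K := B.toNNReal)
    (LipschitzOnWith.of_dist_le_mul fun x hx y hy => ?_)
  rw [dist_eq_norm, intervalIntegral.integral_interval_sub_left (hi _ _) (hi _ _), Real.dist_eq]
  refine (intervalIntegral.norm_integral_le_of_norm_le_const (C := B.toNNReal) fun z hz => ?_)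
  exact (hB z (uIcc_subset_uIcc hy hx (uIoc_subset_uIcc hz))).trans (Real.le_coe_toNNReal B)

/-- A fundamental theorem of calculus for absolutely continuous functions whose almost everywhere
derivative is known. -/
theorem integral_eq_sub_of_ae_hasDerivAt {f f' : ℝ → ℂ} {a b : ℝ}
    (hf : AbsolutelyContinuousOnInterval f a b) (hi : ∀ x y, IntervalIntegrable f' volume x y)
    (hb : ∃ B, ∀ x ∈ uIcc a b, ‖f' x‖ ≤ B) (hd : ∀ᵐ x, HasDerivAt f (f' x) x) :
    ∫ x in a..b, f' x = f b - f a := by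
  have hi' := absolutelyContinuousOnInterval_primitive a hi hb
  obtain ⟨C, hC⟩ := (hf.sub hi').const_of_ae_hasDerivAt_zero (by
    filter_upwards [hd, (hi a b).ae_hasDerivAt_integral] with x h1 h2 h3
    simpa using! h1.sub (h2 h3 a (by simp)))
  have h1 := hC a (by simp)
  have h2 := hC b (by simp)
  simp only [Pi.sub_apply, intervalIntegral.integral_same, sub_zero] at h1 h2
  rw [h1, ← h2]; ring

theorem exists_bound_mul {w u : ℝ → ℂ} {K : ℝ} (hK : ∀ x, ‖w x‖ ≤ K) (hu : Continuous u)
    (s t : ℝ) : ∃ B, ∀ x ∈ uIcc s t, ‖w x * u x‖ ≤ B := by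
  obtain ⟨M, hM⟩ := isCompact_uIcc.exists_bound_of_continuousOn (hu.continuousOn (s := uIcc s t))
  refine ⟨K * M, fun x hx => ?_⟩
  rw [norm_mul]
  exact mul_le_mul (hK x) (hM x hx) (norm_nonneg _) ((norm_nonneg _).trans (hK x))

namespace IsGlobalSolution

variable {w : ℝ → ℂ} {K : ℝ} {a b : ℂ} {u u' : ℝ → ℂ}

theorem hasDerivAt (hu : IsGlobalSolution w a b u u') (x : ℝ) : HasDerivAt u (u' x) x := by
  rw [show u = fun x => a + ∫ y in (0:ℝ)..x, u' y from funext hu.eq]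
  exact (hu.cont'.integral_hasStrictDerivAt 0 x).hasDerivAt.const_add a

theorem intervalIntegrable (hu : IsGlobalSolution w a b u u')
    (hw : AEStronglyMeasurable w volume) (hK : ∀ x, ‖w x‖ ≤ K) (s t : ℝ) :
    IntervalIntegrable (fun y => w y * u y) volume s t :=
  intervalIntegrable_mul_of_bounded hw hK hu.cont s t

theorem locallyIntegrable (hu : IsGlobalSolution w a b u u')
    (hw : AEStronglyMeasurable w volume) (hK : ∀ x, ‖w x‖ ≤ K) :
    LocallyIntegrable (fun y => w y * u y) volume := by
  rw [locallyIntegrable_iff]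
  intro k hk
  obtain ⟨r, hr⟩ := hk.isBounded.subset_closedBall 0
  rw [Real.closedBall_eq_Icc] at hr
  refine IntegrableOn.mono_set ?_ hr
  have h := hu.intervalIntegrable hw hK (min (0 - r) (0 + r)) (max (0 - r) (0 + r))
  rw [intervalIntegrable_iff_integrableOn_Icc_of_le min_le_max] at h
  exact h.mono_set (Icc_subset_Icc (min_le_left _ _) (le_max_right _ _))

theorem ae_hasDerivAt (hu : IsGlobalSolution w a b u u')
    (hw : AEStronglyMeasurable w volume) (hK : ∀ x, ‖w x‖ ≤ K) :
    ∀ᵐ x, HasDerivAt u' (w x * u x) x := by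
  filter_upwards [LocallyIntegrable.ae_hasDerivAt_integral (hu.locallyIntegrable hw hK)] with x hx
  rw [show u' = fun x => b + ∫ y in (0:ℝ)..x, w y * u y from funext hu.eq']
  exact (hx 0).const_add b

theorem absolutelyContinuous' (hu : IsGlobalSolution w a b u u')
    (hw : AEStronglyMeasurable w volume) (hK : ∀ x, ‖w x‖ ≤ K) (s t : ℝ) :
    AbsolutelyContinuousOnInterval u' s t := by
  have h := absolutelyContinuousOnInterval_primitive (s := s) (t := t) s
    (hu.intervalIntegrable hw hK) (exists_bound_mul hK hu.cont s t)
  have hc : AbsolutelyContinuousOnInterval (fun _ : ℝ => u' s) s t :=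
    contDiffOn_const.absolutelyContinuousOnInterval
  have e : u' = (fun _ : ℝ => u' s) + fun x => ∫ y in s..x, w y * u y := by
    funext x
    simp only [Pi.add_apply]
    rw [hu.eq' x, hu.eq' s, add_assoc, intervalIntegral.integral_add_adjacent_intervals
      (hu.intervalIntegrable hw hK 0 s) (hu.intervalIntegrable hw hK s x)]
  rw [e]
  exact hc.add h

theorem contDiff (hu : IsGlobalSolution w a b u u') : ContDiff ℝ 1 u := by
  rw [contDiff_one_iff_deriv]
  refine ⟨fun x => (hu.hasDerivAt x).differentiableAt, ?_⟩
  rw [show deriv u = u' from funext fun x => (hu.hasDerivAt x).deriv]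
  exact hu.cont'

theorem absolutelyContinuous (hu : IsGlobalSolution w a b u u') (s t : ℝ) :
    AbsolutelyContinuousOnInterval u s t :=
  hu.contDiff.contDiffOn.absolutelyContinuousOnInterval

/-- The Wronskian of two solutions is constant. -/
theorem wronskian {c d : ℂ} {v v' : ℝ → ℂ} (hu : IsGlobalSolution w a b u u')
    (hv : IsGlobalSolution w c d v v') (hw : AEStronglyMeasurable w volume)
    (hK : ∀ x, ‖w x‖ ≤ K) (x : ℝ) : u x * v' x - u' x * v x = a * d - b * c := by
  have h0 : u 0 = a := by simpa using hu.eq 0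
  have h1 : u' 0 = b := by simpa using hu.eq' 0
  have h2 : v 0 = c := by simpa using hv.eq 0
  have h3 : v' 0 = d := by simpa using hv.eq' 0
  have hac : AbsolutelyContinuousOnInterval (u • v' - u' • v) 0 x :=
    ((hu.absolutelyContinuous 0 x).smul (hv.absolutelyContinuous' hw hK 0 x)).sub
      ((hu.absolutelyContinuous' hw hK 0 x).smul (hv.absolutelyContinuous 0 x))
  have := integral_eq_sub_of_ae_hasDerivAt (f' := fun _ => 0) hac (by simp) ⟨0, by simp⟩ (by
    filter_upwards [hu.ae_hasDerivAt hw hK, hv.ae_hasDerivAt hw hK] with y h1 h2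
    refine (((hu.hasDerivAt y).mul h2).sub (h1.mul (hv.hasDerivAt y))).congr_deriv ?_
    ring)
  simp only [intervalIntegral.integral_zero, Pi.sub_apply, smul_eq_mul, Pi.mul_apply,
    h0, h1, h2, h3] at this
  linear_combination -this

/-- The amplitude `Q u + i u'` is `e^{-iQx}` times a slowly varying function. -/
theorem amplitude {p : ℝ → ℂ} {Q : ℂ} (hu : IsGlobalSolution (fun x => p x - Q ^ 2) a b u u')
    (hp : AEStronglyMeasurable p volume) (hK : ∀ x, ‖p x‖ ≤ K) (s t : ℝ) :
    ∫ x in s..t, Complex.I * (p x * u x * Complex.exp (Complex.I * Q * x)) =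
      (Q * u t + Complex.I * u' t) * Complex.exp (Complex.I * Q * t) -
        (Q * u s + Complex.I * u' s) * Complex.exp (Complex.I * Q * s) := by
  have hw : AEStronglyMeasurable (fun x => p x - Q ^ 2) volume :=
    hp.sub aestronglyMeasurable_const
  have hK' : ∀ x, ‖p x - Q ^ 2‖ ≤ K + ‖Q ^ 2‖ := fun x =>
    (norm_sub_le _ _).trans (by linarith [hK x])
  have hE : ∀ x : ℝ, HasDerivAt (fun x : ℝ => Complex.exp (Complex.I * Q * x))
      (Complex.exp (Complex.I * Q * x) * (Complex.I * Q)) x := by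
    intro x
    have h1 : HasDerivAt (fun x : ℝ => Complex.I * Q * (x:ℂ)) (Complex.I * Q) x := by
      simpa using (Complex.ofRealCLM.hasDerivAt (x := x)).const_mul (Complex.I * Q)
    exact h1.cexp
  have hEd : ContDiff ℝ 1 fun x : ℝ => Complex.exp (Complex.I * Q * x) := by
    have : ContDiff ℝ 1 fun x : ℝ => Complex.I * Q * (x:ℂ) :=
      contDiff_const.mul Complex.ofRealCLM.contDiff
    exact this.cexp
  have hac : AbsolutelyContinuousOnInterval
      ((fun x => Q • u x) • (fun x : ℝ => Complex.exp (Complex.I * Q * x)) +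
        (fun x => Complex.I • u' x) • (fun x : ℝ => Complex.exp (Complex.I * Q * x))) s t :=
    (((hu.absolutelyContinuous s t).const_smul Q).smul
      hEd.contDiffOn.absolutelyContinuousOnInterval).add
    (((hu.absolutelyContinuous' hw hK' s t).const_smul Complex.I).smul
      hEd.contDiffOn.absolutelyContinuousOnInterval)
  rw [integral_eq_sub_of_ae_hasDerivAt hac]
  · simp only [Pi.add_apply, Pi.mul_apply, smul_eq_mul]; ring
  · intro s t
    have hc : Continuous fun x : ℝ => u x * Complex.exp (Complex.I * Q * x) :=
      hu.cont.mul hEd.continuous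
    simpa [mul_assoc] using (intervalIntegrable_mul_of_bounded hp hK hc s t).const_mul Complex.I
  · obtain ⟨B, hB⟩ := exists_bound_mul hK (hu.cont.mul hEd.continuous) s t
    refine ⟨B, fun x hx => ?_⟩
    simpa [mul_assoc] using hB x hx
  · filter_upwards [hu.ae_hasDerivAt hw hK'] with x hx
    refine ((((hu.hasDerivAt x).const_mul Q).mul (hE x)).add
      ((hx.const_mul Complex.I).mul (hE x))).congr_deriv ?_
    linear_combination (u' x * Q * Complex.exp (Complex.I * Q * x)) * Complex.I_sq

theorem reflect (hu : IsGlobalSolution w a b u u') (he : ∀ x, w (-x) = w x) :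
    IsGlobalSolution w a (-b) (fun x => u (-x)) fun x => -u' (-x) := by
  refine ⟨hu.cont.comp continuous_neg, (hu.cont'.comp continuous_neg).neg, fun x => ?_,
    fun x => ?_⟩
  · rw [hu.eq (-x), intervalIntegral.integral_neg, intervalIntegral.integral_comp_neg, neg_zero,
      intervalIntegral.integral_symm (-x) 0]
  · rw [hu.eq' (-x)]
    have : (fun y => w y * u (-y)) = fun y => (fun y => w y * u y) (-y) := by
      funext y; simp [he]
    rw [this, intervalIntegral.integral_comp_neg (fun y => w y * u y), neg_zero,
      intervalIntegral.integral_symm (-x) 0]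
    ring

theorem const_mul (hu : IsGlobalSolution w a b u u') (c : ℂ) :
    IsGlobalSolution w (c * a) (c * b) (fun x => c * u x) fun x => c * u' x := by
  refine ⟨hu.cont.const_mul c, hu.cont'.const_mul c, fun x => ?_, fun x => ?_⟩
  · rw [hu.eq x, intervalIntegral.integral_const_mul]; ring
  · rw [hu.eq' x]
    simp only [mul_left_comm _ c, intervalIntegral.integral_const_mul]
    ring

theorem isCaratheodorySolution (hu : IsGlobalSolution w a b u u') (h : ℝ) :
    IsCaratheodorySolution h w a b u u' :=
  ⟨by simpa using hu.eq 0, by simpa using hu.eq' 0,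
    fun x _ => (hu.hasDerivAt x).hasDerivWithinAt, fun x _ => hu.eq' x⟩

/-- The remainder after `n` Picard terms of an arbitrary solution. -/
theorem norm_sub_picard_le (hu : IsGlobalSolution w a b u u')
    (hw : AEStronglyMeasurable w volume) {L M r : ℝ} (hL : 1 ≤ L) (hK : ∀ x, ‖w x‖ ≤ L)
    (hM : ∀ x, |x| ≤ r → ‖u x‖ ≤ M ∧ ‖u' x‖ ≤ M) (n : ℕ) (x : ℝ) (hx : |x| ≤ r) :
    ‖u x - ∑ i ∈ Finset.range n, (picardTerm w a b i).1 x‖ ≤ M * (L * |x|) ^ n / n.factorial ∧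
    ‖u' x - ∑ i ∈ Finset.range n, (picardTerm w a b i).2 x‖ ≤
      M * (L * |x|) ^ n / n.factorial := by
  have hM0 : 0 ≤ M := (norm_nonneg _).trans (hM x hx).1
  have hc := picardTerm_continuous hw hK a b
  induction n generalizing x with
  | zero => simpa using hM x hx
  | succ n ih =>
    constructor
    · refine norm_primitive_le (f := fun x => u x - ∑ i ∈ Finset.range (n + 1),
        (picardTerm w a b i).1 x)
        (g := fun y => u' y - ∑ i ∈ Finset.range n, (picardTerm w a b i).2 y)
        (fun y hy => ?_) ?_
      · exact (ih y (hy.trans hx)).2.trans (le_mul_of_one_le_left (by positivity) hL)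
      · rw [intervalIntegral.integral_sub (hu.cont'.intervalIntegrable _ _)
          ((continuous_finsetSum _ fun i _ => (hc i).2).intervalIntegrable _ _),
          intervalIntegral.integral_finsetSum
            (fun i _ => (hc i).2.intervalIntegrable _ _), Finset.sum_range_succ', hu.eq x]
        simp only [picardTerm]
        ring
    · refine norm_primitive_le (f := fun x => u' x - ∑ i ∈ Finset.range (n + 1),
        (picardTerm w a b i).2 x)
        (g := fun y => w y * (u y - ∑ i ∈ Finset.range n, (picardTerm w a b i).1 y))
        (fun y hy => ?_) ?_
      · rw [norm_mul]
        exact mul_le_mul (hK y) (ih y (hy.trans hx)).1 (norm_nonneg _) (by linarith)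
      · simp_rw [mul_sub, Finset.mul_sum]
        rw [intervalIntegral.integral_sub (hu.intervalIntegrable hw hK _ _)
          (by simpa only [Finset.sum_fn] using IntervalIntegrable.sum _ fun i _ =>
            intervalIntegrable_mul_of_bounded hw hK (hc i).1 0 x),
          intervalIntegral.integral_finsetSum
            (fun i _ => intervalIntegrable_mul_of_bounded hw hK (hc i).1 0 x),
          Finset.sum_range_succ', hu.eq' x]
        simp only [picardTerm]
        ring

/-- Every global solution is the sum of the Picard series; in particular it is unique. -/
theorem hasSum_picard (hu : IsGlobalSolution w a b u u')
    (hw : AEStronglyMeasurable w volume) (hK : ∀ x, ‖w x‖ ≤ K) (x : ℝ) :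
    HasSum (fun n => (picardTerm w a b n).1 x) (u x) ∧
    HasSum (fun n => (picardTerm w a b n).2 x) (u' x) := by
  set L := max 1 K
  have hL : 1 ≤ L := le_max_left _ _
  have hKL : ∀ x, ‖w x‖ ≤ L := fun x => (hK x).trans (le_max_right _ _)
  obtain ⟨M1, hM1⟩ := (isCompact_Icc (a := -|x|) (b := |x|)).exists_bound_of_continuousOn
    hu.cont.continuousOn
  obtain ⟨M2, hM2⟩ := (isCompact_Icc (a := -|x|) (b := |x|)).exists_bound_of_continuousOn
    hu.cont'.continuousOn
  have hb := hu.norm_sub_picard_le hw hL hKL (M := max M1 M2) (r := |x|)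
    (fun y hy => ⟨(hM1 y (abs_le.1 hy)).trans (le_max_left _ _),
      (hM2 y (abs_le.1 hy)).trans (le_max_right _ _)⟩)
  have hs : Summable fun n : ℕ => (‖a‖ + ‖b‖) * (L * |x|) ^ n / n.factorial := by
    simp_rw [mul_div_assoc]
    exact (Real.summable_pow_div_factorial (L * |x|)).mul_left _
  have lim : Filter.Tendsto (fun n : ℕ => max M1 M2 * (L * |x|) ^ n / n.factorial)
      Filter.atTop (nhds 0) := by
    simp_rw [mul_div_assoc]
    simpa using (FloorSemiring.tendsto_pow_div_factorial_atTop (L * |x|)).const_mul (max M1 M2)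
  have key : ∀ (f : ℕ → ℂ) (l : ℂ), Summable f → (∀ n, ‖l - ∑ i ∈ Finset.range n, f i‖ ≤
      max M1 M2 * (L * |x|) ^ n / n.factorial) → HasSum f l := by
    intro f l hf hl
    rw [hf.hasSum_iff_tendsto_nat]
    have := squeeze_zero_norm hl lim
    simpa using (tendsto_const_nhds (x := l)).sub this
  exact ⟨key _ _ (Summable.of_norm_bounded hs fun n => (picardTerm_bound hL hKL a b n x).1)
      fun n => (hb n x le_rfl).1,
    key _ _ (Summable.of_norm_bounded hs fun n => (picardTerm_bound hL hKL a b n x).2)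
      fun n => (hb n x le_rfl).2⟩

theorem unique {v v' : ℝ → ℂ} (hu : IsGlobalSolution w a b u u')
    (hv : IsGlobalSolution w a b v v')
    (hw : AEStronglyMeasurable w volume) (hK : ∀ x, ‖w x‖ ≤ K) (x : ℝ) :
    u x = v x ∧ u' x = v' x :=
  ⟨(hu.hasSum_picard hw hK x).1.unique (hv.hasSum_picard hw hK x).1,
    (hu.hasSum_picard hw hK x).2.unique (hv.hasSum_picard hw hK x).2⟩

theorem norm_le (hu : IsGlobalSolution w a b u u')
    (hw : AEStronglyMeasurable w volume) {L : ℝ} (hL : 1 ≤ L) (hK : ∀ x, ‖w x‖ ≤ L) (x : ℝ) :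
    ‖u x‖ ≤ (‖a‖ + ‖b‖) * Real.exp (L * |x|) ∧ ‖u' x‖ ≤ (‖a‖ + ‖b‖) * Real.exp (L * |x|) := by
  have hs : HasSum (fun n : ℕ => (‖a‖ + ‖b‖) * (L * |x|) ^ n / n.factorial)
      ((‖a‖ + ‖b‖) * Real.exp (L * |x|)) := by
    simp_rw [mul_div_assoc]
    have := NormedSpace.expSeries_div_hasSum_exp (L * |x|)
    rw [← Real.exp_eq_exp_ℝ] at this
    exact this.mul_left _
  have h := hu.hasSum_picard hw hK x
  exact ⟨h.1.tsum_eq ▸ tsum_of_norm_bounded hs fun n => (picardTerm_bound hL hK a b n x).1,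
    h.2.tsum_eq ▸ tsum_of_norm_bounded hs fun n => (picardTerm_bound hL hK a b n x).2⟩

end IsGlobalSolution

/-! ### Analytic dependence on the spectral parameter -/

/-- The Picard terms for the coefficient `p - μ` are polynomials in `μ`. -/
theorem exists_picardTerm_eq_sum {p : ℝ → ℂ} {K : ℝ} (hp : AEStronglyMeasurable p volume)
    (hK : ∀ x, ‖p x‖ ≤ K) (a b : ℂ) (n : ℕ) :
    ∃ c c' : ℕ → ℝ → ℂ, ∃ N : ℕ, (∀ k, Continuous (c k)) ∧ (∀ k, Continuous (c' k)) ∧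
      (∀ k, N ≤ k → c k = 0) ∧
      ∀ (μ : ℂ) (x : ℝ), (picardTerm (fun y => p y - μ) a b n).1 x
          = ∑ k ∈ Finset.range N, μ ^ k * c k x ∧
        (picardTerm (fun y => p y - μ) a b n).2 x = ∑ k ∈ Finset.range N, μ ^ k * c' k x := by
  induction n with
  | zero =>
    refine ⟨fun k => if k = 0 then fun _ => a else 0, fun k => if k = 0 then fun _ => b else 0, 1,
      fun k => ?_, fun k => ?_, fun k hk => ?_, fun μ x => ?_⟩
    · dsimp only; split_ifs <;> fun_prop
    · dsimp only; split_ifs <;> fun_prop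
    · dsimp only; rw [if_neg (by omega)]
    · simp [picardTerm]
  | succ n ih =>
    obtain ⟨c, c', N, hc, hc', h0, h⟩ := ih
    have hpc : ∀ k s t, IntervalIntegrable (fun y => p y * c k y) volume s t := fun k s t =>
      intervalIntegrable_mul_of_bounded hp hK (hc k) s t
    have hci : ∀ k s t, IntervalIntegrable (c k) volume s t := fun k s t =>
      (hc k).intervalIntegrable s t
    refine ⟨fun k x => if k < N then ∫ y in (0:ℝ)..x, c' k y else 0,
      fun k x => (∫ y in (0:ℝ)..x, p y * c k y) -
        (if k = 0 then 0 else ∫ y in (0:ℝ)..x, c (k - 1) y), N + 1, fun k => ?_, fun k => ?_,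
        fun k hk => ?_, fun μ x => ⟨?_, ?_⟩⟩
    · dsimp only
      split_ifs
      · exact intervalIntegral.continuous_primitive (fun s t => (hc' k).intervalIntegrable s t) 0
      · exact continuous_const
    · refine (intervalIntegral.continuous_primitive (hpc k) 0).sub ?_
      split_ifs
      · exact continuous_const
      · exact intervalIntegral.continuous_primitive (hci _) 0
    · funext x; dsimp only; rw [if_neg (by omega)]; rfl
    · simp only [picardTerm]
      simp_rw [(h μ _).2]
      rw [intervalIntegral.integral_finsetSum
        (fun k _ => ((hc' k).intervalIntegrable 0 x).const_mul (μ ^ k)), Finset.sum_range_succ,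
        if_neg (lt_irrefl N), mul_zero, add_zero]
      refine Finset.sum_congr rfl fun k hk => ?_
      rw [if_pos (Finset.mem_range.1 hk), intervalIntegral.integral_const_mul]
    · simp only [picardTerm]
      simp_rw [(h μ _).1, Finset.mul_sum]
      have e : ∀ k y, (p y - μ) * (μ ^ k * c k y) =
          μ ^ k * (p y * c k y) - μ ^ (k + 1) * c k y := fun k y => by ring
      simp_rw [e, mul_sub, Finset.sum_sub_distrib]
      rw [Finset.sum_range_succ, Finset.sum_range_succ' (fun k => μ ^ k * _), h0 N le_rfl,
        intervalIntegral.integral_sub, intervalIntegral.integral_finsetSum,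
        intervalIntegral.integral_finsetSum]
      · simp [intervalIntegral.integral_const_mul]
      · exact fun k _ => (hci k 0 x).const_mul _
      · exact fun k _ => (hpc k 0 x).const_mul _
      · simpa only [Finset.sum_fn] using
          IntervalIntegrable.sum _ fun k _ => (hpc k 0 x).const_mul (μ ^ k)
      · simpa only [Finset.sum_fn] using
          IntervalIntegrable.sum _ fun k _ => (hci k 0 x).const_mul (μ ^ (k + 1))

theorem differentiable_picardTerm {p : ℝ → ℂ} {K : ℝ} (hp : AEStronglyMeasurable p volume)
    (hK : ∀ x, ‖p x‖ ≤ K) (a b : ℂ) (n : ℕ) (x : ℝ) :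
    (Differentiable ℂ fun Q : ℂ => (picardTerm (fun y => p y - Q ^ 2) a b n).1 x) ∧
    (Differentiable ℂ fun Q : ℂ => (picardTerm (fun y => p y - Q ^ 2) a b n).2 x) := by
  obtain ⟨c, c', N, -, -, -, h⟩ := exists_picardTerm_eq_sum hp hK a b n
  simp_rw [(h _ x).1, (h _ x).2]
  exact ⟨by fun_prop, by fun_prop⟩

/-- The pair `(u, u')` solving `u'' = (p - Q²) u`, `u 0 = a`, `u' 0 = b`, as a Picard series. -/
noncomputable def fundSol (p : ℝ → ℂ) (a b Q : ℂ) : (ℝ → ℂ) × (ℝ → ℂ) :=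
  (fun x => ∑' n, (picardTerm (fun y => p y - Q ^ 2) a b n).1 x,
    fun x => ∑' n, (picardTerm (fun y => p y - Q ^ 2) a b n).2 x)

section

variable {p : ℝ → ℂ} {K : ℝ}

theorem aestronglyMeasurable_sub_sq (hp : AEStronglyMeasurable p volume) (Q : ℂ) :
    AEStronglyMeasurable (fun x => p x - Q ^ 2) volume :=
  hp.sub aestronglyMeasurable_const

theorem norm_sub_sq_le (hK : ∀ x, ‖p x‖ ≤ K) {Q : ℂ} {r : ℝ} (hQ : ‖Q‖ ≤ r) (x : ℝ) :
    ‖p x - Q ^ 2‖ ≤ K + r ^ 2 := by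
  refine (norm_sub_le _ _).trans (add_le_add (hK x) ?_)
  rw [norm_pow]
  gcongr

theorem fundSol_spec (hp : AEStronglyMeasurable p volume) (hK : ∀ x, ‖p x‖ ≤ K) (a b Q : ℂ) :
    IsGlobalSolution (fun x => p x - Q ^ 2) a b (fundSol p a b Q).1 (fundSol p a b Q).2 := by
  have hw := aestronglyMeasurable_sub_sq hp Q
  have hK' := norm_sub_sq_le hK (le_refl ‖Q‖)
  obtain ⟨u, u', h1, h2, h3, h4⟩ := exists_linear_solution hw hK' a b
  have hu : IsGlobalSolution (fun x => p x - Q ^ 2) a b u u' := ⟨h1, h2, h3, h4⟩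
  have e1 : (fundSol p a b Q).1 = u := funext fun x => (hu.hasSum_picard hw hK' x).1.tsum_eq
  have e2 : (fundSol p a b Q).2 = u' := funext fun x => (hu.hasSum_picard hw hK' x).2.tsum_eq
  rw [e1, e2]
  exact hu

/-- The solution is entire in `Q`, as a locally uniform limit of polynomials. -/
theorem differentiable_fundSol (hp : AEStronglyMeasurable p volume) (hK : ∀ x, ‖p x‖ ≤ K)
    (a b : ℂ) (x : ℝ) : (Differentiable ℂ fun Q => (fundSol p a b Q).1 x) ∧
      Differentiable ℂ fun Q => (fundSol p a b Q).2 x := by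
  have key : ∀ f : ℕ → ℂ → ℂ, (∀ n, Differentiable ℂ (f n)) →
      (∀ (n : ℕ) (Q : ℂ) (r : ℝ), ‖Q‖ ≤ r →
        ‖f n Q‖ ≤ (‖a‖ + ‖b‖) * (max 1 (K + r ^ 2) * |x|) ^ n / n.factorial) →
      Differentiable ℂ fun Q => ∑' n, f n Q := by
    intro f hf hb Q
    have h : DifferentiableOn ℂ (fun Q => ∑' n, f n Q) (Metric.ball 0 (‖Q‖ + 1)) := by
      refine Complex.differentiableOn_tsum_of_summable_norm (u := fun n : ℕ =>
        (‖a‖ + ‖b‖) * (max 1 (K + (‖Q‖ + 1) ^ 2) * |x|) ^ n / n.factorial) ?_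
        (fun n => (hf n).differentiableOn) Metric.isOpen_ball fun n P hP => ?_
      · simp_rw [mul_div_assoc]
        exact (Real.summable_pow_div_factorial _).mul_left _
      · exact hb n P _ (mem_ball_zero_iff.1 hP).le
    exact h.differentiableAt (Metric.isOpen_ball.mem_nhds (by simp))
  have hb := fun (n : ℕ) (Q : ℂ) (r : ℝ) (hQ : ‖Q‖ ≤ r) =>
    picardTerm_bound (w := fun y => p y - Q ^ 2) (le_max_left 1 (K + r ^ 2))
      (fun y => (norm_sub_sq_le hK hQ y).trans (le_max_right _ _)) a b n x
  exact ⟨key _ (fun n => (differentiable_picardTerm hp hK a b n x).1)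
      fun n Q r hQ => (hb n Q r hQ).1,
    key _ (fun n => (differentiable_picardTerm hp hK a b n x).2) fun n Q r hQ => (hb n Q r hQ).2⟩

theorem norm_fundSol_le (hp : AEStronglyMeasurable p volume) (hK : ∀ x, ‖p x‖ ≤ K) (a b : ℂ)
    {Q : ℂ} {r : ℝ} (hQ : ‖Q‖ ≤ r) (x : ℝ) :
    ‖(fundSol p a b Q).1 x‖ ≤ (‖a‖ + ‖b‖) * Real.exp (max 1 (K + r ^ 2) * |x|) :=
  ((fundSol_spec hp hK a b Q).norm_le (aestronglyMeasurable_sub_sq hp Q) (le_max_left _ _)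
    (fun y => (norm_sub_sq_le hK hQ y).trans (le_max_right _ _)) x).1

theorem norm_exp_I_mul (Q : ℂ) (x : ℝ) :
    ‖Complex.exp (Complex.I * Q * x)‖ = Real.exp (-(Q.im * x)) := by
  rw [Complex.norm_exp]; congr 1; simp

/-- For large `|Q|` in the upper half plane, `u` and `Q u + i u'` are comparable to the solution
of the equation without potential. -/
theorem IsGlobalSolution.high_energy {a b Q : ℂ} {u u' : ℝ → ℂ}
    (hu : IsGlobalSolution (fun x => p x - Q ^ 2) a b u u')
    (hp : AEStronglyMeasurable p volume) (hK : ∀ x, ‖p x‖ ≤ K) {r s : ℝ} (hr : 0 ≤ r)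
    (hm : 0 ≤ Q.im) (hQ : 4 * K * r ≤ ‖Q‖) (hQ0 : 0 < ‖Q‖)
    (hs1 : ‖Q * a + Complex.I * b‖ ≤ s) (hs2 : ‖Q * a - Complex.I * b‖ ≤ s)
    {x : ℝ} (hx : x ∈ Icc 0 r) :
    ‖u x‖ ≤ 2 * s / ‖Q‖ * Real.exp (Q.im * x) ∧
    ‖Q * a + Complex.I * b‖ - s / 2 ≤
      ‖Q * u x + Complex.I * u' x‖ * Real.exp (-(Q.im * x)) := by
  have hK0 : 0 ≤ K := (norm_nonneg _).trans (hK 0)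
  have hs0 : 0 ≤ s := (norm_nonneg _).trans hs1
  have h0 : u 0 = a := by simpa using hu.eq 0
  have h1 : u' 0 = b := by simpa using hu.eq' 0
  have cy : Continuous fun x : ℝ => ‖u x‖ * Real.exp (-(Q.im * x)) := by
    have := hu.cont; fun_prop
  -- the maximum `Y` of `|u| e^{-x Im Q}` is estimated in terms of itself
  obtain ⟨x0, hx0, hmax⟩ := isCompact_Icc.exists_isMaxOn (nonempty_Icc.2 hr) cy.continuousOn
  set Y := ‖u x0‖ * Real.exp (-(Q.im * x0)) with hY
  have hY0 : 0 ≤ Y := by positivity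
  have hmax' : ∀ y ∈ Icc 0 r, ‖u y‖ * Real.exp (-(Q.im * y)) ≤ Y := fun y hy => hmax hy
  have up : ∀ y ∈ Icc 0 r, ‖(Q * u y + Complex.I * u' y) * Complex.exp (Complex.I * Q * y) -
      (Q * a + Complex.I * b)‖ ≤ K * Y * r := by
    intro y hy
    have := hu.amplitude hp hK 0 y
    simp only [h0, h1, Complex.ofReal_zero, mul_zero, Complex.exp_zero, mul_one] at this
    rw [← this]
    refine (intervalIntegral.norm_integral_le_of_norm_le_const (C := K * Y) fun z hz => ?_).trans ?_
    · rw [uIoc_of_le hy.1] at hz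
      rw [norm_mul, norm_mul, norm_mul, Complex.norm_I, one_mul, norm_exp_I_mul, mul_assoc]
      exact mul_le_mul (hK z) (hmax' z ⟨hz.1.le, hz.2.trans hy.2⟩) (by positivity) hK0
    · rw [sub_zero, abs_of_nonneg hy.1]
      exact mul_le_mul_of_nonneg_left hy.2 (by positivity)
  have low : ∀ y ∈ Icc 0 r, ‖Q * u y - Complex.I * u' y‖ * Real.exp (-(Q.im * y)) ≤
      s + K * Y * r := by
    intro y hy
    have hu' : IsGlobalSolution (fun x => p x - (-Q) ^ 2) a b u u' := by simpa using hu
    have := hu'.amplitude hp hK 0 y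
    simp only [h0, h1, Complex.ofReal_zero, mul_zero, Complex.exp_zero, mul_one] at this
    have e : Q * u y - Complex.I * u' y = Complex.exp (Complex.I * Q * y) *
        ((Q * a - Complex.I * b) - ∫ x in (0:ℝ)..y,
          Complex.I * (p x * u x * Complex.exp (Complex.I * -Q * x))) := by
      rw [this]
      have : Complex.exp (Complex.I * Q * y) * Complex.exp (Complex.I * -Q * y) = 1 := by
        rw [← Complex.exp_add]; simp
      linear_combination (-(Q * u y - Complex.I * u' y)) * this
    rw [e, mul_sub, ← intervalIntegral.integral_const_mul]
    have b1 : ‖Complex.exp (Complex.I * Q * y) * (Q * a - Complex.I * b)‖ ≤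
        Real.exp (-(Q.im * y)) * s := by
      rw [norm_mul, norm_exp_I_mul]; gcongr
    have b2 : ‖∫ x in (0:ℝ)..y, Complex.exp (Complex.I * Q * y) *
        (Complex.I * (p x * u x * Complex.exp (Complex.I * -Q * x)))‖ ≤
        K * Y * Real.exp (Q.im * y) * y := by
      refine (intervalIntegral.norm_integral_le_of_norm_le_const
        (C := K * Y * Real.exp (Q.im * y)) fun z hz => ?_).trans ?_
      · rw [uIoc_of_le hy.1] at hz
        rw [norm_mul, norm_mul, norm_mul, norm_mul, Complex.norm_I, one_mul, norm_exp_I_mul,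
          norm_exp_I_mul]
        have e1 : Real.exp (-(Q.im * y)) * (‖p z‖ * ‖u z‖ * Real.exp (-((-Q).im * z))) =
            ‖p z‖ * (‖u z‖ * Real.exp (-(Q.im * z))) * Real.exp (2 * Q.im * z - Q.im * y) := by
          have : Real.exp (-(Q.im * y)) * Real.exp (-((-Q).im * z)) =
              Real.exp (-(Q.im * z)) * Real.exp (2 * Q.im * z - Q.im * y) := by
            rw [← Real.exp_add, ← Real.exp_add]; congr 1; simp; ring
          linear_combination ‖p z‖ * ‖u z‖ * this
        rw [e1]
        have hz' : Q.im * z ≤ Q.im * y := mul_le_mul_of_nonneg_left hz.2 hm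
        have := hmax' z ⟨hz.1.le, hz.2.trans hy.2⟩
        have := hK z
        gcongr
        linarith
      · rw [sub_zero, abs_of_nonneg hy.1]
    have b3 : K * Y * y ≤ K * Y * r := mul_le_mul_of_nonneg_left hy.2 (by positivity)
    have hE : Real.exp (Q.im * y) * Real.exp (-(Q.im * y)) = 1 := by
      rw [← Real.exp_add]; simp
    have hE1 : Real.exp (-(Q.im * y)) ≤ 1 := Real.exp_le_one_iff.2 (by
      have := mul_nonneg hm hy.1; linarith)
    have hEp := Real.exp_pos (-(Q.im * y))
    calc _ ≤ (Real.exp (-(Q.im * y)) * s + K * Y * Real.exp (Q.im * y) * y) *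
          Real.exp (-(Q.im * y)) := by
          refine mul_le_mul_of_nonneg_right ((norm_sub_le _ _).trans (add_le_add b1 b2)) hEp.le
      _ = Real.exp (-(Q.im * y)) * Real.exp (-(Q.im * y)) * s + K * Y * y := by
          linear_combination K * Y * y * hE
      _ ≤ 1 * s + K * Y * r := by
          gcongr
          exact mul_le_one₀ hE1 hEp.le hE1
      _ = _ := by ring
  have up' : ∀ y ∈ Icc 0 r, ‖Q * u y + Complex.I * u' y‖ * Real.exp (-(Q.im * y)) ≤
      s + K * Y * r := by
    intro y hy
    have h2 := up y hy
    have h3 := norm_sub_norm_le ((Q * u y + Complex.I * u' y) * Complex.exp (Complex.I * Q * y))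
      (Q * a + Complex.I * b)
    rw [norm_mul, norm_exp_I_mul] at h3
    linarith
  have hY1 : ‖Q‖ * Y ≤ s + K * Y * r := by
    have e : Q * u x0 = ((Q * u x0 + Complex.I * u' x0) + (Q * u x0 - Complex.I * u' x0)) / 2 := by
      ring
    have h2 : ‖Q‖ * ‖u x0‖ ≤ (‖Q * u x0 + Complex.I * u' x0‖ +
        ‖Q * u x0 - Complex.I * u' x0‖) / 2 := by
      rw [← norm_mul, e, norm_div]
      simpa using div_le_div_of_nonneg_right (norm_add_le (Q * u x0 + Complex.I * u' x0)
        (Q * u x0 - Complex.I * u' x0)) (by norm_num : (0:ℝ) ≤ 2)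
    have h3 := mul_le_mul_of_nonneg_right h2 (Real.exp_pos (-(Q.im * x0))).le
    have h4 := up' x0 hx0
    have h5 := low x0 hx0
    rw [hY]
    linarith
  have hY2 : Y ≤ 2 * s / ‖Q‖ := by
    rw [le_div_iff₀ hQ0]
    have : 4 * K * r * Y ≤ ‖Q‖ * Y := mul_le_mul_of_nonneg_right hQ hY0
    nlinarith
  have hE : Real.exp (-(Q.im * x)) * Real.exp (Q.im * x) = 1 := by
    rw [← Real.exp_add]; simp
  constructor
  · calc ‖u x‖ = ‖u x‖ * Real.exp (-(Q.im * x)) * Real.exp (Q.im * x) := by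
          rw [mul_assoc, hE, mul_one]
      _ ≤ _ := by
          have := (hmax' x hx).trans hY2
          gcongr
  · have h2 := up x hx
    have h3 := norm_sub_norm_le (Q * a + Complex.I * b)
      ((Q * u x + Complex.I * u' x) * Complex.exp (Complex.I * Q * x))
    rw [norm_sub_rev, norm_mul, norm_exp_I_mul] at h3
    have h4 : K * Y * r ≤ s / 2 := by
      have h5 : 4 * K * r * Y ≤ ‖Q‖ * Y := mul_le_mul_of_nonneg_right hQ hY0
      have h6 : ‖Q‖ * Y ≤ 2 * s := by rw [le_div_iff₀ hQ0] at hY2; linarith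
      linarith
    linarith

end

/-! ### Generalized eigenfunctions of the waveguide -/

namespace Waveguide

/-- The potential `q - d²`, which vanishes outside the core. -/
noncomputable def pot (W : Waveguide) (x : ℝ) : ℂ := ((W.q x - W.dSq : ℝ) : ℂ)

theorem pot_eq_zero (W : Waveguide) {x : ℝ} (hx : W.h < |x|) : W.pot x = 0 := by
  simp [pot, q, dSq, index, not_le.2 hx]

theorem pot_neg (W : Waveguide) (x : ℝ) : W.pot (-x) = W.pot x := by
  by_cases hx : |x| ≤ W.h
  · simp [pot, q, index, abs_neg, hx, W.nCo_even x (abs_le.1 hx)]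
  · rw [W.pot_eq_zero (not_le.1 hx), W.pot_eq_zero (by rw [abs_neg]; exact not_le.1 hx)]

theorem pot_measurable (W : Waveguide) : AEStronglyMeasurable W.pot volume := by
  have h1 := (Complex.continuous_ofReal.comp_aestronglyMeasurable (W.coeff_measurable W.dSq))
  have h2 := (aestronglyMeasurable_indicator_iff measurableSet_Icc).2 h1
  refine h2.congr (Filter.Eventually.of_forall fun x => ?_)
  by_cases hx : x ∈ Icc (-W.h) W.h
  · simp [indicator_of_mem hx, pot]
  · rw [indicator_of_notMem hx, W.pot_eq_zero]
    exact not_le.1 fun h => hx (abs_le.1 h)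

theorem pot_bounded (W : Waveguide) : ∃ K : ℝ, ∀ x, ‖W.pot x‖ ≤ K := by
  obtain ⟨K, hK⟩ := W.coeff_bounded W.dSq
  refine ⟨K, fun x => ?_⟩
  by_cases hx : |x| ≤ W.h
  · rw [pot, Complex.norm_real]; exact hK x (abs_le.1 hx)
  · rw [W.pot_eq_zero (not_le.1 hx), norm_zero]
    exact (norm_nonneg _).trans (hK 0 ⟨by linarith [W.h_pos], W.h_pos.le⟩)

theorem nCl_le_nStar (W : Waveguide) : W.nCl ≤ W.nStar := by
  obtain ⟨B, hB⟩ := W.nCo_bounded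
  have hb : BddAbove (range W.index) := by
    refine ⟨max B W.nCl, ?_⟩
    rintro _ ⟨x, rfl⟩
    simp only [index]
    split_ifs with hx
    · exact ((le_abs_self _).trans (hB x (abs_le.1 hx))).trans (le_max_left _ _)
    · exact le_max_right _ _
  have := le_ciSup hb (W.h + 1)
  rwa [index, if_neg (not_le.2 ((lt_add_one W.h).trans_le (le_abs_self _)))] at this

theorem dSq_nonneg (W : Waveguide) : 0 ≤ W.dSq := by
  have h1 := W.nCl_le_nStar
  have h2 := W.nCl_pos
  refine mul_nonneg (sq_nonneg _) ?_
  nlinarith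

theorem beta0_pos (W : Waveguide) : 0 < W.beta0 := mul_pos W.k_pos W.nCl_pos

theorem sq_sub_dSq (W : Waveguide) : W.k ^ 2 * W.nStar ^ 2 - W.dSq = W.beta0 ^ 2 := by
  simp only [dSq, beta0]; ring

/-- The parity sign: `1` for the symmetric and `-1` for the antisymmetric modes. -/
def paritySign (j : Parity) : ℂ :=
  match j with
  | .s => 1
  | .a => -1

/-- The initial value of the normalized eigenfunction. -/
def normValue (j : Parity) : ℂ :=
  match j with
  | .s => 1
  | .a => 0

/-- The initial derivative of the normalized eigenfunction. -/
def normDeriv (j : Parity) : ℂ :=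
  match j with
  | .s => 0
  | .a => 1

/-- The generalized eigenfunction with spectral parameter `λ = d² + Q²`, normalized to have
initial data independent of `Q`, so that it is entire in `Q`. -/
noncomputable def eigenfun (W : Waveguide) (j : Parity) (x : ℝ) (Q : ℂ) : ℂ :=
  (fundSol W.pot (normValue j) (normDeriv j) Q).1 x

/-- The `x`-derivative of `eigenfun`. -/
noncomputable def eigenderiv (W : Waveguide) (j : Parity) (x : ℝ) (Q : ℂ) : ℂ :=
  (fundSol W.pot (normValue j) (normDeriv j) Q).2 x

theorem eigenfun_spec (W : Waveguide) (j : Parity) (Q : ℂ) :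
    IsGlobalSolution (fun x => W.pot x - Q ^ 2) (normValue j) (normDeriv j)
      (fun x => W.eigenfun j x Q) (fun x => W.eigenderiv j x Q) := by
  obtain ⟨K, hK⟩ := W.pot_bounded
  exact fundSol_spec W.pot_measurable hK _ _ Q

theorem differentiable_eigenfun (W : Waveguide) (j : Parity) (x : ℝ) :
    Differentiable ℂ (W.eigenfun j x) := by
  obtain ⟨K, hK⟩ := W.pot_bounded
  exact (differentiable_fundSol W.pot_measurable hK _ _ x).1

theorem differentiable_eigenderiv (W : Waveguide) (j : Parity) (x : ℝ) :
    Differentiable ℂ (W.eigenderiv j x) := by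
  obtain ⟨K, hK⟩ := W.pot_bounded
  exact (differentiable_fundSol W.pot_measurable hK _ _ x).2

theorem eigenfun_neg_right (W : Waveguide) (j : Parity) (x : ℝ) (Q : ℂ) :
    W.eigenfun j x (-Q) = W.eigenfun j x Q := by
  simp [eigenfun, fundSol]

theorem eigenderiv_neg_right (W : Waveguide) (j : Parity) (x : ℝ) (Q : ℂ) :
    W.eigenderiv j x (-Q) = W.eigenderiv j x Q := by
  simp [eigenderiv, fundSol]

theorem eigenfun_neg_left (W : Waveguide) (j : Parity) (x : ℝ) (Q : ℂ) :
    W.eigenfun j (-x) Q = paritySign j * W.eigenfun j x Q ∧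
      W.eigenderiv j (-x) Q = -paritySign j * W.eigenderiv j x Q := by
  obtain ⟨K, hK⟩ := W.pot_bounded
  have h1 := (W.eigenfun_spec j Q).reflect (fun x => by rw [W.pot_neg])
  have h2 := (W.eigenfun_spec j Q).const_mul (paritySign j)
  have e1 : paritySign j * normValue j = normValue j := by cases j <;> simp [paritySign, normValue]
  have e2 : paritySign j * normDeriv j = -normDeriv j := by cases j <;> simp [paritySign, normDeriv]
  rw [e1, e2] at h2
  have := h1.unique h2 (aestronglyMeasurable_sub_sq W.pot_measurable Q)
    (norm_sub_sq_le hK le_rfl) x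
  refine ⟨this.1, ?_⟩
  linear_combination -this.2

/-- The factor by which `φ_j` differs from the normalized eigenfunction. -/
noncomputable def phiScale (j : Parity) (lam : ℝ) : ℝ :=
  match j with
  | .s => 1
  | .a => Real.sqrt lam

theorem phiScale_pos (j : Parity) {lam : ℝ} (hl : 0 < lam) : 0 < phiScale j lam := by
  cases j
  · exact one_pos
  · exact Real.sqrt_pos.2 hl

/-- By uniqueness of the initial value problem, `φ_j` is a multiple of the normalized eigenfunction.
The factor is not analytic in `Q`, but it cancels in the spectral kernel. -/
theorem phi_eq (W : Waveguide) (j : Parity) (Q : ℝ) {x : ℝ} (hx : x ∈ Icc (-W.h) W.h) :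
    (W.phi j (W.dSq + Q ^ 2) x : ℂ) = phiScale j (W.dSq + Q ^ 2) * W.eigenfun j x Q ∧
    (W.dphi j (W.dSq + Q ^ 2) x : ℂ) = phiScale j (W.dSq + Q ^ 2) * W.eigenderiv j x Q := by
  have h1 := W.phi_spec j (W.dSq + Q ^ 2)
  have hw : ∀ x : ℝ, ((W.q x - (W.dSq + Q ^ 2) : ℝ) : ℂ) = W.pot x - (Q : ℂ) ^ 2 := by
    intro x; simp [pot]; ring
  have h2 : IsCaratheodorySolution W.h (fun x => W.pot x - (Q : ℂ) ^ 2)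
      (phiScale j (W.dSq + Q ^ 2) * normValue j) (phiScale j (W.dSq + Q ^ 2) * normDeriv j)
      (fun x => (W.phi j (W.dSq + Q ^ 2) x : ℂ)) (fun x => (W.dphi j (W.dSq + Q ^ 2) x : ℂ)) := by
    refine ⟨?_, ?_, fun x hx => ?_, fun x hx => ?_⟩
    · rw [h1.value_zero]; cases j <;> simp [initValue, phiScale, normValue]
    · rw [h1.deriv_zero]; cases j <;> simp [initDeriv, phiScale, normDeriv]
    · exact (h1.hasDeriv x hx).ofReal_comp
    · rw [h1.deriv_eq x hx]
      push_cast
      congr 1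
      · cases j <;> simp [initDeriv, phiScale, normDeriv]
      · rw [← intervalIntegral.integral_ofReal]
        refine intervalIntegral.integral_congr fun y _ => ?_
        rw [← hw y]
        push_cast
        ring
  have h3 := ((W.eigenfun_spec j Q).const_mul
    (phiScale j (W.dSq + Q ^ 2) : ℂ)).isCaratheodorySolution W.h
  obtain ⟨K, hK⟩ := W.pot_bounded
  exact isCaratheodorySolution_unique W.h_pos
    (aestronglyMeasurable_sub_sq W.pot_measurable (Q : ℂ)).restrict
    (fun x _ => norm_sub_sq_le hK le_rfl x) h2 h3 x hx

theorem eigenfun_eigenderiv_not_both_zero (W : Waveguide) (j : Parity) (x : ℝ) (Q : ℂ)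
    (h1 : W.eigenfun j x Q = 0) (h2 : W.eigenderiv j x Q = 0) : False := by
  obtain ⟨K, hK⟩ := W.pot_bounded
  have hs := (W.eigenfun_spec .s Q).wronskian (W.eigenfun_spec .a Q)
    (aestronglyMeasurable_sub_sq W.pot_measurable Q) (norm_sub_sq_le hK le_rfl) x
  cases j <;> simp [h1, h2, normValue, normDeriv] at hs

/-- The amplitude `Q u(h) + i u'(h)` of the incoming wave of the eigenfunction. -/
noncomputable def jost (W : Waveguide) (j : Parity) (Q : ℂ) : ℂ :=
  Q * W.eigenfun j W.h Q + Complex.I * W.eigenderiv j W.h Q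

theorem differentiable_jost (W : Waveguide) (j : Parity) : Differentiable ℂ (W.jost j) :=
  (differentiable_id.mul (W.differentiable_eigenfun j W.h)).add
    ((W.differentiable_eigenderiv j W.h).const_mul _)

/-- Outside the core the eigenfunction is a superposition of two plane waves. -/
theorem eigenfun_outside (W : Waveguide) (j : Parity) {x : ℝ} (hx : W.h ≤ x) (Q : ℂ) :
    2 * Q * W.eigenfun j x Q = -W.jost j (-Q) * Complex.exp (Complex.I * Q * (x - W.h)) +
      W.jost j Q * Complex.exp (-(Complex.I * Q * (x - W.h))) := by
  obtain ⟨K, hK⟩ := W.pot_bounded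
  have key : ∀ P : ℂ, P ^ 2 = Q ^ 2 → P * W.eigenfun j x Q + Complex.I * W.eigenderiv j x Q =
      (P * W.eigenfun j W.h Q + Complex.I * W.eigenderiv j W.h Q) *
        Complex.exp (-(Complex.I * P * (x - W.h))) := by
    intro P hP
    have hu := W.eigenfun_spec j Q
    simp only [← hP] at hu
    have h0 := hu.amplitude W.pot_measurable hK W.h x
    rw [intervalIntegral.integral_congr_ae (g := fun _ => 0)] at h0
    · rw [intervalIntegral.integral_zero, eq_comm, sub_eq_zero] at h0
      have e : Complex.exp (-(Complex.I * P * (x - W.h))) =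
          Complex.exp (Complex.I * P * W.h) * Complex.exp (-(Complex.I * P * x)) := by
        rw [← Complex.exp_add]; congr 1; ring
      have e1 : Complex.exp (Complex.I * P * x) * Complex.exp (-(Complex.I * P * x)) = 1 := by
        rw [← Complex.exp_add]; simp
      rw [e, ← mul_assoc, ← h0, mul_assoc, e1, mul_one]
    · refine Filter.Eventually.of_forall fun y hy => ?_
      rw [uIoc_of_le hx] at hy
      rw [W.pot_eq_zero (hy.1.trans_le (le_abs_self _))]
      simp
  have h1 := key Q rfl
  have h2 := key (-Q) (by ring)
  simp only [jost, eigenfun_neg_right, eigenderiv_neg_right]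
  simp only [mul_neg, neg_mul, neg_neg] at h1 h2 ⊢
  linear_combination h1 - h2

theorem sqrt_add_sq_sub (W : Waveguide) {Q : ℝ} (hQ : 0 < Q) :
    Real.sqrt (W.dSq + Q ^ 2 - W.dSq) = Q := by
  rw [add_sub_cancel_left, Real.sqrt_sq hQ.le]

/-- The piecewise definition of `v_j` continues `φ_j` by the solution of the equation with constant
coefficients, so that `v_j` is a multiple of the global eigenfunction. -/
theorem v_eq (W : Waveguide) (j : Parity) {Q : ℝ} (hQ : 0 < Q) (x : ℝ) :
    (W.v j x (W.dSq + Q ^ 2) : ℂ) = phiScale j (W.dSq + Q ^ 2) * W.eigenfun j x Q := by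
  have hQ' : (Q : ℂ) ≠ 0 := by exact_mod_cast hQ.ne'
  have hh := W.h_pos
  have out : ∀ y : ℝ, W.h ≤ y → W.eigenfun j y Q =
      W.eigenfun j W.h Q * Complex.cos (Q * (y - W.h)) +
        W.eigenderiv j W.h Q / Q * Complex.sin (Q * (y - W.h)) := by
    intro y hy
    have h1 := W.eigenfun_outside j hy Q
    have e1 : Complex.exp (Complex.I * Q * (y - W.h)) =
        Complex.cos (Q * (y - W.h)) + Complex.sin (Q * (y - W.h)) * Complex.I := by
      rw [← Complex.exp_mul_I]; congr 1; ring
    have e2 : Complex.exp (-(Complex.I * Q * (y - W.h))) =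
        Complex.cos (Q * (y - W.h)) - Complex.sin (Q * (y - W.h)) * Complex.I := by
      rw [← Complex.cos_neg, ← neg_neg (Complex.sin _), ← Complex.sin_neg, neg_mul, sub_neg_eq_add,
        ← Complex.exp_mul_I]; congr 1; ring
    rw [e1, e2] at h1
    simp only [jost, eigenfun_neg_right, eigenderiv_neg_right] at h1
    field_simp
    linear_combination h1 / 2 - W.eigenderiv j W.h Q * Complex.sin (Q * (y - W.h)) * Complex.I_sq
  simp only [v, W.sqrt_add_sq_sub hQ]
  have p1 := W.phi_eq j Q (x := W.h) ⟨by linarith, le_rfl⟩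
  have p2 := W.phi_eq j Q (x := -W.h) ⟨le_rfl, by linarith⟩
  have n1 := W.eigenfun_neg_left j W.h Q
  split_ifs with h1 h2
  · rw [out x h1.le]
    push_cast
    rw [p1.1, p1.2]
    ring
  · have n2 := W.eigenfun_neg_left j (-x) Q
    rw [neg_neg] at n2
    rw [n2.1, out (-x) (by linarith)]
    have e1 : (Q : ℂ) * (((-x : ℝ) : ℂ) - W.h) = -(Q * (x + W.h)) := by push_cast; ring
    rw [e1, Complex.cos_neg, Complex.sin_neg]
    push_cast
    rw [p2.1, p2.2, n1.1, n1.2]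
    ring
  · exact (W.phi_eq j Q ⟨by linarith, by linarith⟩).1

/-- On the real axis the Jost function is the sum of a real and an imaginary number which do not
vanish simultaneously, up to a common factor. -/
theorem jost_ne_zero (W : Waveguide) (j : Parity) {Q : ℝ} (hQ : Q ≠ 0) : W.jost j Q ≠ 0 := by
  intro h0
  have hh := W.h_pos
  have p := W.phi_eq j Q (x := W.h) ⟨by linarith, le_rfl⟩
  have hl : 0 < W.dSq + Q ^ 2 := by have := W.dSq_nonneg; positivity
  have hc : (phiScale j (W.dSq + Q ^ 2) : ℂ) ≠ 0 := by exact_mod_cast (phiScale_pos j hl).ne'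
  have h1 : (Q : ℂ) * W.phi j (W.dSq + Q ^ 2) W.h +
      Complex.I * W.dphi j (W.dSq + Q ^ 2) W.h = 0 := by
    rw [p.1, p.2]
    simp only [jost] at h0
    linear_combination (phiScale j (W.dSq + Q ^ 2) : ℂ) * h0
  have hre := congrArg Complex.re h1
  have him := congrArg Complex.im h1
  simp at hre him
  have h3 := hre.resolve_left hQ
  rw [h3, Complex.ofReal_zero, eq_comm, mul_eq_zero] at p
  rw [him, Complex.ofReal_zero, eq_comm (a := (0:ℂ)), mul_eq_zero] at p
  exact W.eigenfun_eigenderiv_not_both_zero j W.h Q (p.1.resolve_left hc)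
    (p.2.resolve_left hc)

/-- The quotient `Q / jost Q`, with the possible singularity at `Q = 0` removed. -/
noncomputable def invJost (W : Waveguide) (j : Parity) (Q : ℂ) : ℂ :=
  open Classical in
  if W.jost j 0 = 0 then (dslope (W.jost j) 0 Q)⁻¹ else Q / W.jost j Q

theorem invJost_eq (W : Waveguide) (j : Parity) {Q : ℂ} (hQ : Q ≠ 0) :
    W.invJost j Q = Q / W.jost j Q := by
  rw [invJost]
  split_ifs with h
  · rw [dslope_of_ne _ hQ, slope_def_field, h, sub_zero, sub_zero, inv_div]
  · rfl

/-- The function whose zeros are the singularities of `invJost`. -/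
noncomputable def jostReg (W : Waveguide) (j : Parity) (Q : ℂ) : ℂ :=
  open Classical in
  if W.jost j 0 = 0 then dslope (W.jost j) 0 Q else W.jost j Q

theorem differentiable_jostReg (W : Waveguide) (j : Parity) : Differentiable ℂ (W.jostReg j) := by
  unfold jostReg
  split_ifs with h
  · have := (Complex.differentiableOn_dslope (c := 0) (Filter.univ_mem)).2
      (W.differentiable_jost j).differentiableOn
    exact differentiableOn_univ.1 this
  · exact W.differentiable_jost j

/-- If the Jost function vanishes at `0` then it has a simple zero there: the derivative is
`u(h, 0)` since `u'(h, ·)` is even, and `u(h, 0)` and `u'(h, 0)` do not vanish simultaneously. -/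
theorem jostReg_ne_zero (W : Waveguide) (j : Parity) (Q : ℝ) : W.jostReg j Q ≠ 0 := by
  unfold jostReg
  rcases eq_or_ne Q 0 with rfl | hQ
  · split_ifs with h
    · rw [Complex.ofReal_zero, dslope_same]
      have h1 : W.eigenderiv j W.h 0 = 0 := by simpa [jost] using h
      have hd : HasDerivAt (W.jost j) (W.eigenfun j W.h 0 +
          Complex.I * deriv (W.eigenderiv j W.h) 0) 0 := by
        have := ((hasDerivAt_id (0:ℂ)).mul (W.differentiable_eigenfun j W.h 0).hasDerivAt).add
          ((W.differentiable_eigenderiv j W.h 0).hasDerivAt.const_mul Complex.I)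
        simpa using! this
      have heven : deriv (W.eigenderiv j W.h) 0 = 0 := by
        have e : W.eigenderiv j W.h = fun Q => W.eigenderiv j W.h (-Q) :=
          funext fun Q => (W.eigenderiv_neg_right j W.h Q).symm
        have := congrFun (congrArg deriv e) 0
        rw [deriv_comp_neg, neg_zero] at this
        linear_combination this / 2
      rw [hd.deriv, heven, mul_zero, add_zero]
      exact fun h2 => W.eigenfun_eigenderiv_not_both_zero j W.h 0 h2 h1
    · simpa using h
  · have hQ' : (Q : ℂ) ≠ 0 := by exact_mod_cast hQ
    split_ifs with h
    · rw [dslope_of_ne _ hQ', slope_def_field, h, sub_zero, sub_zero]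
      exact div_ne_zero (W.jost_ne_zero j hQ) hQ'
    · exact W.jost_ne_zero j hQ

theorem differentiableAt_invJost (W : Waveguide) (j : Parity) {Q : ℂ} (hQ : W.jostReg j Q ≠ 0) :
    DifferentiableAt ℂ (W.invJost j) Q := by
  have hd := W.differentiable_jostReg j Q
  by_cases h : W.jost j 0 = 0
  · have e : W.invJost j = fun P => (W.jostReg j P)⁻¹ := by
      funext P; simp [invJost, jostReg, h]
    rw [e]
    exact hd.inv hQ
  · have e : W.invJost j = fun P => P / W.jostReg j P := by
      funext P; simp [invJost, jostReg, h]
    rw [e]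
    exact differentiableAt_id.div hd hQ

/-- The spectral kernel in terms of the normalized eigenfunctions. -/
theorem v_mul_v_mul_sigma (W : Waveguide) (j : Parity) {Q : ℝ} (hQ : 0 < Q) (x ξ : ℝ) :
    ((W.v j x (W.dSq + Q ^ 2) * W.v j ξ (W.dSq + Q ^ 2) * W.sigma j (W.dSq + Q ^ 2) : ℝ) : ℂ) =
      W.eigenfun j x Q * W.eigenfun j ξ Q * W.invJost j Q * W.invJost j (-Q) := by
  have hQ' : (Q : ℂ) ≠ 0 := by exact_mod_cast hQ.ne'
  have hl : 0 < W.dSq + Q ^ 2 := by have := W.dSq_nonneg; positivity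
  have hc : (phiScale j (W.dSq + Q ^ 2) : ℂ) ≠ 0 := by exact_mod_cast (phiScale_pos j hl).ne'
  have hh := W.h_pos
  have p := W.phi_eq j Q (x := W.h) ⟨by linarith, le_rfl⟩
  rw [W.invJost_eq j hQ', W.invJost_eq j (neg_ne_zero.2 hQ')]
  have j1 := W.jost_ne_zero j hQ.ne'
  have j2 := W.jost_ne_zero j (neg_ne_zero.2 hQ.ne')
  push_cast at j2 ⊢
  rw [v_eq W j hQ, v_eq W j hQ, sigma]
  push_cast
  rw [p.1, p.2]
  set c := (phiScale j (W.dSq + Q ^ 2) : ℂ)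
  have e : ((W.dSq:ℂ) + Q ^ 2 - W.dSq) * (c * W.eigenfun j W.h Q) ^ 2 +
      (c * W.eigenderiv j W.h Q) ^ 2 = c ^ 2 * -(W.jost j Q * W.jost j (-Q)) := by
    simp only [jost, eigenfun_neg_right, eigenderiv_neg_right]
    linear_combination c ^ 2 * W.eigenderiv j W.h Q ^ 2 * Complex.I_sq
  rw [e]
  field_simp
  ring

end Waveguide

/-! ### Contour deformation -/

/-- A function that is holomorphic at the points of a convex set, which need not be open, has a
primitive along all straight lines within the set. -/
theorem exists_primitive_of_convex {S : Set ℂ} (hS : Convex ℝ S) {g : ℂ → ℂ}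
    (hg : ∀ z ∈ S, DifferentiableAt ℂ g z) :
    ∃ G : ℂ → ℂ, ∀ z ∈ S, ∀ v : ℂ, ∀ s : ℝ, ∀ z₀ : ℂ, z = z₀ + s * v → ∀ T : Set ℝ,
      (∀ t ∈ T, z₀ + t * v ∈ S) → HasDerivWithinAt (fun t : ℝ => G (z₀ + t * v)) (g z * v) T s := by
  have hω : ∀ z ∈ S, HasFDerivWithinAt (fun z => ContinuousLinearMap.mul ℂ ℂ (g z))
      (((ContinuousLinearMap.mul ℂ ℂ).restrictScalars ℝ).comp
        ((fderiv ℂ g z).restrictScalars ℝ)) S z := by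
    intro z hz
    exact (((ContinuousLinearMap.mul ℂ ℂ).restrictScalars ℝ).hasFDerivAt.comp z
      ((hg z hz).hasFDerivAt.restrictScalars ℝ)).hasFDerivWithinAt
  obtain ⟨G, hG⟩ := hS.exists_forall_hasFDerivWithinAt_of_hasFDerivWithinAt_symmetric hω (by
    intro z _ x _ y _
    simp only [ContinuousLinearMap.comp_apply, ContinuousLinearMap.coe_restrictScalars',
      ContinuousLinearMap.mul_apply', fderiv_eq_smul_deriv, smul_eq_mul]
    ring)
  refine ⟨G, ?_⟩
  rintro z hz v s z₀ rfl T hT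
  have hline : HasDerivWithinAt (fun t : ℝ => z₀ + (t : ℂ) * v) v T s := by
    simpa using
      ((Complex.ofRealCLM.hasDerivAt (x := s)).mul_const v |>.const_add z₀).hasDerivWithinAt
  have := ((hG _ hz).restrictScalars ℝ).comp_hasDerivWithinAt s hline hT
  simpa using! this

theorem integral_line_eq_sub {g G : ℂ → ℂ} {S : Set ℂ} {z₀ v : ℂ} {α β : ℝ}
    (hg : ∀ z ∈ S, DifferentiableAt ℂ g z)
    (hG : ∀ z ∈ S, ∀ v : ℂ, ∀ s : ℝ, ∀ z₀ : ℂ, z = z₀ + s * v → ∀ T : Set ℝ,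
      (∀ t ∈ T, z₀ + t * v ∈ S) → HasDerivWithinAt (fun t : ℝ => G (z₀ + t * v)) (g z * v) T s)
    (hS : ∀ t ∈ uIcc α β, z₀ + t * v ∈ S) :
    (∫ t in α..β, g (z₀ + t * v)) * v = G (z₀ + β * v) - G (z₀ + α * v) := by
  have hd : ∀ t ∈ uIcc α β, HasDerivWithinAt (fun t : ℝ => G (z₀ + t * v))
      (g (z₀ + t * v) * v) (uIcc α β) t := fun t ht => hG _ (hS t ht) v t z₀ rfl _ hS
  rw [← intervalIntegral.integral_mul_const]
  refine intervalIntegral.integral_eq_sub_of_hasDeriv_right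
    (fun t ht => (hd t ht).continuousWithinAt) (fun t ht => ?_) ?_
  · exact ((hd t (Ioo_subset_Icc_self ht)).hasDerivAt
      (Icc_mem_nhds ht.1 ht.2)).hasDerivWithinAt
  · refine ContinuousOn.intervalIntegrable fun t ht => ?_
    have h1 : ContinuousAt (fun t : ℝ => z₀ + (t : ℂ) * v) t := by fun_prop
    exact ((ContinuousAt.comp (f := fun t : ℝ => z₀ + (t : ℂ) * v)
      (hg _ (hS t ht)).continuousAt h1).mul continuousAt_const).continuousWithinAt

/-- The integral of `g` along the broken line from `i∞` down to `0` and then to `θ`. -/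
noncomputable def contourIntegral (θ : ℝ) (g : ℂ → ℂ) : ℂ :=
  (∫ a in (0:ℝ)..θ, g a) - Complex.I * ∫ b in Ioi (0:ℝ), g (b * Complex.I)

/-- The contour from `i∞` to `θ` is replaced by the half line from `a₀ + i∞` down to
`a₀ + iη`, followed by a segment. -/
theorem contourIntegral_eq {g : ℂ → ℂ} {θ a₀ η : ℝ} (hη : 0 < η) (ha : |a₀| ≤ η)
    (hθ : θ ∈ Icc 0 Real.pi) (hηπ : η ≤ Real.pi)
    (hband : ∀ w : ℂ, -η ≤ w.re → w.re ≤ Real.pi → 0 ≤ w.im → w.im ≤ η →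
      DifferentiableAt ℂ g w)
    (hstrip : ∀ w : ℂ, w.re ∈ uIcc 0 a₀ → η ≤ w.im → DifferentiableAt ℂ g w)
    (h0 : IntegrableOn (fun b : ℝ => g (b * Complex.I)) (Ioi 0))
    (h1 : IntegrableOn (fun b : ℝ => g (a₀ + b * Complex.I)) (Ioi η))
    (htop : Filter.Tendsto (fun M : ℝ => ∫ a in (0:ℝ)..a₀, g (a + M * Complex.I))
      Filter.atTop (nhds 0)) :
    contourIntegral θ g =
      -((∫ t in (0:ℝ)..1, g (θ + t * (a₀ - θ + η * Complex.I))) * (a₀ - θ + η * Complex.I)) -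
        Complex.I * ∫ b in Ioi η, g (a₀ + b * Complex.I) := by
  obtain ⟨ha1, ha2⟩ := abs_le.1 ha
  -- the half line over `0` is moved to the half line over `a₀`
  have hrect : Complex.I * ∫ b in Ioi η, g (b * Complex.I) =
      (∫ a in (0:ℝ)..a₀, g (a + η * Complex.I)) +
        Complex.I * ∫ b in Ioi η, g (a₀ + b * Complex.I) := by
    have hM : ∀ M : ℝ, η ≤ M → Complex.I * ∫ b in η..M, g (b * Complex.I) =
        (∫ a in (0:ℝ)..a₀, g (a + η * Complex.I)) -
          (∫ a in (0:ℝ)..a₀, g (a + M * Complex.I)) +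
          Complex.I * ∫ b in η..M, g (a₀ + b * Complex.I) := by
      intro M hM
      have := Complex.integral_boundary_rect_eq_zero_of_differentiableOn g
        (η * Complex.I) (a₀ + M * Complex.I) (by
          intro w hw
          rw [Complex.mem_reProdIm] at hw
          simp only [Complex.mul_re, Complex.mul_im, Complex.ofReal_re, Complex.ofReal_im,
            Complex.I_re, Complex.I_im, Complex.add_re, Complex.add_im, mul_zero, mul_one,
            sub_zero, add_zero, zero_add] at hw
          rw [uIcc_of_le hM] at hw
          exact (hstrip w hw.1 hw.2.1).differentiableWithinAt)
      simp only [Complex.mul_re, Complex.mul_im, Complex.ofReal_re, Complex.ofReal_im,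
        Complex.I_re, Complex.I_im, Complex.add_re, Complex.add_im, mul_zero, mul_one,
        sub_zero, add_zero, zero_add, smul_eq_mul, Complex.ofReal_zero] at this
      linear_combination -this
    have t1 := (intervalIntegral_tendsto_integral_Ioi η
      (h0.mono_set (Ioi_subset_Ioi hη.le)) Filter.tendsto_id).const_mul Complex.I
    have t2 := ((tendsto_const_nhds (x := ∫ a in (0:ℝ)..a₀, g (a + η * Complex.I))).sub htop).add
      ((intervalIntegral_tendsto_integral_Ioi η h1 Filter.tendsto_id).const_mul Complex.I)
    rw [sub_zero] at t2
    refine tendsto_nhds_unique t1 (t2.congr' ?_)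
    filter_upwards [Filter.eventually_ge_atTop η] with M hM'
    exact (hM M hM').symm
  -- within the band, a primitive takes care of the remaining polygon
  set S : Set ℂ := {w | -η ≤ w.re ∧ w.re ≤ Real.pi ∧ 0 ≤ w.im ∧ w.im ≤ η} with hSdef
  have hSc : Convex ℝ S := by
    have : S = (Complex.reLm ⁻¹' Icc (-η) Real.pi) ∩ (Complex.imLm ⁻¹' Icc 0 η) := by
      ext w; simp [hSdef, and_assoc]
    rw [this]
    exact ((convex_Icc _ _).linear_preimage _).inter ((convex_Icc _ _).linear_preimage _)
  have hgS : ∀ z ∈ S, DifferentiableAt ℂ g z := fun z hz => hband z hz.1 hz.2.1 hz.2.2.1 hz.2.2.2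
  obtain ⟨G, hG⟩ := exists_primitive_of_convex hSc hgS
  have hpi := Real.pi_pos
  have e1 := integral_line_eq_sub (z₀ := 0) (v := 1) (α := 0) (β := θ) hgS hG (fun t ht => by
    rw [uIcc_of_le hθ.1] at ht
    simp only [hSdef, mem_ofPred_eq]
    simp
    exact ⟨by linarith [ht.1], by linarith [ht.2, hθ.2], hη.le⟩)
  have e2 := integral_line_eq_sub (z₀ := 0) (v := Complex.I) (α := 0) (β := η) hgS hG
    (fun t ht => by
      rw [uIcc_of_le hη.le] at ht
      simp only [hSdef, mem_ofPred_eq]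
      simp
      exact ⟨hη.le, hpi.le, ht.1, ht.2⟩)
  have e3 := integral_line_eq_sub (z₀ := η * Complex.I) (v := 1) (α := 0) (β := a₀) hgS hG
    (fun t ht => by
      have := uIcc_subset_Icc (a₂ := -η) (b₂ := η) ⟨by linarith, hη.le⟩ ⟨ha1, ha2⟩ ht
      simp only [hSdef, mem_ofPred_eq]
      simp
      exact ⟨this.1, by linarith [this.2], hη.le⟩)
  have e4 := integral_line_eq_sub (z₀ := θ) (v := a₀ - θ + η * Complex.I) (α := 0) (β := 1) hgS hG
    (fun t ht => by
      rw [uIcc_of_le zero_le_one] at ht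
      have m1 : (θ : ℂ) ∈ S := by
        simp only [hSdef, mem_ofPred_eq]; simp
        exact ⟨by linarith [hθ.1], hθ.2, hη.le⟩
      have m2 : (a₀ + η * Complex.I : ℂ) ∈ S := by
        simp only [hSdef, mem_ofPred_eq]; simp
        exact ⟨by linarith, by linarith, hη.le⟩
      have := hSc.add_smul_sub_mem m1 m2 ht
      convert this using 1
      simp only [Complex.real_smul]; ring)
  have hsplit : Complex.I * ∫ b in Ioi (0:ℝ), g (b * Complex.I) =
      Complex.I * (∫ b in (0:ℝ)..η, g (b * Complex.I)) +
        Complex.I * ∫ b in Ioi η, g (b * Complex.I) := by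
    rw [← mul_add, intervalIntegral.integral_of_le hη.le,
      ← setIntegral_union Ioc_disjoint_Ioi_same measurableSet_Ioi
      (h0.mono_set Ioc_subset_Ioi_self) (h0.mono_set (Ioi_subset_Ioi hη.le)),
      Ioc_union_Ioi_eq_Ioi hη.le]
  rw [contourIntegral, hsplit, hrect]
  simp only [zero_add, mul_one, Complex.ofReal_zero, zero_mul, add_zero, Complex.ofReal_one,
    one_mul] at e1 e2 e3 e4
  have e3' : (∫ a in (0:ℝ)..a₀, g (a + η * Complex.I)) =
      G (η * Complex.I + a₀) - G (η * Complex.I) := by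
    rw [← e3]; simp_rw [add_comm]
  have e5 : (θ + (a₀ - θ + η * Complex.I) : ℂ) = η * Complex.I + a₀ := by ring
  rw [e5] at e4
  rw [e4, e1, e3']
  linear_combination -e2

/-! ### Elementary bounds along the contour -/

/-- The region of decay of the phase is where `sin (θ - a) sinh b > 0`. -/
theorem norm_exp_I_cos (κ θ a b : ℝ) :
    ‖Complex.exp (Complex.I * κ * Complex.cos (a + b * Complex.I - θ))‖ =
      Real.exp (-(κ * Real.sin (θ - a) * Real.sinh b)) := by
  have e : (a + b * Complex.I - θ : ℂ) = ((a - θ : ℝ) : ℂ) + (b : ℝ) * Complex.I := by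
    push_cast; ring
  rw [e, Complex.cos_add_mul_I, Complex.norm_exp]
  congr 1
  rw [← Complex.ofReal_cos, ← Complex.ofReal_sin, ← Complex.ofReal_cosh, ← Complex.ofReal_sinh]
  simp only [Complex.mul_re, Complex.sub_re, Complex.sub_im, Complex.mul_im, Complex.I_re,
    Complex.I_im, Complex.ofReal_re, Complex.ofReal_im]
  rw [← neg_sub a θ, Real.sin_neg]
  ring

theorem norm_cos_sub_one_le (z : ℂ) : ‖Complex.cos z - 1‖ ≤ 2 * Real.exp |z.im| := by
  have h : ‖Complex.cos z‖ ≤ Real.exp |z.im| := by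
    rw [Complex.cos, norm_div]
    have h1 : ‖Complex.exp (z * Complex.I)‖ ≤ Real.exp |z.im| := by
      rw [Complex.norm_exp]; simpa using neg_le_abs z.im
    have h2 : ‖Complex.exp (-z * Complex.I)‖ ≤ Real.exp |z.im| := by
      rw [Complex.norm_exp]; simpa using le_abs_self z.im
    have := norm_add_le (Complex.exp (z * Complex.I)) (Complex.exp (-z * Complex.I))
    rw [Complex.norm_ofNat]
    linarith
  have h3 : (1:ℝ) ≤ Real.exp |z.im| := Real.one_le_exp (abs_nonneg _)
  have := norm_sub_le (Complex.cos z) 1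
  rw [norm_one] at this
  linarith

theorem norm_sin_le_exp (z : ℂ) : ‖Complex.sin z‖ ≤ Real.exp |z.im| := by
  rw [Complex.sin, norm_div, norm_mul, Complex.norm_I, mul_one]
  have h1 : ‖Complex.exp (z * Complex.I)‖ ≤ Real.exp |z.im| := by
    rw [Complex.norm_exp]; simpa using neg_le_abs z.im
  have h2 : ‖Complex.exp (-z * Complex.I)‖ ≤ Real.exp |z.im| := by
    rw [Complex.norm_exp]; simpa using le_abs_self z.im
  have := norm_sub_le (Complex.exp (-z * Complex.I)) (Complex.exp (z * Complex.I))
  rw [Complex.norm_ofNat]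
  linarith

theorem norm_cos_sub_one_le_sq (z : ℂ) :
    ‖Complex.cos z - 1‖ ≤ ‖z‖ ^ 2 * Real.exp (3 * ‖z‖) := by
  have e : Complex.cos z - 1 = (Complex.exp (z * Complex.I) - 1) ^ 2 *
      Complex.exp (-z * Complex.I) / 2 := by
    have h : Complex.exp (z * Complex.I) * Complex.exp (-z * Complex.I) = 1 := by
      rw [← Complex.exp_add]; simp
    rw [Complex.cos]
    linear_combination (-Complex.exp (z * Complex.I) / 2 + 1) * h
  have h1 := Complex.norm_exp_sub_sum_le_norm_mul_exp (z * Complex.I) 1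
  simp only [Finset.range_one, Finset.sum_singleton, pow_zero, Nat.factorial_zero, Nat.cast_one,
    div_one, pow_one, norm_mul, Complex.norm_I, mul_one] at h1
  have h2 : ‖Complex.exp (-z * Complex.I)‖ ≤ Real.exp ‖z‖ := by
    have := Complex.norm_exp_le_exp_norm (-z * Complex.I)
    simpa using! this
  rw [e, norm_div, norm_mul, norm_pow, Complex.norm_ofNat]
  have h3 : Real.exp (3 * ‖z‖) = Real.exp ‖z‖ ^ 2 * Real.exp ‖z‖ := by
    rw [← pow_succ, ← Real.exp_nat_mul]; norm_num
  have h4 : ‖Complex.exp (z * Complex.I) - 1‖ ^ 2 * ‖Complex.exp (-z * Complex.I)‖ ≤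
      (‖z‖ * Real.exp ‖z‖) ^ 2 * Real.exp ‖z‖ := by gcongr
  rw [h3]
  have h5 : 0 ≤ (‖z‖ * Real.exp ‖z‖) ^ 2 * Real.exp ‖z‖ := by positivity
  nlinarith

/-- Any positive multiple of `sinh b` eventually dominates `3 b`; quantitatively, `b² / 4 ≤ sinh b`
and `3 b ≤ γ b² / 4 + 9 / γ`. -/
theorem exp_sub_sinh_le {γ : ℝ} (hγ : 0 < γ) {b : ℝ} (hb : 0 ≤ b) :
    Real.exp (2 * b - γ * Real.sinh b) ≤ Real.exp (9 / γ) * Real.exp (-b) := by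
  rw [← Real.exp_add, Real.exp_le_exp]
  have h1 : b ^ 2 / 4 ≤ Real.sinh b := by
    have h2 := Real.quadratic_le_exp_of_nonneg hb
    have h3 : Real.exp (-b) ≤ 1 := Real.exp_le_one_iff.2 (by linarith)
    rw [Real.sinh_eq]
    nlinarith
  have h2 : 3 * b ≤ γ * (b ^ 2 / 4) + 9 / γ := by
    have : 0 ≤ (γ * b / 2 - 3) ^ 2 / γ := by positivity
    have e : (γ * b / 2 - 3) ^ 2 / γ = γ * (b ^ 2 / 4) + 9 / γ - 3 * b := by field_simp; ring
    linarith
  nlinarith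

theorem integral_gaussian_Icc_le {c : ℝ} (hc : 0 < c) :
    ∫ t in (0:ℝ)..1, Real.exp (-(c * t ^ 2)) ≤ 2 / Real.sqrt c := by
  have hi := integrable_exp_neg_mul_sq hc
  have h1 : ∫ t in (0:ℝ)..1, Real.exp (-(c * t ^ 2)) ≤ Real.sqrt (Real.pi / c) := by
    rw [← integral_gaussian, intervalIntegral.integral_of_le zero_le_one]
    simp_rw [← neg_mul]
    exact setIntegral_le_integral hi (Filter.Eventually.of_forall fun t => (Real.exp_pos _).le)
  refine h1.trans ?_
  rw [Real.sqrt_div Real.pi_pos.le]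
  gcongr
  rw [Real.sqrt_le_left (by norm_num)]
  linarith [Real.pi_lt_four]

/-! ### The stationary phase estimate -/

theorem sin_le_sin_of_mem {η ψ : ℝ} (hη : 0 ≤ η) (h1 : η ≤ ψ) (h2 : ψ ≤ Real.pi - η) :
    Real.sin η ≤ Real.sin ψ := by
  rcases le_total ψ (Real.pi / 2) with h | h
  · exact Real.sin_le_sin_of_le_of_le_pi_div_two (by linarith [Real.pi_pos]) h h1
  · rw [← Real.sin_pi_sub ψ]
    exact Real.sin_le_sin_of_le_of_le_pi_div_two (by linarith [Real.pi_pos]) (by linarith)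
      (by linarith)

theorem sin_convex_comb_ge {x y s t : ℝ} (hx : x ∈ Icc 0 Real.pi) (hy : y ∈ Icc 0 Real.pi)
    (hs : 0 ≤ s) (ht : 0 ≤ t) (hst : s + t = 1) :
    s * Real.sin x + t * Real.sin y ≤ Real.sin (s * x + t * y) := by
  simpa using strictConcaveOn_sin_Icc.concaveOn.2 hx hy hs ht hst

/-- The integrand of the oscillatory integrals, with `n = 1` if the amplitude carries a factor
vanishing to second order at the stationary point `θ`. -/
noncomputable def oscIntegrand (θ κ : ℝ) (n : ℕ) (f : ℂ → ℂ) (w : ℂ) : ℂ :=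
  (Complex.cos (w - θ) - 1) ^ n * Complex.exp (Complex.I * κ * Complex.cos (w - θ)) * f w

theorem norm_oscIntegrand_le {θ κ M D : ℝ} {n : ℕ} (hn : n ≤ 1) {f : ℂ → ℂ} {a b : ℝ}
    (hb : 0 ≤ b) (hf : ‖f (a + b * Complex.I)‖ ≤ M * Real.exp (D * Real.sinh b + b)) :
    ‖oscIntegrand θ κ n f (a + b * Complex.I)‖ ≤
      2 * M * Real.exp (2 * b - (κ * Real.sin (θ - a) - D) * Real.sinh b) := by
  rw [oscIntegrand, norm_mul, norm_mul, norm_exp_I_cos, norm_pow]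
  have h1 : ‖Complex.cos (a + b * Complex.I - θ) - 1‖ ^ n ≤ 2 * Real.exp b := by
    have h2 := norm_cos_sub_one_le (a + b * Complex.I - θ)
    have h3 : (a + b * Complex.I - θ : ℂ).im = b := by simp
    rw [h3, abs_of_nonneg hb] at h2
    have h4 := Real.one_le_exp hb
    interval_cases n
    · rw [pow_zero]; linarith
    · rwa [pow_one]
  calc _ ≤ 2 * Real.exp b * Real.exp (-(κ * Real.sin (θ - a) * Real.sinh b)) *
        (M * Real.exp (D * Real.sinh b + b)) := by gcongr
    _ = 2 * M * (Real.exp b * Real.exp (-(κ * Real.sin (θ - a) * Real.sinh b)) *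
        Real.exp (D * Real.sinh b + b)) := by ring
    _ = _ := by rw [← Real.exp_add, ← Real.exp_add]; congr 2; ring

theorem differentiableAt_oscIntegrand {θ κ : ℝ} {n : ℕ} {f : ℂ → ℂ} {w : ℂ}
    (hf : DifferentiableAt ℂ f w) : DifferentiableAt ℂ (oscIntegrand θ κ n f) w := by
  unfold oscIntegrand
  fun_prop

theorem continuousOn_vertical {g : ℂ → ℂ} {a : ℝ} {T : Set ℝ}
    (hg : ∀ b ∈ T, DifferentiableAt ℂ g (a + b * Complex.I)) :
    ContinuousOn (fun b : ℝ => g (a + b * Complex.I)) T := by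
  intro b hb
  have h1 : ContinuousAt (fun b : ℝ => (a : ℂ) + b * Complex.I) b := by fun_prop
  exact (ContinuousAt.comp (f := fun b : ℝ => (a : ℂ) + b * Complex.I)
    (hg b hb).continuousAt h1).continuousWithinAt

theorem integrableOn_of_exp_bound {F : ℝ → ℂ} {c A : ℝ}
    (hF : ContinuousOn F (Ioi c)) (hb : ∀ b ∈ Ioi c, ‖F b‖ ≤ A * Real.exp (-b)) :
    IntegrableOn F (Ioi c) := by
  have h := (exp_neg_integrableOn_Ioi c one_pos).const_mul A
  refine Integrable.mono' h (hF.aestronglyMeasurable measurableSet_Ioi) ?_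
  refine (ae_restrict_iff' measurableSet_Ioi).2 (Filter.Eventually.of_forall fun b hb' => ?_)
  simpa using hb b hb'

/-- Along the segment from the stationary point `θ` towards `a₀ + iη` the integrand is dominated
by a Gaussian, which gives the order `κ ^ (-n - 1/2)`. -/
theorem norm_integral_segment_le {η : ℝ} (hη : 0 < η) (hη1 : η ≤ 1 / 2) :
    ∃ K : ℝ, 0 ≤ K ∧ ∀ (θ a₀ κ M : ℝ) (f : ℂ → ℂ) (n : ℕ), n ≤ 1 → η ≤ θ - a₀ →
      θ - a₀ ≤ Real.pi - η → 0 < κ →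
      (∀ t ∈ Icc (0:ℝ) 1, ‖f (θ + t * (a₀ - θ + η * Complex.I))‖ ≤ M) →
      ‖(∫ t in (0:ℝ)..1, oscIntegrand θ κ n f (θ + t * (a₀ - θ + η * Complex.I))) *
        (a₀ - θ + η * Complex.I)‖ ≤ K * M / (κ ^ n * Real.sqrt κ) := by
  have hpi := Real.pi_lt_d2
  have hpi3 := Real.pi_gt_three
  have hs : 0 < Real.sin η := Real.sin_pos_of_pos_of_lt_pi hη (by linarith)
  set c := η * Real.sin η
  have hc : 0 < c := by positivity
  -- the segment has length at most `4`, whence `|cos (t d) - 1| ≤ (4 t)² exp (3 * 4)`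
  set L := 16 * Real.exp 12
  have hL : 0 < L := by positivity
  set L1 := max 1 (2 * L / c)
  have hL1 : 0 < L1 := lt_max_of_lt_left one_pos
  refine ⟨8 * L1 / Real.sqrt (c / 2), by positivity, fun θ a₀ κ M f n hn h1 h2 hκ hf => ?_⟩
  have hM : 0 ≤ M := (norm_nonneg _).trans (hf 0 ⟨le_rfl, zero_le_one⟩)
  set d : ℂ := a₀ - θ + η * Complex.I with hd
  have hdn : ‖d‖ ≤ 4 := by
    have e : d = ((a₀ - θ : ℝ) : ℂ) + (η : ℝ) * Complex.I := by rw [hd]; push_cast; ring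
    have h3 := norm_add_le ((a₀ - θ : ℝ) : ℂ) ((η : ℝ) * Complex.I)
    rw [← e, norm_mul, Complex.norm_I, mul_one, Complex.norm_real, Complex.norm_real,
      Real.norm_eq_abs, Real.norm_eq_abs, abs_of_pos hη, abs_of_nonpos (by linarith)] at h3
    linarith
  have hpt : ∀ t ∈ Icc (0:ℝ) 1, ‖oscIntegrand θ κ n f (θ + t * d)‖ ≤
      L1 / κ ^ n * M * Real.exp (-(κ * (c / 2) * t ^ 2)) := by
    intro t ht
    have e : (θ + t * d : ℂ) = ((θ + t * (a₀ - θ) : ℝ) : ℂ) + (t * η : ℝ) * Complex.I := by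
      rw [hd]; push_cast; ring
    have hE : ‖Complex.exp (Complex.I * κ * Complex.cos (θ + t * d - θ))‖ ≤
        Real.exp (-(κ * c * t ^ 2)) := by
      rw [e, norm_exp_I_cos, Real.exp_le_exp, neg_le_neg_iff]
      have s1 : t * Real.sin η ≤ Real.sin (θ - (θ + t * (a₀ - θ))) := by
        have := sin_convex_comb_ge (x := 0) (y := θ - a₀) (s := 1 - t) (t := t)
          ⟨le_rfl, by linarith⟩ ⟨by linarith, by linarith⟩ (by linarith [ht.2]) ht.1 (by ring)
        have h3 := sin_le_sin_of_mem hη.le h1 h2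
        rw [Real.sin_zero, mul_zero, zero_add, zero_add] at this
        have e2 : θ - (θ + t * (a₀ - θ)) = t * (θ - a₀) := by ring
        rw [e2]
        exact (mul_le_mul_of_nonneg_left h3 ht.1).trans this
      have s2 : t * η ≤ Real.sinh (t * η) := Real.self_le_sinh_iff.2 (mul_nonneg ht.1 hη.le)
      have h4 : (t * Real.sin η) * (t * η) ≤ Real.sin (θ - (θ + t * (a₀ - θ))) *
          Real.sinh (t * η) := by
        have := mul_nonneg ht.1 hη.le
        have h5 := mul_nonneg ht.1 hs.le
        exact mul_le_mul s1 s2 this (h5.trans s1)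
      calc κ * c * t ^ 2 = κ * ((t * Real.sin η) * (t * η)) := by simp only [c]; ring
        _ ≤ _ := by rw [mul_assoc κ (Real.sin _)]; exact mul_le_mul_of_nonneg_left h4 hκ.le
    have hcos : ‖Complex.cos (θ + t * d - θ) - 1‖ ≤ L * t ^ 2 := by
      have e3 : (θ + t * d - θ : ℂ) = t * d := by ring
      have h5 : ‖(t * d : ℂ)‖ ≤ 4 * t := by
        rw [norm_mul, Complex.norm_real, Real.norm_eq_abs, abs_of_nonneg ht.1]
        nlinarith [ht.1]
      have h6 : ‖(t * d : ℂ)‖ ≤ 4 := h5.trans (by linarith [ht.2])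
      rw [e3]
      refine (norm_cos_sub_one_le_sq _).trans ?_
      calc _ ≤ (4 * t) ^ 2 * Real.exp (3 * 4) := by gcongr
        _ = _ := by simp only [L]; norm_num; ring
    have hsplit : Real.exp (-(κ * c * t ^ 2)) =
        Real.exp (-(κ * (c / 2) * t ^ 2)) * Real.exp (-(κ * (c / 2) * t ^ 2)) := by
      rw [← Real.exp_add]; congr 1; ring
    have hy : 0 ≤ κ * (c / 2) * t ^ 2 := by positivity
    have hfac : ‖Complex.cos (θ + t * d - θ) - 1‖ ^ n * Real.exp (-(κ * (c / 2) * t ^ 2)) ≤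
        L1 / κ ^ n := by
      interval_cases n
      · rw [pow_zero, one_mul, pow_zero, div_one]
        exact (Real.exp_le_one_iff.2 (by linarith)).trans (le_max_left _ _)
      · rw [pow_one, pow_one, le_div_iff₀ hκ]
        have h7 : κ * (c / 2) * t ^ 2 * Real.exp (-(κ * (c / 2) * t ^ 2)) ≤ 1 := by
          rw [Real.exp_neg, ← div_eq_mul_inv, div_le_one (Real.exp_pos _)]
          linarith [Real.add_one_le_exp (κ * (c / 2) * t ^ 2)]
        calc _ ≤ L * t ^ 2 * Real.exp (-(κ * (c / 2) * t ^ 2)) * κ := by gcongr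
          _ = 2 * L / c * (κ * (c / 2) * t ^ 2 * Real.exp (-(κ * (c / 2) * t ^ 2))) := by
              field_simp
          _ ≤ 2 * L / c * 1 := by gcongr
          _ ≤ L1 := by rw [mul_one]; exact le_max_right _ _
    rw [oscIntegrand, norm_mul, norm_mul, norm_pow]
    calc _ ≤ ‖Complex.cos (θ + t * d - θ) - 1‖ ^ n *
          (Real.exp (-(κ * (c / 2) * t ^ 2)) * Real.exp (-(κ * (c / 2) * t ^ 2))) * M := by
          rw [← hsplit]
          gcongr
          exact hf t ht
      _ = (‖Complex.cos (θ + t * d - θ) - 1‖ ^ n * Real.exp (-(κ * (c / 2) * t ^ 2))) *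
          (M * Real.exp (-(κ * (c / 2) * t ^ 2))) := by ring
      _ ≤ L1 / κ ^ n * (M * Real.exp (-(κ * (c / 2) * t ^ 2))) := by gcongr
      _ = _ := by ring
  have hint : ‖∫ t in (0:ℝ)..1, oscIntegrand θ κ n f (θ + t * d)‖ ≤
      L1 / κ ^ n * M * (2 / Real.sqrt (κ * (c / 2))) := by
    refine (intervalIntegral.norm_integral_le_of_norm_le zero_le_one
      (Filter.Eventually.of_forall fun t ht => hpt t ⟨ht.1.le, ht.2⟩)
      (Continuous.intervalIntegrable (by fun_prop) _ _)).trans ?_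
    rw [intervalIntegral.integral_const_mul]
    have := integral_gaussian_Icc_le (c := κ * (c / 2)) (by positivity)
    gcongr
  rw [norm_mul]
  calc _ ≤ L1 / κ ^ n * M * (2 / Real.sqrt (κ * (c / 2))) * 4 := by gcongr
    _ = _ := by
      rw [Real.sqrt_mul hκ.le]
      field_simp
      ring

/-- Contour integrals ending at the stationary point `θ` are of order `κ ^ (-n - 1/2)`. The
amplitude may grow like `exp (C |re w| sinh (im w))` on the half strip, which the phase compensates
for large `κ` because `sin (θ - a₀)` is bounded below. -/
theorem norm_contourIntegral_le {η C : ℝ} (hη : 0 < η) (hη1 : η ≤ 1 / 2) (hC : 0 ≤ C) :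
    ∃ K κ₀ : ℝ, 1 ≤ κ₀ ∧ 0 ≤ K ∧ ∀ (θ a₀ κ M : ℝ) (f : ℂ → ℂ) (n : ℕ), n ≤ 1 →
      θ ∈ Ioo 0 Real.pi → |a₀| ≤ η → η ≤ θ - a₀ → θ - a₀ ≤ Real.pi - η → κ₀ ≤ κ →
      (∀ w : ℂ, -η ≤ w.re → w.re ≤ Real.pi → 0 ≤ w.im → w.im ≤ η →
        DifferentiableAt ℂ f w ∧ ‖f w‖ ≤ M) →
      (∀ w : ℂ, w.re ∈ uIcc 0 a₀ → η ≤ w.im → DifferentiableAt ℂ f w ∧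
        ‖f w‖ ≤ M * Real.exp (C * |w.re| * Real.sinh w.im + w.im)) →
      IntegrableOn (fun b : ℝ => oscIntegrand θ κ n f (b * Complex.I)) (Ioi 0) ∧
      ‖contourIntegral θ (oscIntegrand θ κ n f)‖ ≤ K * M / (κ ^ n * Real.sqrt κ) := by
  have hpi := Real.pi_gt_three
  have hs : 0 < Real.sin η := Real.sin_pos_of_pos_of_lt_pi hη (by linarith)
  set s := Real.sin η with hsdef
  obtain ⟨K, hK, hseg⟩ := norm_integral_segment_le hη hη1
  refine ⟨K + 32 / (s ^ 2 * η), max 1 (max ((2 * C * η) / s) (8 / s)), le_max_left _ _,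
    by positivity, fun θ a₀ κ M f n hn hθ ha h1 h2 hκ hband hstrip => ?_⟩
  have hκ1 : 1 ≤ κ := (le_max_left _ _).trans hκ
  have hκ2 : 2 * C * η ≤ κ * s :=
    (div_le_iff₀ hs).1 ((le_max_left _ _).trans ((le_max_right _ _).trans hκ))
  have hκ3 : 8 ≤ κ * s :=
    (div_le_iff₀ hs).1 ((le_max_right _ _).trans ((le_max_right _ _).trans hκ))
  have hM : 0 ≤ M := (norm_nonneg _).trans
    (hband 0 (by simpa using hη.le) (by simpa using Real.pi_pos.le) (by simp) (by simpa using hη.le)).2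
  set g := oscIntegrand θ κ n f with hg
  have hsinθ : 0 < Real.sin θ := Real.sin_pos_of_mem_Ioo hθ
  -- `γ` is a rate of decay on the whole half strip; it may degenerate as `θ` tends to `0` or `π`,
  -- but it only serves to justify the deformation and does not enter the final bound
  set γ := min (κ * Real.sin θ) (κ * s - C * η)
  have hγ : 0 < γ := lt_min (by positivity) (by linarith)
  have hψ : s ≤ Real.sin (θ - a₀) := sin_le_sin_of_mem hη.le h1 h2
  have hγle : ∀ a ∈ uIcc 0 a₀, γ ≤ κ * Real.sin (θ - a) - C * |a| := by
    intro a ha'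
    rw [← segment_eq_uIcc] at ha'
    obtain ⟨p, τ, hp, hτ, hpτ, rfl⟩ := ha'
    have e1 : θ - (p • 0 + τ • a₀) = p * θ + τ * (θ - a₀) := by
      simp only [smul_eq_mul]; linear_combination (-θ) * hpτ
    have h3 := sin_convex_comb_ge (x := θ) (y := θ - a₀) ⟨hθ.1.le, hθ.2.le⟩
      ⟨by linarith, by linarith⟩ hp hτ hpτ
    have e2 : |p • 0 + τ • a₀| = τ * |a₀| := by simp [abs_mul, abs_of_nonneg hτ]
    rw [e1, e2]
    have h4 : κ * (p * Real.sin θ + τ * s) ≤ κ * Real.sin (p * θ + τ * (θ - a₀)) := by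
      have := mul_le_mul_of_nonneg_left hψ hτ
      exact mul_le_mul_of_nonneg_left (by linarith) (by linarith)
    have h5 : C * (τ * |a₀|) ≤ τ * (C * η) := by
      have := mul_le_mul_of_nonneg_left ha (mul_nonneg hC hτ)
      linarith
    have h6 : p * γ ≤ p * (κ * Real.sin θ) := mul_le_mul_of_nonneg_left (min_le_left _ _) hp
    have h7 : τ * γ ≤ τ * (κ * s - C * η) := mul_le_mul_of_nonneg_left (min_le_right _ _) hτ
    have h8 : p * γ + τ * γ = γ := by rw [← add_mul, hpτ, one_mul]
    linarith
  have hgd_band : ∀ w : ℂ, -η ≤ w.re → w.re ≤ Real.pi → 0 ≤ w.im → w.im ≤ η →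
      DifferentiableAt ℂ g w := fun w p1 p2 p3 p4 =>
    differentiableAt_oscIntegrand (hband w p1 p2 p3 p4).1
  have hgd_strip : ∀ w : ℂ, w.re ∈ uIcc 0 a₀ → η ≤ w.im → DifferentiableAt ℂ g w :=
    fun w p1 p2 => differentiableAt_oscIntegrand (hstrip w p1 p2).1
  have hre : ∀ a b : ℝ, (a + b * Complex.I : ℂ).re = a := fun a b => by simp
  have him : ∀ a b : ℝ, (a + b * Complex.I : ℂ).im = b := fun a b => by simp
  -- bounds in the strip and on the imaginary axis
  have hgb : ∀ a ∈ uIcc 0 a₀, ∀ b : ℝ, η ≤ b → ‖g (a + b * Complex.I)‖ ≤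
      2 * M * Real.exp (2 * b - (κ * Real.sin (θ - a) - C * |a|) * Real.sinh b) := by
    intro a ha' b hb
    refine norm_oscIntegrand_le hn (hη.le.trans hb) ?_
    have := (hstrip (a + b * Complex.I) (by rwa [hre]) (by rwa [him])).2
    rwa [hre, him] at this
  have hgγ : ∀ a ∈ uIcc 0 a₀, ∀ b : ℝ, η ≤ b → ‖g (a + b * Complex.I)‖ ≤
      2 * M * Real.exp (9 / γ) * Real.exp (-b) := by
    intro a ha' b hb
    have hb0 : 0 ≤ b := hη.le.trans hb
    refine (hgb a ha' b hb).trans ?_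
    rw [mul_assoc (2 * M)]
    refine mul_le_mul_of_nonneg_left (le_trans ?_ (exp_sub_sinh_le hγ hb0)) (by positivity)
    rw [Real.exp_le_exp]
    have := mul_le_mul_of_nonneg_right (hγle a ha') (Real.sinh_nonneg_iff.2 hb0)
    linarith
  have hg0 : ∀ b ∈ Ioi (0:ℝ), ‖g ((0:ℝ) + b * Complex.I)‖ ≤
      2 * M * Real.exp (9 / γ) * Real.exp (-b) := by
    intro b hb
    have hb0 : (0:ℝ) < b := hb
    rcases le_total η b with h | h
    · exact hgγ 0 left_mem_uIcc b h
    · have h3 : ‖f ((0:ℝ) + b * Complex.I)‖ ≤ M * Real.exp (0 * Real.sinh b + b) := by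
        have h4 := (hband ((0:ℝ) + b * Complex.I) (by rw [hre]; linarith)
          (by rw [hre]; exact Real.pi_pos.le) (by rw [him]; exact hb0.le) (by rwa [him])).2
        refine h4.trans (le_mul_of_one_le_right hM (Real.one_le_exp (by linarith)))
      refine (norm_oscIntegrand_le hn hb0.le h3).trans ?_
      rw [mul_assoc (2 * M)]
      refine mul_le_mul_of_nonneg_left (le_trans ?_ (exp_sub_sinh_le hγ hb0.le)) (by positivity)
      rw [Real.exp_le_exp]
      have := mul_le_mul_of_nonneg_right (min_le_left (κ * Real.sin θ) (κ * s - C * η))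
        (Real.sinh_nonneg_iff.2 hb0.le)
      rw [sub_zero, sub_zero]
      linarith
  have h0 : IntegrableOn (fun b : ℝ => g (b * Complex.I)) (Ioi 0) := by
    have := integrableOn_of_exp_bound (F := fun b : ℝ => g ((0:ℝ) + b * Complex.I))
      (continuousOn_vertical fun b hb => ?_) hg0
    · simpa using this
    · have hb0 : (0:ℝ) < b := hb
      rcases le_total η b with h | h
      · exact hgd_strip _ (by rw [hre]; exact left_mem_uIcc) (by rwa [him])
      · exact hgd_band _ (by rw [hre]; linarith) (by rw [hre]; exact Real.pi_pos.le)
          (by rw [him]; exact hb0.le) (by rwa [him])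
  refine ⟨h0, ?_⟩
  have hi1 : IntegrableOn (fun b : ℝ => g (a₀ + b * Complex.I)) (Ioi η) :=
    integrableOn_of_exp_bound (continuousOn_vertical fun b hb =>
      hgd_strip _ (by rw [hre]; exact right_mem_uIcc) (by rw [him]; exact (mem_Ioi.1 hb).le))
      fun b hb => hgγ a₀ right_mem_uIcc b (mem_Ioi.1 hb).le
  have htop : Filter.Tendsto (fun M' : ℝ => ∫ a in (0:ℝ)..a₀, g (a + M' * Complex.I))
      Filter.atTop (nhds 0) := by
    have lim : Filter.Tendsto (fun b : ℝ => 2 * M * Real.exp (9 / γ) * Real.exp (-b) * |a₀ - 0|)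
        Filter.atTop (nhds 0) := by
      have := (Real.tendsto_exp_neg_atTop_nhds_zero.const_mul
        (2 * M * Real.exp (9 / γ))).mul_const |a₀ - 0|
      simpa using this
    refine squeeze_zero_norm' ?_ lim
    filter_upwards [Filter.eventually_ge_atTop η] with b hb
    exact intervalIntegral.norm_integral_le_of_norm_le_const fun a ha' =>
      hgγ a (uIoc_subset_uIcc ha') b hb
  rw [contourIntegral_eq hη ha ⟨hθ.1.le, hθ.2.le⟩ (by linarith) hgd_band hgd_strip h0 hi1 htop]
  have hsg := hseg θ a₀ κ M f n hn h1 h2 (by linarith) (fun t ht => by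
    obtain ⟨ha1, ha2⟩ := abs_le.1 ha
    have e : (θ + t * (a₀ - θ + η * Complex.I) : ℂ) =
        ((θ + t * (a₀ - θ) : ℝ) : ℂ) + (t * η : ℝ) * Complex.I := by push_cast; ring
    rw [e]
    have ht1 := mul_nonneg ht.1 hη.le
    have ht2 : t * (θ - a₀) ≤ θ - a₀ := mul_le_of_le_one_left (by linarith) ht.2
    have ht3 : 0 ≤ t * (θ - a₀) := mul_nonneg ht.1 (by linarith)
    have ht4 : t * η ≤ η := mul_le_of_le_one_left hη.le ht.2
    refine (hband _ ?_ ?_ ?_ ?_).2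
    · rw [hre]; linarith
    · rw [hre]; linarith [hθ.2]
    · rw [him]; exact ht1
    · rw [him]; exact ht4)
  -- the remaining half line contributes only `O(κ ^ (-2))`
  have hvert : ‖∫ b in Ioi η, g (a₀ + b * Complex.I)‖ ≤ 32 / (s ^ 2 * η) * M / κ ^ 2 := by
    set c := κ * s / 4
    have hc : 0 < c := by positivity
    have hpt : ∀ b ∈ Ioi η, ‖g (a₀ + b * Complex.I)‖ ≤ 2 * M * Real.exp (-c * b) := by
      intro b hb
      have hb' : η ≤ b := (mem_Ioi.1 hb).le
      have hb0 : 0 ≤ b := hη.le.trans hb'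
      refine (hgb a₀ right_mem_uIcc b hb').trans ?_
      refine mul_le_mul_of_nonneg_left ?_ (by positivity)
      rw [Real.exp_le_exp]
      have h3 : b ≤ Real.sinh b := Real.self_le_sinh_iff.2 hb0
      have h4 : C * |a₀| ≤ C * η := mul_le_mul_of_nonneg_left ha hC
      have h5 : κ * s ≤ κ * Real.sin (θ - a₀) := mul_le_mul_of_nonneg_left hψ (by linarith)
      have h6 : κ * s / 2 ≤ κ * Real.sin (θ - a₀) - C * |a₀| := by linarith
      have h7 : κ * s / 2 * b ≤ (κ * Real.sin (θ - a₀) - C * |a₀|) * Real.sinh b :=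
        mul_le_mul h6 h3 hb0 (by linarith)
      have h8 : 2 * b ≤ κ * s / 4 * b := mul_le_mul_of_nonneg_right (by linarith) hb0
      simp only [c]
      linarith
    have hI := (exp_neg_integrableOn_Ioi η hc).const_mul (2 * M)
    refine (norm_integral_le_of_norm_le hI
      ((ae_restrict_iff' measurableSet_Ioi).2 (Filter.Eventually.of_forall hpt))).trans ?_
    rw [integral_const_mul, integral_exp_mul_Ioi (by linarith), neg_div_neg_eq]
    have h9 : Real.exp (-c * η) ≤ 1 / (c * η) := by
      rw [neg_mul, Real.exp_neg, ← one_div]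
      refine one_div_le_one_div_of_le (by positivity) ?_
      linarith [Real.add_one_le_exp (c * η)]
    calc _ ≤ 2 * M * (1 / (c * η) / c) := by gcongr
      _ = _ := by simp only [c]; field_simp; ring
  have hpow : κ ^ n * Real.sqrt κ ≤ κ ^ 2 := by
    have h3 : Real.sqrt κ ≤ κ := by
      rw [Real.sqrt_le_left (by linarith)]; nlinarith
    have h4 : κ ^ n ≤ κ := by
      simpa using pow_le_pow_right₀ hκ1 hn
    calc _ ≤ κ * κ := mul_le_mul h4 h3 (Real.sqrt_nonneg _) (by linarith)
      _ = _ := by ring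
  have hκpos : 0 < κ := by linarith
  have hvert' : ‖∫ b in Ioi η, g (a₀ + b * Complex.I)‖ ≤
      32 / (s ^ 2 * η) * M / (κ ^ n * Real.sqrt κ) := by
    refine hvert.trans ?_
    gcongr
  refine (norm_sub_le _ _).trans ?_
  rw [norm_neg, norm_mul Complex.I, Complex.norm_I, one_mul, add_mul, add_div]
  exact add_le_add hsg hvert'

/-! ### Superpositions of plane waves -/

/-- Integrability along both legs of the contour of `contourIntegral`. -/
structure ContourIntegrable (θ : ℝ) (g : ℂ → ℂ) : Prop where
  horizontal : IntervalIntegrable (fun a : ℝ => g a) volume 0 θ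
  vertical : IntegrableOn (fun b : ℝ => g (b * Complex.I)) (Ioi 0)

theorem ContourIntegrable.add {θ : ℝ} {f g : ℂ → ℂ} (hf : ContourIntegrable θ f)
    (hg : ContourIntegrable θ g) : ContourIntegrable θ fun w => f w + g w :=
  ⟨hf.1.add hg.1, hf.2.add hg.2⟩

theorem ContourIntegrable.const_mul {θ : ℝ} {f : ℂ → ℂ} (hf : ContourIntegrable θ f) (c : ℂ) :
    ContourIntegrable θ fun w => c * f w :=
  ⟨hf.1.const_mul c, hf.2.const_mul c⟩

theorem contourIntegral_add {θ : ℝ} {f g : ℂ → ℂ} (hf : ContourIntegrable θ f)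
    (hg : ContourIntegrable θ g) :
    contourIntegral θ (fun w => f w + g w) = contourIntegral θ f + contourIntegral θ g := by
  simp only [contourIntegral]
  rw [intervalIntegral.integral_add hf.1 hg.1, integral_add hf.2 hg.2]
  ring

theorem contourIntegral_const_mul (θ : ℝ) (f : ℂ → ℂ) (c : ℂ) :
    contourIntegral θ (fun w => c * f w) = c * contourIntegral θ f := by
  simp only [contourIntegral]
  rw [intervalIntegral.integral_const_mul, integral_const_mul]
  ring

/-- Two contours ending at `π / 2`, whose integrands are mirror images of each other, may be
prolonged to mirror points. -/
theorem contourIntegral_add_reflect {f g : ℂ → ℂ} {θ : ℝ}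
    (hf : Continuous fun a : ℝ => f a) (hg : Continuous fun a : ℝ => g a)
    (hfg : ∀ a : ℝ, g ((Real.pi - a : ℝ) : ℂ) = f a) :
    contourIntegral (Real.pi / 2) f + contourIntegral (Real.pi / 2) g =
      contourIntegral θ f + contourIntegral (Real.pi - θ) g := by
  simp only [contourIntegral]
  have h1 := intervalIntegral.integral_add_adjacent_intervals
    (hf.intervalIntegrable (μ := volume) 0 θ) (hf.intervalIntegrable θ (Real.pi / 2))
  have h2 := intervalIntegral.integral_add_adjacent_intervals
    (hg.intervalIntegrable (μ := volume) 0 (Real.pi - θ))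
    (hg.intervalIntegrable (Real.pi - θ) (Real.pi / 2))
  have h3 : ∫ a in θ..(Real.pi / 2), f a = -∫ a in (Real.pi - θ)..(Real.pi / 2), g a := by
    simp_rw [← hfg]
    rw [intervalIntegral.integral_comp_sub_left (fun a : ℝ => g a), intervalIntegral.integral_symm]
    congr 2
    ring
  rw [← h1, ← h2, h3]
  ring

/-- The plane wave `e^{iβ (X cos w + Z sin w)}` with complex angle of incidence `w`. -/
noncomputable def planeWave (β X Z : ℝ) (w : ℂ) : ℂ :=
  Complex.exp (Complex.I * β * (X * Complex.cos w + Z * Complex.sin w))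

theorem planeWave_polar (β ρ θ : ℝ) (w : ℂ) :
    planeWave β (ρ * Real.cos θ) (ρ * Real.sin θ) w =
      Complex.exp (Complex.I * (β * ρ : ℝ) * Complex.cos (w - θ)) := by
  rw [planeWave, Complex.cos_sub]; congr 1; push_cast; ring

theorem norm_planeWave_real (β X Z a : ℝ) : ‖planeWave β X Z a‖ = 1 := by
  rw [planeWave, Complex.norm_exp, ← Complex.ofReal_cos, ← Complex.ofReal_sin, Real.exp_eq_one_iff]
  simp

theorem planeWave_vertical (β X Z b : ℝ) : planeWave β X Z (b * Complex.I) =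
    Complex.exp (Complex.I * (β * X * Real.cosh b : ℝ) - (β * Z * Real.sinh b : ℝ)) := by
  rw [planeWave, Complex.cos_mul_I, Complex.sin_mul_I]
  congr 1
  push_cast
  linear_combination (β * Z * Complex.sinh b) * Complex.I_sq

theorem norm_planeWave_vertical (β X Z b : ℝ) :
    ‖planeWave β X Z (b * Complex.I)‖ = Real.exp (-(β * Z * Real.sinh b)) := by
  rw [planeWave_vertical, Complex.norm_exp, Complex.sub_re, Complex.ofReal_re, mul_comm,
    Complex.re_ofReal_mul, Complex.I_re, mul_zero, zero_sub]

theorem norm_direction_vertical_le (μ ν : ℝ) {b : ℝ} (hb : 0 ≤ b) :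
    ‖μ * Complex.cos (b * Complex.I) + ν * Complex.sin (b * Complex.I)‖ ≤
      (|μ| + |ν|) * Real.exp b := by
  rw [Complex.cos_mul_I, Complex.sin_mul_I, ← Complex.ofReal_cosh, ← Complex.ofReal_sinh]
  have h1 := Real.cosh_add_sinh b
  have h2 := Real.sinh_nonneg_iff.2 hb
  have h3 := Real.cosh_pos b
  refine (norm_add_le _ _).trans ?_
  rw [norm_mul, norm_mul, norm_mul, Complex.norm_I, mul_one, Complex.norm_real, Complex.norm_real,
    Complex.norm_real, Complex.norm_real, Real.norm_eq_abs, Real.norm_eq_abs, Real.norm_eq_abs,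
    Real.norm_eq_abs, abs_of_pos h3, abs_of_nonneg h2, add_mul]
  exact add_le_add (mul_le_mul_of_nonneg_left (by linarith) (abs_nonneg _))
    (mul_le_mul_of_nonneg_left (by linarith) (abs_nonneg _))

theorem continuous_planeWave (β X Z : ℝ) : Continuous (planeWave β X Z) := by
  unfold planeWave
  fun_prop

theorem continuous_planeWave_real (β X Z : ℝ) : Continuous fun a : ℝ => planeWave β X Z a :=
  (continuous_planeWave β X Z).comp Complex.continuous_ofReal

theorem continuous_planeWave_vertical (β X Z : ℝ) :
    Continuous fun b : ℝ => planeWave β X Z (b * Complex.I) :=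
  (continuous_planeWave β X Z).comp (Complex.continuous_ofReal.mul continuous_const)

/-- The decay on the imaginary axis beats the growth of `cos` and `sin` as soon as `Z' > 0`. -/
theorem norm_exp_decay_le {β Z' b : ℝ} (hβ : 0 < β) (hZ : 0 < Z') (hb : 0 ≤ b) :
    Real.exp b * Real.exp (-(β * Z' * Real.sinh b)) ≤ Real.exp (9 / (β * Z')) * Real.exp (-b) := by
  refine le_trans ?_ (exp_sub_sinh_le (mul_pos hβ hZ) hb)
  rw [← Real.exp_add, Real.exp_le_exp]
  linarith

theorem contourIntegrable_planeWave {β X Z : ℝ} (hβ : 0 < β) (hZ : 0 < Z) (μ ν : ℝ) (c : ℂ)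
    {f : ℂ → ℂ} {M : ℝ} (hf : Continuous fun a : ℝ => f a)
    (hfv : Continuous fun b : ℝ => f (b * Complex.I)) (hM : ∀ b : ℝ, ‖f (b * Complex.I)‖ ≤ M)
    (θ : ℝ) : ContourIntegrable θ fun w =>
      (c + (μ * Complex.cos w + ν * Complex.sin w)) * (planeWave β X Z w * f w) := by
  constructor
  · refine Continuous.intervalIntegrable (Continuous.mul (by fun_prop)
      ((continuous_planeWave_real β X Z).mul hf)) _ _
  · refine integrableOn_of_exp_bound (A := (‖c‖ + (|μ| + |ν|)) * M * Real.exp (9 / (β * Z)))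
      (Continuous.mul (by fun_prop) ((continuous_planeWave_vertical β X Z).mul hfv)).continuousOn
      fun b hb => ?_
    have hb0 : 0 ≤ b := (mem_Ioi.1 hb).le
    have hM0 : 0 ≤ M := (norm_nonneg _).trans (hM 0)
    rw [norm_mul, norm_mul, norm_planeWave_vertical]
    have h1 : ‖c + (μ * Complex.cos (b * Complex.I) + ν * Complex.sin (b * Complex.I))‖ ≤
        (‖c‖ + (|μ| + |ν|)) * Real.exp b := by
      refine (norm_add_le _ _).trans ?_
      have h2 := norm_direction_vertical_le μ ν hb0
      have h3 := mul_le_mul_of_nonneg_left (Real.one_le_exp hb0) (norm_nonneg c)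
      linarith
    calc _ ≤ (‖c‖ + (|μ| + |ν|)) * Real.exp b * (Real.exp (-(β * Z * Real.sinh b)) * M) := by
          gcongr; exact hM b
      _ = (‖c‖ + (|μ| + |ν|)) * M * (Real.exp b * Real.exp (-(β * Z * Real.sinh b))) := by ring
      _ ≤ (‖c‖ + (|μ| + |ν|)) * M * (Real.exp (9 / (β * Z)) * Real.exp (-b)) := by
          gcongr ?_ * ?_
          exact norm_exp_decay_le hβ hZ hb0
      _ = _ := by ring

theorem hasDerivAt_planeWave (β X Z μ ν : ℝ) (w : ℂ) (t : ℝ) :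
    HasDerivAt (fun t : ℝ => planeWave β (X + t * μ) (Z + t * ν) w)
      (Complex.I * β * (μ * Complex.cos w + ν * Complex.sin w) *
        planeWave β (X + t * μ) (Z + t * ν) w) t := by
  have h1 : HasDerivAt (fun t : ℝ => Complex.I * β * (((X + t * μ : ℝ) : ℂ) * Complex.cos w +
      ((Z + t * ν : ℝ) : ℂ) * Complex.sin w))
      (Complex.I * β * (μ * Complex.cos w + ν * Complex.sin w)) t := by
    have h2 : ∀ Y η : ℝ, HasDerivAt (fun t : ℝ => ((Y + t * η : ℝ) : ℂ)) (η : ℂ) t := by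
      intro Y η
      have : HasDerivAt (fun t : ℝ => Y + t * η) η t := by
        simpa using ((hasDerivAt_id t).mul_const η).const_add Y
      exact this.ofReal_comp
    exact (((h2 X μ).mul_const _).add ((h2 Z ν).mul_const _)).const_mul _
  refine h1.cexp.congr_deriv ?_
  rw [planeWave]; ring

/-- Differentiation of a superposition of plane waves along a straight line; the integral over the
imaginary axis is dominated since `Z` stays away from `0`. -/
theorem hasDerivAt_contourIntegral_planeWave {β X Z : ℝ} (hβ : 0 < β) (hZ : 0 < Z) (μ ν : ℝ)
    {f : ℂ → ℂ} {M : ℝ} (hf : Continuous fun a : ℝ => f a)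
    (hfv : Continuous fun b : ℝ => f (b * Complex.I)) (hM : ∀ b : ℝ, ‖f (b * Complex.I)‖ ≤ M)
    (θ : ℝ) :
    HasDerivAt (fun t : ℝ => contourIntegral θ fun w => planeWave β (X + t * μ) (Z + t * ν) w * f w)
      (contourIntegral θ fun w => Complex.I * β * (μ * Complex.cos w + ν * Complex.sin w) *
        (planeWave β X Z w * f w)) 0 := by
  have hM0 : 0 ≤ M := (norm_nonneg _).trans (hM 0)
  have hd : ∀ (w : ℂ) (t : ℝ), HasDerivAt (fun t : ℝ => planeWave β (X + t * μ) (Z + t * ν) w * f w)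
      (Complex.I * β * (μ * Complex.cos w + ν * Complex.sin w) *
        (planeWave β (X + t * μ) (Z + t * ν) w * f w)) t := by
    intro w t
    refine ((hasDerivAt_planeWave β X Z μ ν w t).mul_const (f w)).congr_deriv (by ring)
  have hA : HasDerivAt (fun t : ℝ => ∫ a in (0:ℝ)..θ,
      planeWave β (X + t * μ) (Z + t * ν) (a : ℂ) * f a)
      (∫ a in (0:ℝ)..θ, Complex.I * β * (μ * Complex.cos a + ν * Complex.sin a) *
        (planeWave β (X + 0 * μ) (Z + 0 * ν) a * f a)) 0 := by
    refine (intervalIntegral.hasDerivAt_integral_of_dominated_loc_of_deriv_le (𝕜 := ℝ)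
      (F := fun t a => planeWave β (X + t * μ) (Z + t * ν) ((a : ℝ) : ℂ) * f a)
      (F' := fun t a => Complex.I * β * (μ * Complex.cos ((a : ℝ) : ℂ) + ν * Complex.sin a) *
        (planeWave β (X + t * μ) (Z + t * ν) a * f a))
      (bound := fun a : ℝ => ‖Complex.I * β * (μ * Complex.cos a + ν * Complex.sin a)‖ * ‖f a‖)
      (Metric.ball_mem_nhds (0:ℝ) one_pos) ?_ ?_ ?_ ?_ ?_ ?_).2
    · exact Filter.Eventually.of_forall fun t =>
        ((continuous_planeWave_real _ _ _).mul hf).aestronglyMeasurable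
    · exact ((continuous_planeWave_real _ _ _).mul hf).intervalIntegrable _ _
    · exact (Continuous.mul (by fun_prop)
        ((continuous_planeWave_real _ _ _).mul hf)).aestronglyMeasurable
    · refine Filter.Eventually.of_forall fun a _ t _ => ?_
      simp only [norm_mul, norm_planeWave_real, one_mul, le_refl]
    · exact ((Continuous.norm (by fun_prop)).mul hf.norm).intervalIntegrable _ _
    · exact Filter.Eventually.of_forall fun a _ t _ => hd a t
  -- for `|t| < δ` one has `Z + t ν ≥ Z / 2`
  set δ := Z / (2 * (|ν| + 1)) with hδ
  have hδ0 : 0 < δ := by positivity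
  have hZt : ∀ t ∈ Metric.ball (0:ℝ) δ, Z / 2 ≤ Z + t * ν := by
    intro t ht
    rw [Metric.mem_ball, dist_zero_right, Real.norm_eq_abs] at ht
    have h1 : |t * ν| ≤ δ * (|ν| + 1) := by
      rw [abs_mul]
      have := abs_nonneg ν
      exact mul_le_mul ht.le (by linarith) this hδ0.le
    have h2 : δ * (|ν| + 1) = Z / 2 := by rw [hδ]; field_simp
    have := neg_abs_le (t * ν)
    linarith
  have hB : HasDerivAt (fun t : ℝ => ∫ b in Ioi (0:ℝ),
      planeWave β (X + t * μ) (Z + t * ν) (b * Complex.I) * f (b * Complex.I))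
      (∫ b in Ioi (0:ℝ), Complex.I * β *
        (μ * Complex.cos (b * Complex.I) + ν * Complex.sin (b * Complex.I)) *
        (planeWave β (X + 0 * μ) (Z + 0 * ν) (b * Complex.I) * f (b * Complex.I))) 0 := by
    refine (hasDerivAt_integral_of_dominated_loc_of_deriv_le (𝕜 := ℝ)
      (F := fun t b => planeWave β (X + t * μ) (Z + t * ν) ((b : ℝ) * Complex.I) *
        f (b * Complex.I))
      (F' := fun t b => Complex.I * β * (μ * Complex.cos ((b : ℝ) * Complex.I) +
        ν * Complex.sin (b * Complex.I)) *
        (planeWave β (X + t * μ) (Z + t * ν) (b * Complex.I) * f (b * Complex.I)))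
      (bound := fun b : ℝ => β * (|μ| + |ν|) * M * Real.exp (9 / (β * (Z / 2))) * Real.exp (-1 * b))
      (Metric.ball_mem_nhds (0:ℝ) hδ0) ?_ ?_ ?_ ?_ ?_ ?_).2
    · exact Filter.Eventually.of_forall fun t =>
        ((continuous_planeWave_vertical _ _ _).mul hfv).aestronglyMeasurable
    · have := (contourIntegrable_planeWave (X := X + 0 * μ) (Z := Z + 0 * ν) hβ (by simpa using hZ)
        0 0 1 hf hfv hM θ).vertical
      simpa [IntegrableOn] using this
    · exact (Continuous.mul (by fun_prop)
        ((continuous_planeWave_vertical _ _ _).mul hfv)).aestronglyMeasurable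
    · refine (ae_restrict_iff' measurableSet_Ioi).2 (Filter.Eventually.of_forall fun b hb t ht => ?_)
      have hb0 : 0 ≤ b := (mem_Ioi.1 hb).le
      have h1 := norm_direction_vertical_le μ ν hb0
      have h2 : Real.exp (-(β * (Z + t * ν) * Real.sinh b)) ≤
          Real.exp (-(β * (Z / 2) * Real.sinh b)) := by
        have h3 := Real.sinh_nonneg_iff.2 hb0
        have h4 := hZt t ht
        gcongr
      have h5 := norm_exp_decay_le hβ (half_pos hZ) hb0
      rw [norm_mul, norm_mul, norm_mul, norm_mul, Complex.norm_I, one_mul, Complex.norm_real,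
        Real.norm_eq_abs, abs_of_pos hβ, norm_planeWave_vertical]
      calc _ ≤ β * ((|μ| + |ν|) * Real.exp b) *
            (Real.exp (-(β * (Z / 2) * Real.sinh b)) * M) := by
            gcongr; exact hM b
        _ = β * (|μ| + |ν|) * M * (Real.exp b * Real.exp (-(β * (Z / 2) * Real.sinh b))) := by ring
        _ ≤ β * (|μ| + |ν|) * M * (Real.exp (9 / (β * (Z / 2))) * Real.exp (-b)) := by
            gcongr ?_ * ?_
        _ = _ := by rw [neg_one_mul]; ring
    · exact ((exp_neg_integrableOn_Ioi 0 one_pos).const_mul _)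
    · exact Filter.Eventually.of_forall fun b t _ => hd _ t
  simp only [zero_mul, add_zero] at hA hB
  exact hA.sub (hB.const_mul Complex.I)

/-! ### Bounds for the amplitude -/

/-- The part of the complex `Q`-plane in which the amplitudes are holomorphic: a thin
neighbourhood of a real segment together with the remote part of the upper half plane. -/
def amplitudeRegion (ε r : ℝ) : Set ℂ :=
  {Q | |Q.im| ≤ ε ∧ ‖Q‖ ≤ r ∨ 0 ≤ Q.im ∧ r ≤ ‖Q‖}

namespace Waveguide

/-- For large `|Q|` in the upper half plane the Jost function has no zeros. -/
theorem exists_high_energy_bound (W : Waveguide) (j : Parity) (B : ℝ) :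
    ∃ r₀ : ℝ, 0 < r₀ ∧ ∀ Q : ℂ, 0 ≤ Q.im → r₀ ≤ ‖Q‖ → W.jost j Q ≠ 0 ∧
      ∀ ξ : ℝ, |ξ| ≤ B → ‖W.eigenfun j ξ Q * W.invJost j Q‖ ≤ 4 * Real.exp (B * Q.im) := by
  obtain ⟨K, hK⟩ := W.pot_bounded
  have hh := W.h_pos
  have hK0 : 0 ≤ K := (norm_nonneg _).trans (hK 0)
  set r := max B W.h
  have hr : 0 ≤ r := hh.le.trans (le_max_right _ _)
  refine ⟨4 * K * r + 1, by positivity, fun Q hm hQ => ?_⟩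
  have hQ0 : 0 < ‖Q‖ := lt_of_lt_of_le (by positivity) hQ
  have hQ1 : Q ≠ 0 := norm_pos_iff.1 hQ0
  set s := ‖Q * normValue j + Complex.I * normDeriv j‖ with hs
  have hs2 : ‖Q * normValue j - Complex.I * normDeriv j‖ ≤ s := by
    cases j <;> simp [hs, normValue, normDeriv]
  have hspos : 0 < s := by
    cases j <;> simp [hs, normValue, normDeriv, hQ1]
  have main := fun (x : ℝ) (hx : x ∈ Icc 0 r) => (W.eigenfun_spec j Q).high_energy
    W.pot_measurable hK hr hm (by linarith) hQ0 le_rfl hs2 hx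
  have hj := (main W.h ⟨hh.le, le_max_right _ _⟩).2
  change s - s / 2 ≤ ‖W.jost j Q‖ * _ at hj
  have hexp : Real.exp (-(Q.im * W.h)) ≤ 1 := Real.exp_le_one_iff.2 (by
    have := mul_nonneg hm hh.le; linarith)
  have hj2 : s / 2 ≤ ‖W.jost j Q‖ := by
    have := mul_le_mul_of_nonneg_left hexp (norm_nonneg (W.jost j Q))
    linarith
  have hj3 : 0 < ‖W.jost j Q‖ := lt_of_lt_of_le (by positivity) hj2
  refine ⟨norm_pos_iff.1 hj3, fun ξ hξ => ?_⟩
  have h1 : ‖W.eigenfun j ξ Q‖ ≤ 2 * s / ‖Q‖ * Real.exp (B * Q.im) := by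
    have h2 := (main |ξ| ⟨abs_nonneg _, hξ.trans (le_max_left _ _)⟩).1
    have h3 : ‖W.eigenfun j ξ Q‖ = ‖W.eigenfun j |ξ| Q‖ := by
      rcases abs_choice ξ with h | h <;> rw [h]
      rw [(W.eigenfun_neg_left j ξ Q).1]
      cases j <;> simp [paritySign]
    rw [h3]
    refine h2.trans ?_
    have : Q.im * |ξ| ≤ B * Q.im := by nlinarith
    gcongr
  rw [W.invJost_eq j hQ1, norm_mul, norm_div]
  calc _ ≤ 2 * s / ‖Q‖ * Real.exp (B * Q.im) * (‖Q‖ / (s / 2)) := by gcongr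
    _ = _ := by field_simp; norm_num

/-- Holomorphy of `Q / jost Q` and exponential bounds of `u(ξ, Q) Q / jost Q`, uniformly for
bounded `ξ`. -/
theorem exists_invJost_bound (W : Waveguide) (j : Parity) {B : ℝ} (hB : 0 ≤ B) (q : ℝ) :
    ∃ r ε M : ℝ, q ≤ r ∧ 0 < r ∧ 0 < ε ∧ 0 < M ∧ ∀ Q ∈ amplitudeRegion ε r,
      DifferentiableAt ℂ (W.invJost j) Q ∧
      ∀ ξ : ℝ, |ξ| ≤ B → ‖W.eigenfun j ξ Q * W.invJost j Q‖ ≤ M * Real.exp (B * |Q.im|) := by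
  obtain ⟨r₀, hr₀, hbig⟩ := W.exists_high_energy_bound j B
  obtain ⟨K, hK⟩ := W.pot_bounded
  set r := max r₀ q
  have hr : 0 < r := hr₀.trans_le (le_max_left _ _)
  -- the denominator does not vanish in a neighbourhood of the compact segment `[-r, r]`
  have hcomp : IsCompact ((fun x : ℝ => (x : ℂ)) '' Icc (-r) r) :=
    isCompact_Icc.image Complex.continuous_ofReal
  have hopen : IsOpen {Q : ℂ | W.jostReg j Q ≠ 0} :=
    isOpen_ne_fun (W.differentiable_jostReg j).continuous continuous_const
  obtain ⟨ε, hε, hsub⟩ := hcomp.exists_cthickening_subset_open hopen (by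
    rintro _ ⟨x, -, rfl⟩; exact W.jostReg_ne_zero j x)
  have hreg : ∀ Q : ℂ, |Q.im| ≤ ε → ‖Q‖ ≤ r → W.jostReg j Q ≠ 0 := by
    intro Q h1 h2
    refine hsub (Metric.mem_cthickening_of_dist_le Q (Q.re : ℂ) ε _
      ⟨Q.re, abs_le.1 ((Complex.abs_re_le_norm Q).trans h2), rfl⟩ ?_)
    rw [Complex.dist_of_re_eq (by simp)]
    simpa [Real.dist_eq] using h1
  have hcomp2 : IsCompact {Q : ℂ | |Q.im| ≤ ε ∧ ‖Q‖ ≤ r} := by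
    refine (isCompact_closedBall (0:ℂ) r).of_isClosed_subset ?_ fun Q hQ => by simpa using hQ.2
    exact (isClosed_le Complex.continuous_im.abs continuous_const).inter
      (isClosed_le continuous_norm continuous_const)
  obtain ⟨M₁, hM₁⟩ := hcomp2.exists_bound_of_continuousOn (f := W.invJost j) fun Q hQ =>
    (W.differentiableAt_invJost j (hreg Q hQ.1 hQ.2)).continuousAt.continuousWithinAt
  set M₂ := (‖normValue j‖ + ‖normDeriv j‖) * Real.exp (max 1 (K + r ^ 2) * B)
  have hM₂ : 0 ≤ M₂ := by positivity
  refine ⟨r, ε, max 4 (M₂ * M₁), le_max_right _ _, hr, hε, lt_max_of_lt_left (by norm_num),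
    fun Q hQ => ?_⟩
  rcases hQ with ⟨h1, h2⟩ | ⟨h1, h2⟩
  · refine ⟨W.differentiableAt_invJost j (hreg Q h1 h2), fun ξ hξ => ?_⟩
    have e1 : ‖W.eigenfun j ξ Q‖ ≤ M₂ := by
      refine (norm_fundSol_le W.pot_measurable hK _ _ h2 ξ).trans ?_
      have : (0:ℝ) ≤ max 1 (K + r ^ 2) := zero_le_one.trans (le_max_left _ _)
      simp only [M₂]
      gcongr
    rw [norm_mul]
    have hx : (1:ℝ) ≤ Real.exp (B * |Q.im|) := Real.one_le_exp (by positivity)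
    calc _ ≤ M₂ * M₁ := mul_le_mul e1 (hM₁ Q ⟨h1, h2⟩) (norm_nonneg _) hM₂
      _ ≤ max 4 (M₂ * M₁) := le_max_right _ _
      _ ≤ _ := le_mul_of_one_le_right (le_max_of_le_left (by norm_num)) hx
  · obtain ⟨h3, h4⟩ := hbig Q h1 ((le_max_left _ _).trans h2)
    refine ⟨W.differentiableAt_invJost j ?_, fun ξ hξ => ?_⟩
    · unfold jostReg
      split_ifs with h
      · have hQ0 : Q ≠ 0 := norm_pos_iff.1 (hr.trans_le h2)
        rw [dslope_of_ne _ hQ0, slope_def_field, h, sub_zero, sub_zero]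
        exact div_ne_zero h3 hQ0
      · exact h3
    · rw [abs_of_nonneg h1]
      refine (h4 ξ hξ).trans ?_
      gcongr
      exact le_max_left _ _

/-- The amplitude `F(Q)` for which the spectral kernel equals
`(e^{iQX} F(Q) + e^{-iQX} F(-Q)) / 2`, where `X = |[x]_h|`. -/
noncomputable def amplitude (W : Waveguide) (j : Parity) (x ξ : ℝ) (Q : ℂ) : ℂ :=
  if |x| ≤ W.h then W.eigenfun j ξ Q * W.invJost j Q * (W.eigenfun j x Q * W.invJost j (-Q))
  else (if 0 < x then 1 else paritySign j) * (W.eigenfun j ξ Q * W.invJost j Q)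

theorem abs_outerCoord (h x : ℝ) (hh : 0 < h) :
    |outerCoord h x| = if |x| ≤ h then 0 else |x| - h := by
  simp only [outerCoord]
  by_cases h0 : |x| ≤ h
  · have := abs_le.1 h0
    rw [if_neg (not_lt.2 this.1), if_pos this.2, if_pos h0, abs_zero]
  · rw [if_neg h0]
    rcases lt_abs.1 (not_le.1 h0) with h1 | h1
    · rw [if_neg (by linarith), if_neg (by linarith), abs_of_pos (by linarith),
        abs_of_pos (by linarith)]
    · rw [if_pos (by linarith), abs_of_neg (by linarith), abs_of_neg (by linarith)]; ring

/-- The spectral kernel is the sum of an outgoing and an incoming wave in `X = |[x]_h|`, whose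
amplitudes are exchanged by `Q ↦ -Q`. -/
theorem kernel_eq (W : Waveguide) (j : Parity) {Q : ℝ} (hQ : 0 < Q) (x ξ : ℝ) :
    ((W.v j x (W.dSq + Q ^ 2) * W.v j ξ (W.dSq + Q ^ 2) * W.sigma j (W.dSq + Q ^ 2) : ℝ) : ℂ) =
      (Complex.exp (Complex.I * Q * (|outerCoord W.h x| : ℝ)) * W.amplitude j x ξ Q +
        Complex.exp (-(Complex.I * Q * (|outerCoord W.h x| : ℝ))) * W.amplitude j x ξ (-Q)) / 2 := by
  rw [W.v_mul_v_mul_sigma j hQ x ξ, abs_outerCoord _ _ W.h_pos]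
  have hQ' : (Q : ℂ) ≠ 0 := by exact_mod_cast hQ.ne'
  by_cases h0 : |x| ≤ W.h
  · simp only [amplitude, if_pos h0, eigenfun_neg_right, neg_neg, Complex.ofReal_zero, mul_zero,
      neg_zero, Complex.exp_zero]
    ring
  · simp only [amplitude, if_neg h0, eigenfun_neg_right]
    have j1 := W.jost_ne_zero j hQ.ne'
    have j2 := W.jost_ne_zero j (neg_ne_zero.2 hQ.ne')
    push_cast at j2 ⊢
    have h1 := W.eigenfun_outside j (not_le.1 h0).le Q
    have h2 : W.eigenfun j x Q =
        (if 0 < x then 1 else paritySign j) * W.eigenfun j |x| Q := by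
      split_ifs with h3
      · rw [abs_of_pos h3, one_mul]
      · rw [abs_of_nonpos (not_lt.1 h3), (W.eigenfun_neg_left j x Q).1]
        cases j <;> simp [paritySign]
    rw [h2, W.invJost_eq j hQ', W.invJost_eq j (neg_ne_zero.2 hQ')]
    set E1 := Complex.exp (Complex.I * Q * (|x| - W.h))
    set E2 := Complex.exp (-(Complex.I * Q * (|x| - W.h)))
    field_simp
    linear_combination (-(if 0 < x then 1 else paritySign j) * W.eigenfun j ξ Q) * h1

/-- Holomorphy and exponential bounds of the amplitude, uniformly in `x` and for bounded `ξ`. For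
`|x| ≤ h` the amplitude contains `Q / jost` at both `Q` and `-Q`, so that both points have to lie
in the region. -/
theorem exists_amplitude_bound (W : Waveguide) (j : Parity) {B : ℝ} (hB : 0 ≤ B) (q : ℝ) :
    ∃ r ε M C : ℝ, q ≤ r ∧ 0 < r ∧ 0 < ε ∧ 0 < M ∧ 0 ≤ C ∧ ∀ Q ∈ amplitudeRegion ε r,
      ∀ x ξ : ℝ, |ξ| ≤ B → (|x| ≤ W.h → -Q ∈ amplitudeRegion ε r) →
      DifferentiableAt ℂ (W.amplitude j x ξ) Q ∧
      ‖W.amplitude j x ξ Q‖ ≤ M * Real.exp (C * |Q.im|) := by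
  have hh := W.h_pos
  set B' := max B W.h
  have hB' : 0 ≤ B' := hB.trans (le_max_left _ _)
  obtain ⟨r, ε, M, hq, hr, hε, hM, hb⟩ := W.exists_invJost_bound j hB' q
  refine ⟨r, ε, max M (M * M), 2 * B', hq, hr, hε, lt_max_of_lt_left hM, by positivity,
    fun Q hQ x ξ hξ hx => ?_⟩
  obtain ⟨hd, hn⟩ := hb Q hQ
  have hn := hn ξ (hξ.trans (le_max_left _ _))
  have hξd := W.differentiable_eigenfun j ξ Q
  have hxd := W.differentiable_eigenfun j x Q
  by_cases h0 : |x| ≤ W.h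
  · obtain ⟨hd', hn'⟩ := hb (-Q) (hx h0)
    have hn' := hn' x (h0.trans (le_max_right _ _))
    have e : W.amplitude j x ξ = fun Q => W.eigenfun j ξ Q * W.invJost j Q *
        (W.eigenfun j x Q * W.invJost j (-Q)) := by funext Q; simp [amplitude, h0]
    rw [e]
    constructor
    · have : DifferentiableAt ℂ (fun Q => W.invJost j (-Q)) Q :=
        DifferentiableAt.comp Q hd' differentiableAt_id.neg
      exact (hξd.mul hd).mul (hxd.mul this)
    · rw [eigenfun_neg_right, Complex.neg_im, abs_neg] at hn'
      rw [norm_mul]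
      calc _ ≤ (M * Real.exp (B' * |Q.im|)) * (M * Real.exp (B' * |Q.im|)) :=
            mul_le_mul hn hn' (norm_nonneg _) (by positivity)
        _ = M * M * Real.exp (2 * B' * |Q.im|) := by
            rw [mul_mul_mul_comm, ← Real.exp_add]; congr 2; ring
        _ ≤ _ := by gcongr; exact le_max_right _ _
  · have e : W.amplitude j x ξ = fun Q => (if 0 < x then 1 else paritySign j) *
        (W.eigenfun j ξ Q * W.invJost j Q) := by funext Q; simp [amplitude, h0]
    rw [e]
    refine ⟨(hξd.mul hd).const_mul _, ?_⟩
    have h1 : ‖(if 0 < x then 1 else paritySign j : ℂ)‖ = 1 := by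
      split_ifs
      · simp
      · cases j <;> simp [paritySign]
    rw [norm_mul, h1, one_mul]
    refine hn.trans ?_
    have : B' * |Q.im| ≤ 2 * B' * |Q.im| := by
      have := mul_nonneg hB' (abs_nonneg Q.im); linarith
    gcongr
    exact le_max_left _ _

end Waveguide

/-! ### The Green's function as a contour integral -/

theorem outgoingSqrt_sq {y : ℝ} (hy : 0 ≤ y) : outgoingSqrt (y ^ 2) = y := by
  rw [outgoingSqrt, Real.sqrt_sq hy, Real.sqrt_eq_zero_of_nonpos (by nlinarith)]
  simp

theorem outgoingSqrt_neg_sq {y : ℝ} (hy : 0 ≤ y) : outgoingSqrt (-y ^ 2) = Complex.I * y := by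
  rw [outgoingSqrt, neg_neg, Real.sqrt_sq hy, Real.sqrt_eq_zero_of_nonpos (by nlinarith)]
  simp

/-- The parametrization of the oscillatory part of the continuous spectrum. -/
theorem image_cos_sq {d β : ℝ} (hβ : 0 < β) :
    (fun w => d + (β * Real.cos w) ^ 2) '' Ioo 0 (Real.pi / 2) = Ioo d (d + β ^ 2) := by
  ext y
  constructor
  · rintro ⟨w, hw, rfl⟩
    have h1 : 0 < Real.cos w := Real.cos_pos_of_mem_Ioo ⟨by linarith [hw.1, Real.pi_pos], hw.2⟩
    have h2 : Real.cos w < 1 := by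
      have := Real.cos_lt_cos_of_nonneg_of_le_pi_div_two le_rfl hw.2.le hw.1
      rwa [Real.cos_zero] at this
    have h3 : 0 < (β * Real.cos w) ^ 2 := by positivity
    refine ⟨by simpa using h3, ?_⟩
    have : (β * Real.cos w) ^ 2 < (β * 1) ^ 2 := by gcongr
    simpa using this
  · rintro ⟨h1, h2⟩
    set c := Real.sqrt (y - d) / β
    have hc0 : 0 < c := div_pos (Real.sqrt_pos.2 (by linarith)) hβ
    have hc1 : c < 1 := by
      rw [div_lt_one hβ, Real.sqrt_lt' hβ]; linarith
    refine ⟨Real.arccos c, ⟨Real.arccos_pos.2 hc1, Real.arccos_lt_pi_div_two.2 hc0⟩, ?_⟩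
    simp only
    rw [Real.cos_arccos (by linarith) hc1.le, mul_div_cancel₀ _ hβ.ne',
      Real.sq_sqrt (by linarith)]
    ring

/-- The parametrization of the evanescent part of the continuous spectrum. -/
theorem image_cosh_sq {d β : ℝ} (hβ : 0 < β) :
    (fun b => d + (β * Real.cosh b) ^ 2) '' Ioi 0 = Ioi (d + β ^ 2) := by
  ext y
  constructor
  · rintro ⟨b, hb, rfl⟩
    have h1 : 1 < Real.cosh b := Real.one_lt_cosh.2 (ne_of_gt hb)
    have : (β * 1) ^ 2 < (β * Real.cosh b) ^ 2 := by gcongr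
    simpa using this
  · intro h1
    have h1 : d + β ^ 2 < y := h1
    set c := Real.sqrt (y - d) / β
    have hc1 : 1 < c := by
      rw [one_lt_div hβ]; exact Real.lt_sqrt_of_sq_lt (by linarith)
    refine ⟨Real.arcosh c, Real.arcosh_pos hc1, ?_⟩
    simp only
    have h0 : 0 ≤ y - d := by nlinarith [sq_nonneg β]
    rw [Real.cosh_arcosh hc1.le, mul_div_cancel₀ _ hβ.ne', Real.sq_sqrt h0]
    ring

theorem injOn_cos_sq {d β : ℝ} (hβ : 0 < β) :
    InjOn (fun w => d + (β * Real.cos w) ^ 2) (Ioo 0 (Real.pi / 2)) := by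
  intro x hx y hy hxy
  have h1 : ∀ w ∈ Ioo 0 (Real.pi / 2), 0 ≤ β * Real.cos w := fun w hw =>
    mul_nonneg hβ.le (Real.cos_nonneg_of_mem_Icc ⟨by linarith [hw.1, Real.pi_pos], hw.2.le⟩)
  have h2 := (pow_left_inj₀ (h1 x hx) (h1 y hy) two_ne_zero).1 (add_left_cancel hxy)
  exact Real.injOn_cos ⟨hx.1.le, by linarith [hx.2, Real.pi_pos]⟩
    ⟨hy.1.le, by linarith [hy.2, Real.pi_pos]⟩ (mul_left_cancel₀ hβ.ne' h2)

theorem injOn_cosh_sq {d β : ℝ} (hβ : 0 < β) :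
    InjOn (fun b => d + (β * Real.cosh b) ^ 2) (Ioi 0) := by
  intro x hx y hy hxy
  have h1 : ∀ b, 0 ≤ β * Real.cosh b := fun b => mul_nonneg hβ.le (Real.cosh_pos b).le
  have h2 := (pow_left_inj₀ (h1 x) (h1 y) two_ne_zero).1 (add_left_cancel hxy)
  exact Real.cosh_injOn (mem_Ici.2 (le_of_lt hx)) (mem_Ici.2 (le_of_lt hy))
    (mul_left_cancel₀ hβ.ne' h2)

theorem hasDerivAt_cos_sq (d β w : ℝ) : HasDerivAt (fun w => d + (β * Real.cos w) ^ 2)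
    (-(2 * β ^ 2 * Real.cos w * Real.sin w)) w := by
  have := (((Real.hasDerivAt_cos w).const_mul β).pow 2).const_add d
  refine this.congr_deriv ?_
  push_cast; ring

theorem hasDerivAt_cosh_sq (d β b : ℝ) : HasDerivAt (fun b => d + (β * Real.cosh b) ^ 2)
    (2 * β ^ 2 * Real.cosh b * Real.sinh b) b := by
  have := (((Real.hasDerivAt_cosh b).const_mul β).pow 2).const_add d
  refine this.congr_deriv ?_
  push_cast; ring

/-- Integration over the continuous spectrum `(d, ∞)` is integration over a circular arc and a
hyperbolic ray. -/
theorem integral_Ioi_eq {d β : ℝ} (hβ : 0 < β) {g G₁ G₂ : ℝ → ℂ}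
    (h1 : ∀ w ∈ Ioo 0 (Real.pi / 2), (2 * β ^ 2 * Real.cos w * Real.sin w : ℝ) •
      g (d + (β * Real.cos w) ^ 2) = G₁ w)
    (h2 : ∀ b ∈ Ioi (0:ℝ), (2 * β ^ 2 * Real.cosh b * Real.sinh b : ℝ) •
      g (d + (β * Real.cosh b) ^ 2) = G₂ b)
    (hi1 : IntervalIntegrable G₁ volume 0 (Real.pi / 2)) (hi2 : IntegrableOn G₂ (Ioi 0)) :
    IntegrableOn g (Ioi d) ∧
      ∫ y in Ioi d, g y = (∫ w in (0:ℝ)..(Real.pi / 2), G₁ w) + ∫ b in Ioi (0:ℝ), G₂ b := by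
  have hpi : (0:ℝ) ≤ Real.pi / 2 := by positivity
  have e1 : EqOn (fun w => |(-(2 * β ^ 2 * Real.cos w * Real.sin w))| •
      g (d + (β * Real.cos w) ^ 2)) G₁ (Ioo 0 (Real.pi / 2)) := by
    intro w hw
    have hc : 0 < Real.cos w := Real.cos_pos_of_mem_Ioo ⟨by linarith [hw.1, Real.pi_pos], hw.2⟩
    have hs : 0 < Real.sin w := Real.sin_pos_of_pos_of_lt_pi hw.1 (by linarith [hw.2, Real.pi_pos])
    simp only
    rw [abs_neg, abs_of_nonneg (by positivity), h1 w hw]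
  have e2 : EqOn (fun b => |2 * β ^ 2 * Real.cosh b * Real.sinh b| •
      g (d + (β * Real.cosh b) ^ 2)) G₂ (Ioi 0) := by
    intro b hb
    have hc := Real.cosh_pos b
    have hs : 0 < Real.sinh b := Real.sinh_pos_iff.2 hb
    simp only
    rw [abs_of_nonneg (by positivity), h2 b hb]
  have d1 : ∀ w ∈ Ioo 0 (Real.pi / 2), HasDerivWithinAt (fun w => d + (β * Real.cos w) ^ 2)
      (-(2 * β ^ 2 * Real.cos w * Real.sin w)) (Ioo 0 (Real.pi / 2)) w :=
    fun w _ => (hasDerivAt_cos_sq d β w).hasDerivWithinAt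
  have d2 : ∀ b ∈ Ioi (0:ℝ), HasDerivWithinAt (fun b => d + (β * Real.cosh b) ^ 2)
      (2 * β ^ 2 * Real.cosh b * Real.sinh b) (Ioi 0) b :=
    fun b _ => (hasDerivAt_cosh_sq d β b).hasDerivWithinAt
  rw [intervalIntegrable_iff_integrableOn_Ioo_of_le hpi] at hi1
  have i1 : IntegrableOn g (Ioo d (d + β ^ 2)) := by
    rw [← image_cos_sq hβ, integrableOn_image_iff_integrableOn_abs_deriv_smul measurableSet_Ioo d1
      (injOn_cos_sq hβ)]
    exact hi1.congr_fun e1.symm measurableSet_Ioo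
  have i2 : IntegrableOn g (Ioi (d + β ^ 2)) := by
    rw [← image_cosh_sq hβ, integrableOn_image_iff_integrableOn_abs_deriv_smul measurableSet_Ioi d2
      (injOn_cosh_sq hβ)]
    exact hi2.congr_fun e2.symm measurableSet_Ioi
  have i1' : IntegrableOn g (Ioc d (d + β ^ 2)) :=
    (integrableOn_Ioc_iff_integrableOn_Ioo (by simp)).2 i1
  have hu : Ioc d (d + β ^ 2) ∪ Ioi (d + β ^ 2) = Ioi d :=
    Ioc_union_Ioi_eq_Ioi (by nlinarith [sq_nonneg β])
  refine ⟨hu ▸ i1'.union i2, ?_⟩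
  rw [← hu, setIntegral_union Ioc_disjoint_Ioi_same measurableSet_Ioi i1' i2,
    integral_Ioc_eq_integral_Ioo, ← image_cos_sq hβ, ← image_cosh_sq hβ,
    integral_image_eq_integral_abs_deriv_smul measurableSet_Ioo d1 (injOn_cos_sq hβ),
    integral_image_eq_integral_abs_deriv_smul measurableSet_Ioi d2 (injOn_cosh_sq hβ),
    setIntegral_congr_fun measurableSet_Ioo e1, setIntegral_congr_fun measurableSet_Ioi e2,
    intervalIntegral.integral_of_le hpi, integral_Ioc_eq_integral_Ioo]

namespace Waveguide

/-- The amplitude in the angular variable, `Q = σ β₀ cos w` with a sign `σ = ± 1`. -/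
noncomputable def angularAmplitude (W : Waveguide) (j : Parity) (x ξ σ : ℝ) (w : ℂ) : ℂ :=
  W.amplitude j x ξ ((σ * W.beta0 : ℝ) * Complex.cos w)

theorem angularAmplitude_real (W : Waveguide) (j : Parity) (x ξ σ a : ℝ) :
    W.angularAmplitude j x ξ σ a = W.amplitude j x ξ ((σ * W.beta0 * Real.cos a : ℝ) : ℂ) := by
  simp [angularAmplitude]

theorem angularAmplitude_vertical (W : Waveguide) (j : Parity) (x ξ σ b : ℝ) :
    W.angularAmplitude j x ξ σ (b * Complex.I) =
      W.amplitude j x ξ ((σ * W.beta0 * Real.cosh b : ℝ) : ℂ) := by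
  simp [angularAmplitude, Complex.cos_mul_I]

theorem continuous_amplitude_real {W : Waveguide} {j : Parity} {x ξ : ℝ}
    (hc : ∀ Q : ℝ, DifferentiableAt ℂ (W.amplitude j x ξ) Q) :
    Continuous fun Q : ℝ => W.amplitude j x ξ Q := by
  rw [continuous_iff_continuousAt]
  intro Q
  exact (hc Q).continuousAt.comp (f := fun Q : ℝ => (Q : ℂ)) Complex.continuous_ofReal.continuousAt

theorem continuous_angularAmplitude {W : Waveguide} {j : Parity} {x ξ σ : ℝ}
    (hc : ∀ Q : ℝ, DifferentiableAt ℂ (W.amplitude j x ξ) Q) :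
    Continuous fun a : ℝ => W.angularAmplitude j x ξ σ a := by
  simp only [angularAmplitude_real]
  exact (continuous_amplitude_real hc).comp (f := fun a => σ * W.beta0 * Real.cos a) (by fun_prop)

theorem continuous_angularAmplitude_vertical {W : Waveguide} {j : Parity} {x ξ σ : ℝ}
    (hc : ∀ Q : ℝ, DifferentiableAt ℂ (W.amplitude j x ξ) Q) :
    Continuous fun b : ℝ => W.angularAmplitude j x ξ σ (b * Complex.I) := by
  simp only [angularAmplitude_vertical]
  exact (continuous_amplitude_real hc).comp (f := fun a => σ * W.beta0 * Real.cosh a) (by fun_prop)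

theorem norm_angularAmplitude_vertical_le {W : Waveguide} {j : Parity} {x ξ σ M : ℝ}
    (hc : ∀ Q : ℝ, ‖W.amplitude j x ξ Q‖ ≤ M) (b : ℝ) :
    ‖W.angularAmplitude j x ξ σ (b * Complex.I)‖ ≤ M := by
  rw [angularAmplitude_vertical]
  exact hc _

/-- The two plane wave superpositions that make up the `j`-th part of the Green's function. -/
noncomputable def waveSum (W : Waveguide) (j : Parity) (x ξ X Z : ℝ) : ℂ :=
  contourIntegral (Real.pi / 2) (fun w => planeWave W.beta0 X Z w * W.angularAmplitude j x ξ 1 w) +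
    contourIntegral (Real.pi / 2)
      fun w => planeWave W.beta0 (-X) Z w * W.angularAmplitude j x ξ (-1) w

/-- The integrand of the Green's function at `λ = d² + Q²`, where `k² n_*² - λ = β₀² - Q²`. -/
theorem radIntegrand_eq (W : Waveguide) (j : Parity) {Q : ℝ} (hQ : 0 < Q) (x z ξ ζ : ℝ) :
    W.radIntegrand j x z ξ ζ (W.dSq + Q ^ 2) =
      Complex.exp (Complex.I * (|z - ζ| : ℝ) * outgoingSqrt (W.beta0 ^ 2 - Q ^ 2)) /
        (2 * Complex.I * outgoingSqrt (W.beta0 ^ 2 - Q ^ 2)) *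
      ((Complex.exp (Complex.I * Q * (|outerCoord W.h x| : ℝ)) * W.amplitude j x ξ Q +
        Complex.exp (-(Complex.I * Q * (|outerCoord W.h x| : ℝ))) * W.amplitude j x ξ (-Q)) / 2 /
          Q) := by
  have e : W.k ^ 2 * W.nStar ^ 2 - (W.dSq + Q ^ 2) = W.beta0 ^ 2 - Q ^ 2 := by
    rw [← W.sq_sub_dSq]; ring
  rw [← W.kernel_eq j hQ x ξ, radIntegrand, e, W.sqrt_add_sq_sub hQ]
  congr 1
  push_cast
  ring

/-- The integrals over the continuous spectrum converge absolutely off the line `z = ζ`, and are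
superpositions of plane waves. -/
theorem integral_radIntegrand (W : Waveguide) (j : Parity) {x z ξ ζ M : ℝ} (hz : z ≠ ζ)
    (hc : ∀ Q : ℝ, DifferentiableAt ℂ (W.amplitude j x ξ) Q ∧ ‖W.amplitude j x ξ Q‖ ≤ M) :
    IntegrableOn (W.radIntegrand j x z ξ ζ) (Ioi W.dSq) ∧
      ∫ lam in Ioi W.dSq, W.radIntegrand j x z ξ ζ lam =
        1 / (2 * Complex.I) * W.waveSum j x ξ |outerCoord W.h x| |z - ζ| := by
  have hβ := W.beta0_pos
  set X := |outerCoord W.h x|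
  set Z := |z - ζ| with hZdef
  have hZ : 0 < Z := abs_pos.2 (sub_ne_zero.2 hz)
  have ci : ∀ Y σ : ℝ, ContourIntegrable (Real.pi / 2)
      fun w => planeWave W.beta0 Y Z w * W.angularAmplitude j x ξ σ w := by
    intro Y σ
    have := contourIntegrable_planeWave (X := Y) hβ hZ 0 0 1
      (continuous_angularAmplitude fun Q => (hc Q).1)
      (continuous_angularAmplitude_vertical fun Q => (hc Q).1)
      (norm_angularAmplitude_vertical_le (σ := σ) fun Q => (hc Q).2) (Real.pi / 2)
    simpa using this
  have key := integral_Ioi_eq (d := W.dSq) hβ (g := W.radIntegrand j x z ξ ζ)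
    (G₁ := fun w => 1 / (2 * Complex.I) * (planeWave W.beta0 X Z w * W.angularAmplitude j x ξ 1 w +
      planeWave W.beta0 (-X) Z w * W.angularAmplitude j x ξ (-1) w))
    (G₂ := fun b => -(1 / 2) * (planeWave W.beta0 X Z (b * Complex.I) *
        W.angularAmplitude j x ξ 1 (b * Complex.I) +
      planeWave W.beta0 (-X) Z (b * Complex.I) * W.angularAmplitude j x ξ (-1) (b * Complex.I)))
    ?_ ?_ (((ci X 1).1.add (ci (-X) (-1)).1).const_mul _)
    (((ci X 1).2.add (ci (-X) (-1)).2).const_mul _)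
  · refine ⟨key.1, ?_⟩
    rw [key.2, intervalIntegral.integral_const_mul, integral_const_mul,
      intervalIntegral.integral_add (ci X 1).1 (ci (-X) (-1)).1,
      integral_add (ci X 1).2 (ci (-X) (-1)).2, waveSum, contourIntegral, contourIntegral]
    have hI := Complex.I_ne_zero
    field_simp
    ring
  -- on both parts, `1 / (Q √(β₀² - Q²))` cancels against the Jacobian
  · intro w hw
    have hcw : 0 < Real.cos w := Real.cos_pos_of_mem_Ioo ⟨by linarith [hw.1, Real.pi_pos], hw.2⟩
    have hsw : 0 < Real.sin w := Real.sin_pos_of_pos_of_lt_pi hw.1 (by linarith [hw.2, Real.pi_pos])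
    have e : W.beta0 ^ 2 - (W.beta0 * Real.cos w) ^ 2 = (W.beta0 * Real.sin w) ^ 2 := by
      linear_combination (-W.beta0 ^ 2) * Real.sin_sq_add_cos_sq w
    rw [W.radIntegrand_eq j (mul_pos hβ hcw), e, outgoingSqrt_sq (by positivity)]
    have p1 : planeWave W.beta0 X Z w = Complex.exp (Complex.I * Z * (W.beta0 * Real.sin w : ℝ)) *
        Complex.exp (Complex.I * (W.beta0 * Real.cos w : ℝ) * X) := by
      rw [planeWave, ← Complex.exp_add]; congr 1; push_cast; ring
    have p2 : planeWave W.beta0 (-X) Z w =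
        Complex.exp (Complex.I * Z * (W.beta0 * Real.sin w : ℝ)) *
        Complex.exp (-(Complex.I * (W.beta0 * Real.cos w : ℝ) * X)) := by
      rw [planeWave, ← Complex.exp_add]; congr 1; push_cast; ring
    have a1 : W.angularAmplitude j x ξ 1 w = W.amplitude j x ξ (W.beta0 * Real.cos w : ℝ) := by
      simp [angularAmplitude]
    have a2 : W.angularAmplitude j x ξ (-1) w =
        W.amplitude j x ξ (-((W.beta0 * Real.cos w : ℝ) : ℂ)) := by
      simp [angularAmplitude]
    rw [p1, p2, a1, a2, Complex.real_smul, ← hZdef]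
    set E := Complex.exp (Complex.I * Z * (W.beta0 * Real.sin w : ℝ))
    set P := Complex.exp (Complex.I * (W.beta0 * Real.cos w : ℝ) * X) *
      W.amplitude j x ξ (W.beta0 * Real.cos w : ℝ)
    set N := Complex.exp (-(Complex.I * (W.beta0 * Real.cos w : ℝ) * X)) *
      W.amplitude j x ξ (-((W.beta0 * Real.cos w : ℝ) : ℂ))
    have hI := Complex.I_ne_zero
    have n1 : (W.beta0 : ℂ) ≠ 0 := by exact_mod_cast hβ.ne'
    have n2 : Complex.cos w ≠ 0 := by
      rw [← Complex.ofReal_cos]; exact_mod_cast hcw.ne'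
    have n3 : Complex.sin w ≠ 0 := by
      rw [← Complex.ofReal_sin]; exact_mod_cast hsw.ne'
    rw [mul_assoc E, mul_assoc E, ← mul_add E]
    change _ * (E / _ * ((P + N) / 2 / _)) = _ * (E * (P + N))
    push_cast
    field_simp
  · intro b hb
    have hcw := Real.cosh_pos b
    have hsw : 0 < Real.sinh b := Real.sinh_pos_iff.2 hb
    have e : W.beta0 ^ 2 - (W.beta0 * Real.cosh b) ^ 2 = -(W.beta0 * Real.sinh b) ^ 2 := by
      linear_combination (-W.beta0 ^ 2) * Real.cosh_sq b
    rw [W.radIntegrand_eq j (mul_pos hβ hcw), e, outgoingSqrt_neg_sq (by positivity)]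
    have p1 : planeWave W.beta0 X Z (b * Complex.I) =
        Complex.exp (Complex.I * Z * (Complex.I * (W.beta0 * Real.sinh b : ℝ))) *
        Complex.exp (Complex.I * (W.beta0 * Real.cosh b : ℝ) * X) := by
      rw [planeWave_vertical, ← Complex.exp_add]
      congr 1; push_cast
      linear_combination (-(W.beta0 * Z * Complex.sinh b)) * Complex.I_sq
    have p2 : planeWave W.beta0 (-X) Z (b * Complex.I) =
        Complex.exp (Complex.I * Z * (Complex.I * (W.beta0 * Real.sinh b : ℝ))) *
        Complex.exp (-(Complex.I * (W.beta0 * Real.cosh b : ℝ) * X)) := by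
      rw [planeWave_vertical, ← Complex.exp_add]
      congr 1; push_cast
      linear_combination (-(W.beta0 * Z * Complex.sinh b)) * Complex.I_sq
    have a1 : W.angularAmplitude j x ξ 1 (b * Complex.I) =
        W.amplitude j x ξ (W.beta0 * Real.cosh b : ℝ) := by
      simp [angularAmplitude, Complex.cos_mul_I]
    have a2 : W.angularAmplitude j x ξ (-1) (b * Complex.I) =
        W.amplitude j x ξ (-((W.beta0 * Real.cosh b : ℝ) : ℂ)) := by
      simp [angularAmplitude, Complex.cos_mul_I]
    rw [p1, p2, a1, a2, Complex.real_smul, ← hZdef]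
    set E := Complex.exp (Complex.I * Z * (Complex.I * (W.beta0 * Real.sinh b : ℝ)))
    set P := Complex.exp (Complex.I * (W.beta0 * Real.cosh b : ℝ) * X) *
      W.amplitude j x ξ (W.beta0 * Real.cosh b : ℝ)
    set N := Complex.exp (-(Complex.I * (W.beta0 * Real.cosh b : ℝ) * X)) *
      W.amplitude j x ξ (-((W.beta0 * Real.cosh b : ℝ) : ℂ))
    have hI := Complex.I_ne_zero
    have n1 : (W.beta0 : ℂ) ≠ 0 := by exact_mod_cast hβ.ne'
    have n2 : Complex.cosh b ≠ 0 := by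
      rw [← Complex.ofReal_cosh]; exact_mod_cast hcw.ne'
    have n3 : Complex.sinh b ≠ 0 := by
      rw [← Complex.ofReal_sinh]; exact_mod_cast hsw.ne'
    rw [mul_assoc E, mul_assoc E, ← mul_add E]
    change _ * (E / _ * ((P + N) / 2 / _)) = _ * (E * (P + N))
    push_cast
    have hI2 : Complex.I * Complex.I = -1 := Complex.I_mul_I
    rw [show (2 * Complex.I * (Complex.I * (W.beta0 * Complex.sinh b)) : ℂ) =
      -(2 * (W.beta0 * Complex.sinh b)) by linear_combination (2 * (W.beta0 * Complex.sinh b)) * hI2]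
    field_simp

end Waveguide

/-! ### The radiation condition for plane wave superpositions -/

theorem ofReal_mem_amplitudeRegion {ε : ℝ} (hε : 0 ≤ ε) (r Q : ℝ) :
    (Q : ℂ) ∈ amplitudeRegion ε r := by
  rcases le_total ‖(Q : ℂ)‖ r with h | h
  · exact Or.inl ⟨by simpa using hε, h⟩
  · exact Or.inr ⟨by simp, h⟩

theorem re_mul_cos (c : ℝ) (w : ℂ) :
    ((c : ℂ) * Complex.cos w).re = c * (Real.cos w.re * Real.cosh w.im) := by
  rw [Complex.re_ofReal_mul, Complex.cos_eq w, ← Complex.ofReal_cos, ← Complex.ofReal_cosh,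
    ← Complex.ofReal_sin, ← Complex.ofReal_sinh]
  simp [-Complex.ofReal_cos, -Complex.ofReal_cosh, -Complex.ofReal_sin, -Complex.ofReal_sinh]

theorem im_mul_cos (c : ℝ) (w : ℂ) :
    ((c : ℂ) * Complex.cos w).im = -(c * (Real.sin w.re * Real.sinh w.im)) := by
  rw [Complex.im_ofReal_mul, Complex.cos_eq w, ← Complex.ofReal_cos, ← Complex.ofReal_cosh,
    ← Complex.ofReal_sin, ← Complex.ofReal_sinh]
  simp [-Complex.ofReal_cos, -Complex.ofReal_cosh, -Complex.ofReal_sin, -Complex.ofReal_sinh]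

/-- Near the real axis, `c cos w` stays in the thin part of the region. -/
theorem mul_cos_mem_amplitudeRegion_of_band {ε r η c : ℝ} {w : ℂ} (hη1 : η ≤ 1 / 2)
    (hηε : 2 * r * η ≤ ε) (hc : 2 * |c| ≤ r) (h0 : 0 ≤ w.im) (h1 : w.im ≤ η) :
    (c : ℂ) * Complex.cos w ∈ amplitudeRegion ε r ∧ |((c : ℂ) * Complex.cos w).im| ≤ ε := by
  have hη : 0 ≤ η := h0.trans h1
  have hs : Real.sinh w.im ≤ 2 * η := by
    have h2 := Real.sinh_le_sinh.2 h1
    have h3 : Real.sinh η ≤ 2 * η := by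
      have h4 := Real.abs_exp_sub_one_le (x := η) (by rw [abs_of_nonneg hη]; linarith)
      have h5 := Real.abs_exp_sub_one_le (x := -η) (by rw [abs_neg, abs_of_nonneg hη]; linarith)
      rw [abs_neg, abs_of_nonneg hη] at h5
      rw [abs_of_nonneg hη] at h4
      rw [Real.sinh_eq]
      linarith [(abs_le.1 h4).2, (abs_le.1 h5).1]
    linarith
  have hs0 : 0 ≤ Real.sinh w.im := Real.sinh_nonneg_iff.2 h0
  have him : |((c : ℂ) * Complex.cos w).im| ≤ ε := by
    rw [im_mul_cos, abs_neg, abs_mul, abs_mul, abs_of_nonneg hs0]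
    have := Real.abs_sin_le_one w.re
    calc |c| * (|Real.sin w.re| * Real.sinh w.im) ≤ |c| * (1 * (2 * η)) := by gcongr
      _ ≤ r * η := by nlinarith
      _ ≤ ε := by nlinarith [abs_nonneg c]
  refine ⟨Or.inl ⟨him, ?_⟩, him⟩
  have hcos : ‖Complex.cos w‖ ≤ 2 := by
    have h2 := norm_sin_le_exp (w + Real.pi / 2)
    rw [Complex.sin_add_pi_div_two] at h2
    have h3 : (w + Real.pi / 2 : ℂ).im = w.im := by
      rw [Complex.add_im, ← Complex.ofReal_ofNat, ← Complex.ofReal_div, Complex.ofReal_im, add_zero]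
    rw [h3, abs_of_nonneg h0] at h2
    have h4 := Real.abs_exp_sub_one_le (x := w.im) (by rw [abs_of_nonneg h0]; linarith)
    rw [abs_of_nonneg h0] at h4
    linarith [(abs_le.1 h4).2]
  rw [norm_mul, Complex.norm_real, Real.norm_eq_abs]
  nlinarith [abs_nonneg c]

/-- On the half strips used for the vertical parts of the contours, `c cos w` stays in the closed
upper half plane, and where it is small it is close to the real axis. -/
theorem mul_cos_mem_amplitudeRegion_of_strip {ε r η c : ℝ} {w : ℂ}
    (hη1 : η ≤ 1 / 2) (hηε : 2 * r * η ≤ ε) (ha : |w.re| ≤ η) (hca : c * w.re ≤ 0)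
    (h0 : 0 ≤ w.im) : (c : ℂ) * Complex.cos w ∈ amplitudeRegion ε r := by
  have hs0 : 0 ≤ Real.sinh w.im := Real.sinh_nonneg_iff.2 h0
  have hch := Real.cosh_pos w.im
  by_cases hQ : r ≤ ‖(c : ℂ) * Complex.cos w‖
  · refine Or.inr ⟨?_, hQ⟩
    rw [im_mul_cos, neg_nonneg, ← mul_assoc]
    refine mul_nonpos_of_nonpos_of_nonneg ?_ hs0
    have hpi := Real.pi_gt_three
    have ha' := abs_le.1 ha
    rcases le_total 0 w.re with h | h
    · have h1 := Real.sin_nonneg_of_nonneg_of_le_pi h (by linarith)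
      rcases h.eq_or_lt with h2 | h2
      · simp [← h2]
      · exact mul_nonpos_of_nonpos_of_nonneg (by nlinarith) h1
    · have h1 := Real.sin_nonpos_of_nonpos_of_neg_pi_le h (by linarith)
      rcases h.eq_or_lt with h2 | h2
      · simp [h2]
      · exact mul_nonpos_of_nonneg_of_nonpos (by nlinarith) h1
  · have hQ' := (not_le.1 hQ).le
    refine Or.inl ⟨?_, hQ'⟩
    have hcos : 1 / 2 ≤ Real.cos w.re := by
      have h1 := Real.one_sub_sq_div_two_le_cos (x := w.re)
      have h2 : w.re ^ 2 ≤ (1 / 2) ^ 2 := sq_le_sq' (by linarith [(abs_le.1 ha).1])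
        ((le_abs_self _).trans (ha.trans hη1))
      linarith
    have hre := (Complex.abs_re_le_norm _).trans hQ'
    rw [re_mul_cos, abs_mul, abs_mul, abs_of_pos hch, abs_of_nonneg (by linarith : 0 ≤ Real.cos w.re)]
      at hre
    have h3 : |c| * Real.cosh w.im ≤ 2 * r := by
      have := mul_le_mul_of_nonneg_right hcos (mul_nonneg (abs_nonneg c) hch.le)
      linarith
    rw [im_mul_cos, abs_neg, abs_mul, abs_mul, abs_of_nonneg hs0]
    have h4 : |Real.sin w.re| ≤ η := Real.abs_sin_le_abs.trans ha
    have h5 : Real.sinh w.im ≤ Real.cosh w.im := (Real.sinh_lt_cosh _).le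
    have h6 : 0 ≤ η := (abs_nonneg _).trans ha
    calc |c| * (|Real.sin w.re| * Real.sinh w.im) ≤ |c| * (η * Real.cosh w.im) := by gcongr
      _ = |c| * Real.cosh w.im * η := by ring
      _ ≤ 2 * r * η := by gcongr
      _ ≤ ε := hηε

namespace Waveguide

/-- Uniform decay of the oscillatory integrals that make up the `j`-th part of the Green's
function. The angle `θ` lies in the half of `(0, π)` on which the contour can be moved into the
region where `Q = σ β₀ cos w` has non-negative imaginary part. -/
theorem exists_wave_bound (W : Waveguide) (j : Parity) {B : ℝ} (hB : 0 ≤ B) :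
    ∃ K κ₀ M : ℝ, 1 ≤ κ₀ ∧ 0 ≤ K ∧ ∀ x ξ : ℝ, |ξ| ≤ B →
      (∀ Q : ℝ, DifferentiableAt ℂ (W.amplitude j x ξ) Q ∧ ‖W.amplitude j x ξ Q‖ ≤ M) ∧
      ∀ (σ θ κ : ℝ) (n m : ℕ),
        (σ = 1 ∧ θ ∈ Ioc 0 (Real.pi / 2) ∨ σ = -1 ∧ θ ∈ Ico (Real.pi / 2) Real.pi) →
        (|x| ≤ W.h → θ = Real.pi / 2) → n ≤ 1 → m ≤ 1 → κ₀ ≤ κ →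
        IntegrableOn (fun b : ℝ => oscIntegrand θ κ n
          (fun w => Complex.sin w ^ m * W.angularAmplitude j x ξ σ w) (b * Complex.I)) (Ioi 0) ∧
        ‖contourIntegral θ (oscIntegrand θ κ n
          fun w => Complex.sin w ^ m * W.angularAmplitude j x ξ σ w)‖ ≤
            K / (κ ^ n * Real.sqrt κ) := by
  have hβ := W.beta0_pos
  have hpi := Real.pi_gt_three
  obtain ⟨r, ε, M, C, hqr, hr, hε, hM, hC, hamp⟩ := W.exists_amplitude_bound j hB (2 * W.beta0)
  -- with `2 r η ≤ ε` the thin part of the region contains the image of the band of width `η`, and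
  -- of those points of the half strip where `|Q| ≤ r`
  set η := min (1 / 2) (ε / (2 * r))
  have hη : 0 < η := lt_min (by norm_num) (by positivity)
  have hη1 : η ≤ 1 / 2 := min_le_left _ _
  have hηε : 2 * r * η ≤ ε := by
    have := mul_le_mul_of_nonneg_left (min_le_right (1 / 2) (ε / (2 * r)))
      (by positivity : 0 ≤ 2 * r)
    rwa [mul_div_cancel₀ _ (by positivity)] at this
  obtain ⟨K, κ₀, hκ₀, hK, hmain⟩ := norm_contourIntegral_le hη hη1 (mul_nonneg hC hβ.le)
  -- in the band, `‖sin w‖ ≤ exp (im w) ≤ 2` and `|im Q| ≤ ε`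
  set M' := 2 * (M * Real.exp (C * ε)) with hM'
  have hM'0 : 0 ≤ M' := by positivity
  have hexp1 : 1 ≤ Real.exp (C * ε) := Real.one_le_exp (by positivity)
  have hMM' : M ≤ M' := by nlinarith
  refine ⟨K * M', κ₀, M, hκ₀, by positivity, fun x ξ hξ => ⟨fun Q => ?_,
    fun σ θ κ n m hσ hx hn hm hκ => ?_⟩⟩
  · have h1 := hamp Q (ofReal_mem_amplitudeRegion hε.le r Q) x ξ hξ fun _ => by
      rw [← Complex.ofReal_neg]; exact ofReal_mem_amplitudeRegion hε.le r (-Q)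
    exact ⟨h1.1, by simpa using h1.2⟩
  have hσ1 : |σ| = 1 := by rcases hσ with ⟨rfl, -⟩ | ⟨rfl, -⟩ <;> simp
  have hσβ : |σ * W.beta0| = W.beta0 := by rw [abs_mul, hσ1, one_mul, abs_of_pos hβ]
  have hθ : θ ∈ Ioo 0 Real.pi := by
    rcases hσ with ⟨-, h⟩ | ⟨-, h⟩
    · exact ⟨h.1, by linarith [h.2]⟩
    · exact ⟨by linarith [h.1], h.2⟩
  have hsin : ∀ w : ℂ, 0 ≤ w.im → ‖Complex.sin w ^ m‖ ≤ Real.exp w.im := by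
    intro w hw
    have h1 := norm_sin_le_exp w
    rw [abs_of_nonneg hw] at h1
    interval_cases m
    · simpa using hw
    · simpa using h1
  have hf : ∀ w : ℂ, 0 ≤ w.im → ((σ * W.beta0 : ℝ) * Complex.cos w) ∈ amplitudeRegion ε r →
      (|x| ≤ W.h → -((σ * W.beta0 : ℝ) * Complex.cos w) ∈ amplitudeRegion ε r) →
      DifferentiableAt ℂ (fun w => Complex.sin w ^ m * W.angularAmplitude j x ξ σ w) w ∧
      ‖Complex.sin w ^ m * W.angularAmplitude j x ξ σ w‖ ≤
        Real.exp w.im * (M * Real.exp (C * |((σ * W.beta0 : ℝ) * Complex.cos w).im|)) := by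
    intro w hw h1 h2
    obtain ⟨h3, h4⟩ := hamp _ h1 x ξ hξ h2
    constructor
    · refine (Complex.differentiable_sin w).pow m |>.mul ?_
      exact DifferentiableAt.comp w h3 ((Complex.differentiable_cos w).const_mul _)
    · rw [norm_mul]
      exact mul_le_mul (hsin w hw) h4 (norm_nonneg _) (Real.exp_pos _).le
  have hneg : ∀ w : ℂ, -((σ * W.beta0 : ℝ) * Complex.cos w) =
      ((-(σ * W.beta0) : ℝ) : ℂ) * Complex.cos w := by
    intro w; push_cast; ring
  -- inside the core the vertical contour stays on the line `w.re = 0`, where `Q` is real;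
  -- outside it moves to the side on which `Q` has positive imaginary part
  obtain ⟨a₀, ha, h1, h2, hside⟩ : ∃ a₀ : ℝ, |a₀| ≤ η ∧ η ≤ θ - a₀ ∧ θ - a₀ ≤ Real.pi - η ∧
      ∀ a ∈ uIcc 0 a₀, |a| ≤ η ∧ σ * W.beta0 * a ≤ 0 ∧ (|x| ≤ W.h → a = 0) := by
    by_cases h0 : |x| ≤ W.h
    · refine ⟨0, by simpa using hη.le, by rw [hx h0]; linarith, by rw [hx h0]; linarith,
        fun a h => ?_⟩
      have : a = 0 := by simpa using h
      simp [this, hη.le]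
    · rcases hσ with ⟨rfl, h⟩ | ⟨rfl, h⟩
      · refine ⟨-η, by rw [abs_neg, abs_of_pos hη], by linarith [h.1], by linarith [h.2],
          fun a ha => ?_⟩
        rw [uIcc_of_ge (by linarith)] at ha
        exact ⟨abs_le.2 ⟨ha.1, by linarith [ha.2]⟩, by nlinarith [ha.2], fun h => absurd h h0⟩
      · refine ⟨η, by rw [abs_of_pos hη], by linarith [h.1], by linarith [h.2],
          fun a ha => ?_⟩
        rw [uIcc_of_le (by linarith)] at ha
        exact ⟨abs_le.2 ⟨by linarith [ha.1], ha.2⟩, by nlinarith [ha.1], fun h => absurd h h0⟩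
  refine hmain θ a₀ κ M' _ n hn hθ ha h1 h2 hκ (fun w _ _ h3 h4 => ?_) fun w h3 h4 => ?_
  · obtain ⟨h5, h6⟩ := mul_cos_mem_amplitudeRegion_of_band (c := σ * W.beta0) hη1 hηε
      (by rw [hσβ]; exact hqr) h3 h4
    obtain ⟨h7, h8⟩ := hf w h3 h5 fun _ => by
      rw [hneg]
      exact (mul_cos_mem_amplitudeRegion_of_band hη1 hηε (by rw [abs_neg, hσβ]; exact hqr) h3 h4).1
    refine ⟨h7, h8.trans ?_⟩
    have h9 : Real.exp w.im ≤ 2 := by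
      have h4 := Real.abs_exp_sub_one_le (x := w.im) (by rw [abs_of_nonneg h3]; linarith)
      rw [abs_of_nonneg h3] at h4
      linarith [(abs_le.1 h4).2]
    rw [hM']
    gcongr
  · obtain ⟨s1, s2, s3⟩ := hside _ h3
    have him : 0 ≤ w.im := hη.le.trans h4
    have hsh : 0 ≤ Real.sinh w.im := Real.sinh_nonneg_iff.2 him
    obtain ⟨h7, h8⟩ := hf w him (mul_cos_mem_amplitudeRegion_of_strip hη1 hηε s1 s2 him)
      fun h0 => by
        rw [hneg]
        exact mul_cos_mem_amplitudeRegion_of_strip hη1 hηε s1 (by simp [s3 h0]) him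
    refine ⟨h7, h8.trans ?_⟩
    rw [im_mul_cos, abs_neg, abs_mul, hσβ, abs_mul, abs_of_nonneg hsh, Real.exp_add]
    have h9 : |Real.sin w.re| ≤ |w.re| := Real.abs_sin_le_abs
    calc Real.exp w.im * (M * Real.exp (C * (W.beta0 * (|Real.sin w.re| * Real.sinh w.im))))
        ≤ Real.exp w.im * (M' * Real.exp (C * (W.beta0 * (|w.re| * Real.sinh w.im)))) := by gcongr
      _ = _ := by ring_nf

end Waveguide

namespace Waveguide

/-- The radiation condition for one superposition of plane waves, at the point
`(ρ cos θ, ρ sin θ)`. The differential operator multiplies each plane wave by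
`cos (w - θ) - 1` up to terms of size `1 / R`. -/
theorem exists_radiation_bound (W : Waveguide) (j : Parity) {B : ℝ} (hB : 0 ≤ B) :
    ∃ C R₀ M : ℝ, 0 < R₀ ∧ ∀ x ξ : ℝ, |ξ| ≤ B →
      (∀ Q : ℝ, DifferentiableAt ℂ (W.amplitude j x ξ) Q ∧ ‖W.amplitude j x ξ Q‖ ≤ M) ∧
      ∀ R σ θ ρ δ : ℝ, R₀ ≤ R →
        (σ = 1 ∧ θ ∈ Ioc 0 (Real.pi / 2) ∨ σ = -1 ∧ θ ∈ Ico (Real.pi / 2) Real.pi) →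
        (|x| ≤ W.h → θ = Real.pi / 2) → |ρ - R| ≤ B → |δ| ≤ B →
        ‖contourIntegral θ fun w => (-(Complex.I * W.beta0) + Complex.I * W.beta0 *
          ((ρ * Real.cos θ / R : ℝ) * Complex.cos w +
            ((ρ * Real.sin θ + δ) / R : ℝ) * Complex.sin w)) *
          (planeWave W.beta0 (ρ * Real.cos θ) (ρ * Real.sin θ) w *
            W.angularAmplitude j x ξ σ w)‖ ≤ C * R ^ (-(3 / 2) : ℝ) := by
  have hβ := W.beta0_pos
  obtain ⟨K, κ₀, M, hκ₀, hK, hmain⟩ := W.exists_wave_bound j hB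
  -- `ρ ≥ R / 2`, so that `κ = β₀ ρ ≥ b R`
  set b := W.beta0 / 2 with hb
  have hb0 : 0 < b := by positivity
  refine ⟨W.beta0 * (2 * (K / (b * Real.sqrt b)) + 2 * B * (K / Real.sqrt b)),
    max (max 1 (2 * B)) (κ₀ / b), M, lt_max_of_lt_left (lt_max_of_lt_left one_pos),
    fun x ξ hξ => ⟨(hmain x ξ hξ).1, fun R σ θ ρ δ hR hσ hx hρ hδ => ?_⟩⟩
  have hR1 : 1 ≤ R := (le_max_left _ _).trans ((le_max_left _ _).trans hR)
  have hR2 : 2 * B ≤ R := (le_max_right _ _).trans ((le_max_left _ _).trans hR)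
  have hR3 : κ₀ ≤ R * b := (div_le_iff₀ hb0).1 ((le_max_right _ _).trans hR)
  have hR0 : 0 < R := by linarith
  obtain ⟨hρ1, hρ2⟩ := abs_le.1 hρ
  have hκb : b * R ≤ W.beta0 * ρ := by rw [hb]; nlinarith
  have hκ : κ₀ ≤ W.beta0 * ρ := by linarith
  have hκ0 : 0 ≤ W.beta0 * ρ := by linarith
  obtain ⟨hc, hwave⟩ := hmain x ξ hξ
  have hca := continuous_angularAmplitude (σ := σ) fun Q => (hc Q).1
  set κ := W.beta0 * ρ with hκdef
  set J : ℕ → ℕ → ℂ → ℂ := fun n m => oscIntegrand θ κ n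
    fun w => Complex.sin w ^ m * W.angularAmplitude j x ξ σ w with hJ
  have hint : ∀ n m : ℕ, n ≤ 1 → m ≤ 1 → ContourIntegrable θ (J n m) := by
    intro n m hn hm
    refine ⟨Continuous.intervalIntegrable ?_ _ _, (hwave σ θ κ n m hσ hx hn hm hκ).1⟩
    simp only [hJ, oscIntegrand]
    exact Continuous.mul (by fun_prop) (Continuous.mul (by fun_prop) hca)
  have hsq : 0 < Real.sqrt (b * R) := Real.sqrt_pos.2 (by positivity)
  have hbd : ∀ n m : ℕ, n ≤ 1 → m ≤ 1 →
      ‖contourIntegral θ (J n m)‖ ≤ K / ((b * R) ^ n * Real.sqrt (b * R)) := by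
    intro n m hn hm
    refine (hwave σ θ κ n m hσ hx hn hm hκ).2.trans ?_
    gcongr
  have e : (fun w => (-(Complex.I * W.beta0) + Complex.I * W.beta0 *
          ((ρ * Real.cos θ / R : ℝ) * Complex.cos w +
            ((ρ * Real.sin θ + δ) / R : ℝ) * Complex.sin w)) *
          (planeWave W.beta0 (ρ * Real.cos θ) (ρ * Real.sin θ) w *
            W.angularAmplitude j x ξ σ w)) =
      fun w => (Complex.I * W.beta0 * (ρ / R : ℝ)) * J 1 0 w +
        ((Complex.I * W.beta0 * ((ρ - R) / R : ℝ)) * J 0 0 w +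
          (Complex.I * W.beta0 * (δ / R : ℝ)) * J 0 1 w) := by
    -- `cos θ cos w + sin θ sin w = cos (w - θ)`
    funext w
    simp only [hJ, oscIntegrand, planeWave_polar, ← hκdef, pow_zero, pow_one, one_mul]
    have hR' : (R : ℂ) ≠ 0 := by exact_mod_cast hR0.ne'
    rw [Complex.cos_sub]
    push_cast
    field_simp
    ring
  have i1 := hint 1 0 le_rfl zero_le_one
  have i2 := hint 0 0 zero_le_one zero_le_one
  have i3 := hint 0 1 zero_le_one le_rfl
  have b1 := hbd 1 0 le_rfl zero_le_one
  have b2 := hbd 0 0 zero_le_one zero_le_one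
  have b3 := hbd 0 1 zero_le_one le_rfl
  rw [pow_zero, one_mul] at b2 b3
  rw [pow_one] at b1
  rw [e, contourIntegral_add (i1.const_mul _) ((i2.const_mul _).add (i3.const_mul _)),
    contourIntegral_add (i2.const_mul _) (i3.const_mul _), contourIntegral_const_mul,
    contourIntegral_const_mul, contourIntegral_const_mul]
  have hn : ∀ t : ℝ, ‖Complex.I * W.beta0 * (t : ℂ)‖ = W.beta0 * |t| := by
    intro t
    rw [norm_mul, norm_mul, Complex.norm_I, one_mul, Complex.norm_real, Complex.norm_real,
      Real.norm_eq_abs, Real.norm_eq_abs, abs_of_pos hβ]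
  have t1 : |ρ / R| ≤ 2 := by
    rw [abs_of_nonneg (div_nonneg (by linarith) hR0.le), div_le_iff₀ hR0]; linarith
  have t2 : |(ρ - R) / R| ≤ B / R := by
    rw [abs_div, abs_of_pos hR0]; gcongr
  have t3 : |δ / R| ≤ B / R := by
    rw [abs_div, abs_of_pos hR0]; gcongr
  have hpow : R ^ (-(3 / 2) : ℝ) = 1 / (R * Real.sqrt R) := by
    rw [Real.rpow_neg hR0.le, one_div, Real.sqrt_eq_rpow, show (3 / 2 : ℝ) = 1 + 1 / 2 by norm_num,
      Real.rpow_add hR0, Real.rpow_one]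
  refine (norm_add_le _ _).trans ((add_le_add_right (norm_add_le _ _) _).trans ?_)
  rw [norm_mul _ (contourIntegral θ (J 1 0)), norm_mul _ (contourIntegral θ (J 0 0)),
    norm_mul _ (contourIntegral θ (J 0 1)), hn, hn, hn]
  calc _ ≤ W.beta0 * 2 * (K / (b * R * Real.sqrt (b * R))) +
        (W.beta0 * (B / R) * (K / Real.sqrt (b * R)) +
          W.beta0 * (B / R) * (K / Real.sqrt (b * R))) := by gcongr
    _ = _ := by
      rw [hpow, Real.sqrt_mul hb0.le]
      have := Real.sqrt_pos.2 hb0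
      have := Real.sqrt_pos.2 hR0
      field_simp
      ring

/-- The radiation condition for the `j`-th part of the Green's function. Here `X = |[x]_h|`,
`Z = |z - ζ|`, and `(X / R, (Z + δ) / R)` is the direction of differentiation. -/
theorem exists_waveSum_radiation (W : Waveguide) (j : Parity) {B : ℝ} (hB : 0 ≤ B) :
    ∃ C R₀ M : ℝ, 0 < R₀ ∧ ∀ x ξ : ℝ, |ξ| ≤ B →
      (∀ Q : ℝ, DifferentiableAt ℂ (W.amplitude j x ξ) Q ∧ ‖W.amplitude j x ξ Q‖ ≤ M) ∧
      ∀ R X Z δ : ℝ, R₀ ≤ R → 0 ≤ X → 0 < Z → (|x| ≤ W.h → X = 0) →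
        |Real.sqrt (X ^ 2 + Z ^ 2) - R| ≤ B → |δ| ≤ B →
        ∃ D : ℂ, HasDerivAt
            (fun t : ℝ => W.waveSum j x ξ (X + t * (X / R)) (Z + t * ((Z + δ) / R))) D 0 ∧
          ‖D - Complex.I * W.beta0 * W.waveSum j x ξ X Z‖ ≤ C * R ^ (-(3 / 2) : ℝ) := by
  have hβ := W.beta0_pos
  obtain ⟨C, R₀, M, hR₀, hmain⟩ := W.exists_radiation_bound j hB
  refine ⟨2 * C, R₀, M, hR₀, fun x ξ hξ => ⟨(hmain x ξ hξ).1, fun R X Z δ hR hX hZ hx hρ hδ => ?_⟩⟩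
  obtain ⟨hc, hrad⟩ := hmain x ξ hξ
  have c1 := fun σ => continuous_angularAmplitude (σ := σ) fun Q => (hc Q).1
  have c2 := fun σ => continuous_angularAmplitude_vertical (σ := σ) fun Q => (hc Q).1
  have c3 := fun σ => norm_angularAmplitude_vertical_le (σ := σ) fun Q => (hc Q).2
  have hd := fun Y σ => hasDerivAt_contourIntegral_planeWave (X := Y) hβ hZ (Y / R) ((Z + δ) / R)
    (c1 σ) (c2 σ) (c3 σ) (Real.pi / 2)
  refine ⟨_, ((hd X 1).add (hd (-X) (-1))).congr_of_eventuallyEq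
    (Filter.Eventually.of_forall fun t => ?_), ?_⟩
  · simp only [waveSum, Pi.add_apply]
    rw [neg_add, ← mul_neg, ← neg_div]
  -- polar coordinates
  set w₀ : ℂ := ⟨X, Z⟩
  set ρ := ‖w₀‖ with hρdef
  set θ := w₀.arg with hθdef
  have hX' : ρ * Real.cos θ = X := Complex.norm_mul_cos_arg w₀
  have hZ' : ρ * Real.sin θ = Z := Complex.norm_mul_sin_arg w₀
  have hρ' : ρ = Real.sqrt (X ^ 2 + Z ^ 2) := by
    rw [hρdef, Complex.norm_eq_sqrt_sq_add_sq]
  rw [← hρ'] at hρ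
  have hθ1 : 0 < θ := lt_of_le_of_ne (Complex.arg_nonneg_iff.2 hZ.le) fun h => by
    rw [← h, Real.sin_zero, mul_zero] at hZ'
    exact hZ.ne hZ'
  have hθ2 : θ ≤ Real.pi / 2 :=
    (le_abs_self _).trans (Complex.abs_arg_le_pi_div_two_iff.2 hX)
  have hθx : |x| ≤ W.h → θ = Real.pi / 2 := fun h =>
    Complex.arg_eq_pi_div_two_iff.2 ⟨hx h, hZ⟩
  have r1 := hrad R 1 θ ρ δ hR (Or.inl ⟨rfl, hθ1, hθ2⟩) hθx hρ hδ
  have r2 := hrad R (-1) (Real.pi - θ) ρ δ hR (Or.inr ⟨rfl, by linarith, by linarith⟩)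
    (fun h => by rw [hθx h]; ring) hρ hδ
  rw [Real.cos_pi_sub, Real.sin_pi_sub, mul_neg] at r2
  rw [hX', hZ'] at r1 r2
  -- the integrand of the radiation operator applied to one superposition
  set F : ℝ → ℝ → ℂ → ℂ := fun Y σ w => (-(Complex.I * W.beta0) + Complex.I * W.beta0 *
    ((Y / R : ℝ) * Complex.cos w + ((Z + δ) / R : ℝ) * Complex.sin w)) *
      (planeWave W.beta0 Y Z w * W.angularAmplitude j x ξ σ w) with hF
  have hFc : ∀ Y σ, Continuous fun a : ℝ => F Y σ a := fun Y σ =>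
    Continuous.mul (by fun_prop) ((continuous_planeWave_real _ _ _).mul (c1 σ))
  have hFi : ∀ Y σ, contourIntegral (Real.pi / 2) (fun w => Complex.I * W.beta0 *
      ((Y / R : ℝ) * Complex.cos w + ((Z + δ) / R : ℝ) * Complex.sin w) *
        (planeWave W.beta0 Y Z w * W.angularAmplitude j x ξ σ w)) -
      Complex.I * W.beta0 * contourIntegral (Real.pi / 2)
        (fun w => planeWave W.beta0 Y Z w * W.angularAmplitude j x ξ σ w) =
      contourIntegral (Real.pi / 2) (F Y σ) := by
    intro Y σ
    have j1 := (contourIntegrable_planeWave (X := Y) hβ hZ (Y / R) ((Z + δ) / R) 0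
      (c1 σ) (c2 σ) (c3 σ) (Real.pi / 2)).const_mul (Complex.I * W.beta0)
    have j2 := (contourIntegrable_planeWave (X := Y) hβ hZ 0 0 1
      (c1 σ) (c2 σ) (c3 σ) (Real.pi / 2)).const_mul (-(Complex.I * W.beta0))
    have e1 : F Y σ = fun w => -(Complex.I * W.beta0) *
        ((1 + ((0 : ℝ) * Complex.cos w + (0 : ℝ) * Complex.sin w)) *
          (planeWave W.beta0 Y Z w * W.angularAmplitude j x ξ σ w)) +
        Complex.I * W.beta0 * ((0 + ((Y / R : ℝ) * Complex.cos w +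
          ((Z + δ) / R : ℝ) * Complex.sin w)) *
          (planeWave W.beta0 Y Z w * W.angularAmplitude j x ξ σ w)) := by
      funext w
      simp only [hF, Complex.ofReal_zero]
      ring
    rw [e1, contourIntegral_add j2 j1, contourIntegral_const_mul, contourIntegral_const_mul]
    simp only [mul_assoc (Complex.I * (W.beta0 : ℂ)), contourIntegral_const_mul,
      Complex.ofReal_zero, zero_mul, add_zero, one_mul, zero_add]
    ring
  have key : ∀ a b c d e : ℂ, a + b - e * (c + d) = (a - e * c) + (b - e * d) := by intros; ring
  rw [waveSum, key, hFi, hFi, contourIntegral_add_reflect (θ := θ) (hFc X 1) (hFc (-X) (-1))]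
  · refine (norm_add_le _ _).trans ?_
    linarith
  · intro a
    simp only [hF, planeWave, angularAmplitude]
    rw [← Complex.ofReal_cos, ← Complex.ofReal_sin, Real.cos_pi_sub, Real.sin_pi_sub]
    push_cast
    simp only [one_mul, neg_mul, mul_neg, neg_neg, neg_div]

end Waveguide

/-! ### The boundary of `Ω_R` and the normal derivative -/

theorem continuous_outerCoord {h : ℝ} (hh : 0 < h) : Continuous (outerCoord h) := by
  have : outerCoord h = fun x => x - max (-h) (min h x) := by
    funext x
    simp only [outerCoord]
    split_ifs with h1 h2
    · rw [min_eq_right (by linarith), max_eq_left h1.le]; ring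
    · rw [min_eq_right h2, max_eq_right (not_lt.1 h1)]; ring
    · rw [min_eq_left (not_le.1 h2).le, max_eq_right (by linarith)]
  rw [this]
  fun_prop

namespace Waveguide

theorem sq_add_sq_eq_of_mem_frontier (W : Waveguide) {R : ℝ} {p : ℝ × ℝ}
    (hp : p ∈ frontier (W.Omega R)) : outerCoord W.h p.1 ^ 2 + p.2 ^ 2 = R ^ 2 :=
  frontier_le_subset_eq ((((continuous_outerCoord W.h_pos).comp continuous_fst).pow 2).add
    (continuous_snd.pow 2)) continuous_const hp

/-- Outside the core the amplitude only depends on the side. -/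
theorem amplitude_congr (W : Waveguide) (j : Parity) {x x' : ℝ} (ξ : ℝ) (hx : W.h < |x|)
    (hx' : W.h < |x'|) (h : 0 < x ↔ 0 < x') : W.amplitude j x ξ = W.amplitude j x' ξ := by
  funext Q
  simp only [amplitude, if_neg (not_le.2 hx), if_neg (not_le.2 hx'), h]

/-- Along the normal direction, `|[x]_h|` is affine and the amplitude does not change. -/
theorem eventually_outerCoord_eq (W : Waveguide) (j : Parity) (x ξ R : ℝ) :
    ∀ᶠ t : ℝ in nhds 0,
      |outerCoord W.h (x + t * (outerCoord W.h x / R))| =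
        |outerCoord W.h x| + t * (|outerCoord W.h x| / R) ∧
      W.amplitude j (x + t * (outerCoord W.h x / R)) ξ = W.amplitude j x ξ := by
  have hh := W.h_pos
  by_cases h0 : |x| ≤ W.h
  · have e : outerCoord W.h x = 0 := by
      rw [← abs_eq_zero, abs_outerCoord _ _ hh, if_pos h0]
    simp [e]
  · have hc : Continuous fun t : ℝ => x + t * (outerCoord W.h x / R) := by fun_prop
    rcases lt_abs.1 (not_le.1 h0) with h1 | h1
    · filter_upwards [hc.continuousAt.eventually_mem (Ioi_mem_nhds
        (by simpa using h1 : W.h < x + 0 * (outerCoord W.h x / R)))] with t ht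
      have ht : W.h < x + t * (outerCoord W.h x / R) := ht
      have e : outerCoord W.h x = x - W.h := by
        rw [outerCoord, if_neg (by linarith), if_neg (by linarith)]
      refine ⟨?_, W.amplitude_congr j ξ (ht.trans_le (le_abs_self _)) (h1.trans_le (le_abs_self _))
        (iff_of_true (hh.trans ht) (hh.trans h1))⟩
      rw [abs_outerCoord _ _ hh, if_neg (not_le.2 (ht.trans_le (le_abs_self _))),
        abs_of_pos (hh.trans ht), e, abs_of_pos (by linarith)]
      ring
    · filter_upwards [hc.continuousAt.eventually_mem (Iio_mem_nhds
        (by simp; linarith : x + 0 * (outerCoord W.h x / R) < -W.h))] with t ht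
      have ht : x + t * (outerCoord W.h x / R) < -W.h := ht
      have e : outerCoord W.h x = x + W.h := by
        rw [outerCoord, if_pos (by linarith)]
      have ht' : W.h < |x + t * (outerCoord W.h x / R)| :=
        (by linarith : W.h < _).trans_le (neg_le_abs _)
      refine ⟨?_, W.amplitude_congr j ξ ht' (not_le.1 h0)
        (iff_of_false (by linarith) (by linarith))⟩
      rw [abs_outerCoord _ _ hh, if_neg (not_le.2 ht'), abs_of_neg (by linarith), e,
        abs_of_neg (by linarith)]
      ring

/-- The radiation condition for each of the two integrals over the continuous spectrum. -/
theorem exists_normal_derivative_bound (W : Waveguide) (j : Parity) {B : ℝ} (hB : 0 ≤ B) :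
    ∃ C R₀ : ℝ, 0 < R₀ ∧ ∀ R : ℝ, R₀ ≤ R → ∀ ξ ζ : ℝ, |ξ| ≤ B → |ζ| ≤ B →
      ∀ p ∈ frontier (W.Omega R), p.2 ≠ ζ →
        IntegrableOn (W.radIntegrand j p.1 p.2 ξ ζ) (Ioi W.dSq) ∧
        ∃ D : ℂ, HasLineDerivAt ℝ
            (fun r : ℝ × ℝ => ∫ lam in Ioi W.dSq, W.radIntegrand j r.1 r.2 ξ ζ lam) D p
            (W.normal R p) ∧
          ‖D - Complex.I * W.beta0 * ∫ lam in Ioi W.dSq, W.radIntegrand j p.1 p.2 ξ ζ lam‖ ≤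
            C * R ^ (-(3 / 2) : ℝ) := by
  obtain ⟨C, R₀, M, hR₀, hmain⟩ := W.exists_waveSum_radiation j hB
  refine ⟨1 / 2 * C, R₀, hR₀, fun R hR ξ ζ hξ hζ p hp hz => ?_⟩
  obtain ⟨x, z⟩ := p
  have hRp : 0 < R := hR₀.trans_le hR
  have hsq := W.sq_add_sq_eq_of_mem_frontier hp
  simp only at hsq hz ⊢
  obtain ⟨hc, hrad⟩ := hmain x ξ hξ
  have hZ : 0 < |z - ζ| := abs_pos.2 (sub_ne_zero.2 hz)
  -- the sign `s` of `z - ζ`, which is constant near the point considered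
  obtain ⟨s, hs1, hs⟩ : ∃ s : ℝ, |s| = 1 ∧ |z - ζ| = s * (z - ζ) := by
    rcases le_total 0 (z - ζ) with h | h
    · exact ⟨1, abs_one, by rw [abs_of_nonneg h, one_mul]⟩
    · exact ⟨-1, by simp, by rw [abs_of_nonpos h, neg_one_mul]⟩
  have hδ : |s * ζ| ≤ B := by rw [abs_mul, hs1, one_mul]; exact hζ
  -- `R` and `ρ` are the distances to two points at distance `|ζ|`
  have hρ : |Real.sqrt (|outerCoord W.h x| ^ 2 + |z - ζ| ^ 2) - R| ≤ B := by
    have h1 := abs_norm_sub_norm_le (⟨outerCoord W.h x, z - ζ⟩ : ℂ) ⟨outerCoord W.h x, z⟩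
    have h2 : (⟨outerCoord W.h x, z - ζ⟩ - ⟨outerCoord W.h x, z⟩ : ℂ) =
        ((-ζ : ℝ) : ℂ) * Complex.I := by
      apply Complex.ext <;> simp
    rw [h2, norm_mul, Complex.norm_I, mul_one, Complex.norm_real, Real.norm_eq_abs, abs_neg,
      Complex.norm_eq_sqrt_sq_add_sq, Complex.norm_eq_sqrt_sq_add_sq] at h1
    simp only at h1
    rw [hsq, Real.sqrt_sq hRp.le] at h1
    rw [sq_abs, sq_abs]
    exact h1.trans hζ
  obtain ⟨D, hD, hDb⟩ := hrad R |outerCoord W.h x| |z - ζ| (s * ζ) hR (abs_nonneg _) hZ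
    (fun h => by rw [abs_outerCoord _ _ W.h_pos, if_pos h]) hρ hδ
  have hint := W.integral_radIntegrand j hz hc
  refine ⟨hint.1, 1 / (2 * Complex.I) * D, ?_, ?_⟩
  · refine (hD.const_mul (1 / (2 * Complex.I))).congr_of_eventuallyEq ?_
    have hcs : Continuous fun t : ℝ => s * (z + t * (z / R) - ζ) := by fun_prop
    have hpos : ∀ᶠ t : ℝ in nhds 0, 0 < s * (z + t * (z / R) - ζ) :=
      hcs.continuousAt.eventually_mem (Ioi_mem_nhds (by
        rw [hs] at hZ
        simpa using hZ))
    filter_upwards [hpos, W.eventually_outerCoord_eq j x ξ R] with t ht ⟨ht1, ht2⟩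
    have hz' : z + t * (z / R) ≠ ζ := by
      intro h
      rw [h, sub_self, mul_zero] at ht
      exact lt_irrefl _ ht
    have habs : |z + t * (z / R) - ζ| = |z - ζ| + t * ((|z - ζ| + s * ζ) / R) := by
      rw [← one_mul |z + t * (z / R) - ζ|, ← hs1, ← abs_mul, abs_of_pos ht, hs]
      ring
    simp only [normal, Prod.smul_mk, Prod.mk_add_mk, smul_eq_mul]
    rw [(W.integral_radIntegrand j hz' (hmain _ ξ hξ).1).2, habs, ht1]
    simp only [waveSum, angularAmplitude, ht2]
  · rw [hint.2]
    have e : 1 / (2 * Complex.I) * D - Complex.I * W.beta0 * (1 / (2 * Complex.I) *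
        W.waveSum j x ξ |outerCoord W.h x| |z - ζ|) = 1 / (2 * Complex.I) *
          (D - Complex.I * W.beta0 * W.waveSum j x ξ |outerCoord W.h x| |z - ζ|) := by ring
    have h2 : ‖1 / (2 * Complex.I)‖ = 1 / 2 := by simp
    rw [e, norm_mul, h2, mul_assoc (1 / 2) C]
    gcongr

end Waveguide

theorem theorem3p3 (W : Waveguide) (B : ℝ) :
    ∃ C R₀ : ℝ, 0 < R₀ ∧ ∀ R : ℝ, R₀ ≤ R → ∀ ξ ζ : ℝ, |ξ| ≤ B → |ζ| ≤ B →
      ∀ p ∈ frontier (W.Omega R), p.2 ≠ ζ →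
        (∀ j : Parity, IntegrableOn (W.radIntegrand j p.1 p.2 ξ ζ) (Ioi W.dSq)) ∧
        LineDifferentiableAt ℝ (fun r : ℝ × ℝ => W.Grad r.1 r.2 ξ ζ) p (W.normal R p) ∧
        ‖lineDeriv ℝ (fun r : ℝ × ℝ => W.Grad r.1 r.2 ξ ζ) p (W.normal R p) -
            Complex.I * (W.beta0 : ℂ) * W.Grad p.1 p.2 ξ ζ‖ ≤ C * R ^ (-(3 / 2) : ℝ) := by
  obtain ⟨Cs, Rs, hRs, hs⟩ := W.exists_normal_derivative_bound .s (abs_nonneg B)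
  obtain ⟨Ca, Ra, -, ha⟩ := W.exists_normal_derivative_bound .a (abs_nonneg B)
  refine ⟨1 / (2 * Real.pi) * (Cs + Ca), max Rs Ra, lt_max_of_lt_left hRs,
    fun R hR ξ ζ hξ hζ p hp hz => ?_⟩
  have hξ' := hξ.trans (le_abs_self B)
  have hζ' := hζ.trans (le_abs_self B)
  obtain ⟨is, Ds, hDs, bs⟩ := hs R ((le_max_left _ _).trans hR) ξ ζ hξ' hζ' p hp hz
  obtain ⟨ia, Da, hDa, ba⟩ := ha R ((le_max_right _ _).trans hR) ξ ζ hξ' hζ' p hp hz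
  have hD : HasLineDerivAt ℝ (fun r : ℝ × ℝ => W.Grad r.1 r.2 ξ ζ)
      (1 / (2 * (Real.pi : ℂ)) * (Ds + Da)) p (W.normal R p) :=
    (HasDerivAt.add hDs hDa).const_mul (1 / (2 * (Real.pi : ℂ)))
  refine ⟨fun j => by cases j <;> assumption, hD.lineDifferentiableAt, ?_⟩
  rw [hD.lineDeriv, Waveguide.Grad]
  have e : ∀ c b S A : ℂ, c * (Ds + Da) - b * (c * (S + A)) =
      c * ((Ds - b * S) + (Da - b * A)) := by
    intros; ring
  have hn : ‖1 / (2 * (Real.pi : ℂ))‖ = 1 / (2 * Real.pi) := by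
    rw [norm_div, norm_one, norm_mul, Complex.norm_real, Real.norm_eq_abs, abs_of_pos Real.pi_pos,
      Complex.norm_two]
  rw [e, norm_mul, hn, mul_assoc (1 / (2 * Real.pi)), add_mul]
  gcongr
  exact (norm_add_le _ _).trans (add_le_add bs ba)
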